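/- Let $k$ be an algebraically closed field and let $G\subset \mathrm{GL}(3,k)$ be a finite cyclic group of diagonal matrices whose order $r$ is not divisible by the characteristic of $k$ and which contains no pseudo-reflections (elements $g$ with $\operatorname{rank}(g-1)=1$). Assume that the quotient variety $X=\mathbb{A}^3_k/G=\operatorname{Spec} k[x_1,x_2,x_3]^G$ has only canonical singularities. Fix a primitive $r$-th root of unity $\zeta\in k$. For $g=\operatorname{diag}(\zeta^{a_1},\zeta^{a_2},\zeta^{a_3})\in G$ with $a_i\in\mathbb{Z}$ put $\overline{g}=\frac1r(a_1,a_2,a_3)$, which is well defined modulo $\mathbb{Z}^3$, and let $$N=\mathbb{Z}^3+\sum_{g\in G}\mathbb{Z}\,\overline{g}\subset\mathbb{R}^3,\qquad M=\{x\in\mathbb{R}^3\mid (x,y)\in\mathbb{Z}\ \text{for all } y\in N\},$$ where $(\ ,\ )$ is the standard inner product. Let $\sigma=(\mathbb{R}_{\ge0})^3$, let $\sigma^\vee=\{x\in\mathbb{R}^3\mid (x,y)\ge 0\ \text{for all } y\in\sigma\}$ be its dual cone, and let $w$ be an element of the Hilbert basis (the smallest set of generators) of the monoid $\sigma\cap N$.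 Put $\Lambda^w_{(=1)}=\{x\in\sigma^\vee\mid (x,w)=1\}$. Then $$\Lambda^w_{(=1)}\cap M=\emptyset\quad\Longleftrightarrow\quad G\text{ is of type }\tfrac1{14}(1,9,11)\text{ and }w=\tfrac1{14}(7,7,7).$$ Here $G$ is of type $\frac1s(a,b,c)$ if, up to a permutation of the coordinates, it is generated by $\operatorname{diag}(\xi^a,\xi^b,\xi^c)$ for some primitive $s$-th root of unity $\xi$. -/

import Mathlib

open scoped Matrix

noncomputable section

namespace QuotSing

/-! ## Divisors over an affine variety, discrepancies, canonical singularities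

Throughout, `A` is the coordinate ring of an affine variety `X = Spec A` of dimension `d` over a
field `k`, and `FractionRing A` is its function field. -/

section Canonical

variable (k : Type*) (A : Type*) [Field k] [CommRing A] [IsDomain A] [Algebra k A]

/-- A divisor over the `d`-dimensional variety `X = Spec A`, that is, a prime divisor on some
normal variety with a proper birational morphism to `X`, given as its local ring in the function
field: a discrete valuation ring of the function field that contains `A` and whose residue field
has transcendence degree `d - 1` over `k`. -/
structure DivisorOver (d : ℕ) where
  /-- the local ring of the divisor -/
  ring : Subalgebra A (FractionRing A)
  isDVR : IsDiscreteValuationRing ring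
  isFractionRing : IsFractionRing ring (FractionRing A)
  trdeg_residueField : Algebra.trdeg k (IsLocalRing.ResidueField ring) + 1 = d

attribute [instance] DivisorOver.isDVR DivisorOver.isFractionRing

variable {k A}

/-- The (generic point of the) center on `X = Spec A` of a divisor over `X`. -/
def DivisorOver.center {d : ℕ} (E : DivisorOver k A d) : Ideal A :=
  (IsLocalRing.maximalIdeal E.ring).comap (algebraMap A E.ring)

/-- A divisor over `X` is exceptional if its center has codimension greater than one. -/
def DivisorOver.IsExceptional {d : ℕ} (E : DivisorOver k A d) : Prop :=
  1 < E.center.height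

/-- A divisor over `X` whose center has codimension one: for normal `X`, these are the prime
divisors on `X` itself. -/
def DivisorOver.IsPrimeDivisor {d : ℕ} (E : DivisorOver k A d) : Prop :=
  E.center.height = 1

variable (k A) in
/-- The one-dimensional vector space (over the function field) of rational `d`-forms on `X`. -/
abbrev RationalForms (d : ℕ) : Type _ :=
  ⋀[FractionRing A]^d (Ω[FractionRing A⁄k])

/-- The rational `d`-forms that are regular along the divisor `E`: the image of the top exterior
power of the Kähler differentials of the local ring of `E`. It is a free module of rank one over
this local ring. -/
def DivisorOver.regularForms {d : ℕ} (E : DivisorOver k A d) :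
    Submodule E.ring (RationalForms k A d) :=
  Submodule.span E.ring
    {ω | ∃ f : Fin d → E.ring, ω = exteriorPower.ιMulti (FractionRing A) d
      (fun i => KaehlerDifferential.D k (FractionRing A) (f i : FractionRing A))}

/-- The rational `m`-canonical form `h • ω₀ ^ (⊗ m)` has order `e` along the divisor `E`. Here `η`
is a generator of the `d`-forms regular along `E` and `ϖ` is a uniformizer of the local ring of
`E`. (As the rational `d`-forms are one-dimensional over the function field, every rational
`m`-canonical form is of this shape, for any `ω₀ ≠ 0`.) -/
def DivisorOver.HasOrder {d : ℕ} (E : DivisorOver k A d) (h : FractionRing A)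
    (ω₀ : RationalForms k A d) (m : ℕ) (e : ℤ) : Prop :=
  ∃ (η : RationalForms k A d) (c : FractionRing A) (ϖ : E.ring) (u : E.ringˣ),
    Submodule.span E.ring {η} = E.regularForms ∧ ω₀ = c • η ∧ Irreducible ϖ ∧
      h * c ^ m = ((u : E.ring) : FractionRing A) * (ϖ : FractionRing A) ^ e

/-- `a` is the discrepancy of the divisor `E` over `X`, the coefficient of `E` in the relative
canonical divisor: there is an `m ≥ 1` such that `m K_X` is Cartier at the generic point of the
center of `E`, with local generator the `m`-canonical form `h • ω₀ ^ (⊗ m)` (it has neither zeros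
nor poles along the prime divisors of `X` through that point), and the order along `E` of this
generator is `m * a`. -/
def DivisorOver.HasDiscrepancy {d : ℕ} (E : DivisorOver k A d) (a : ℚ) : Prop :=
  ∃ (m : ℕ) (h : FractionRing A) (ω₀ : RationalForms k A d) (e : ℤ),
    0 < m ∧ h ≠ 0 ∧ ω₀ ≠ 0 ∧
    (∀ P : DivisorOver k A d, P.IsPrimeDivisor → P.center ≤ E.center → P.HasOrder h ω₀ m 0) ∧
    E.HasOrder h ω₀ m e ∧ a = e / m

variable (k A) in
/-- `Spec A` is a normal variety of dimension `d` over `k` with only canonical singularities: it is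
`ℚ`-Gorenstein, so that discrepancies are defined, and the discrepancy of every exceptional divisor
over it is non-negative. -/
structure IsCanonical (d : ℕ) : Prop where
  finiteType : Algebra.FiniteType k A
  isIntegrallyClosed : IsIntegrallyClosed A
  trdeg_eq : Algebra.trdeg k (FractionRing A) = d
  discrepancy_nonneg : ∀ E : DivisorOver k A d, E.IsExceptional →
    ∃ a : ℚ, E.HasDiscrepancy a ∧ 0 ≤ a

end Canonical

/-! ## Quotients of affine space -/

section Quotient

variable {k : Type*} [Field k] {d : ℕ}

/-- The linear substitution `x_i ↦ ∑ j, g i j * x_j` of the coordinates of `𝔸^d`. -/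
def linearSubst (g : Matrix.GeneralLinearGroup (Fin d) k) :
    MvPolynomial (Fin d) k →ₐ[k] MvPolynomial (Fin d) k :=
  MvPolynomial.aeval fun i => ∑ j, MvPolynomial.C (g.val i j) * MvPolynomial.X j

/-- The ring of invariants of `G`, the coordinate ring of the quotient variety `𝔸^d / G`. -/
def invariantRing (G : Subgroup (Matrix.GeneralLinearGroup (Fin d) k)) :
    Subalgebra k (MvPolynomial (Fin d) k) where
  carrier := {f | ∀ g ∈ G, linearSubst g f = f}
  mul_mem' ha hb g hg := by rw [map_mul, ha g hg, hb g hg]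
  add_mem' ha hb g hg := by rw [map_add, ha g hg, hb g hg]
  algebraMap_mem' r g _ := AlgHom.commutes _ r

/-- `G` contains no pseudo-reflections, that is, no element whose fixed locus is a hyperplane. -/
def IsSmall (G : Subgroup (Matrix.GeneralLinearGroup (Fin d) k)) : Prop :=
  ∀ g ∈ G, (g.val - 1).rank ≠ 1

/-- The invertible diagonal matrix with given diagonal entries. -/
def diagGL (t : Fin d → kˣ) : Matrix.GeneralLinearGroup (Fin d) k where
  val := Matrix.diagonal fun i => (t i : k)
  inv := Matrix.diagonal fun i => ((t i)⁻¹ : kˣ)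
  val_inv := by simp [Matrix.diagonal_mul_diagonal]
  inv_val := by simp [Matrix.diagonal_mul_diagonal]

/-- `G` is of type `1/r (a_1, …, a_d)`: up to a permutation of the coordinates, it is generated by
`diag (ζ ^ a_1, …, ζ ^ a_d)` for a primitive `r`-th root of unity `ζ`. -/
def IsOfType (G : Subgroup (Matrix.GeneralLinearGroup (Fin d) k)) (r : ℕ) (a : Fin d → ℕ) : Prop :=
  ∃ ζ : kˣ, IsPrimitiveRoot ζ r ∧ ∃ π : Equiv.Perm (Fin d),
    G = Subgroup.zpowers (diagGL fun i => ζ ^ a (π i))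

end Quotient

/-! ## Toric data of a diagonal quotient -/

section Toric

variable {k : Type*} [Field k] {d : ℕ}

/-- The lattice `N = ℤ^d + ∑_{g ∈ G} ℤ ḡ`, where for a primitive `r`-th root of unity `ζ`, with `r`
the order of `G`, the element `ḡ` corresponding to `g = diag (ζ ^ a_1, …, ζ ^ a_d)` is
`(a_1 / r, …, a_d / r)` (well defined modulo `ℤ^d`). -/
def latticeN (G : Subgroup (Matrix.GeneralLinearGroup (Fin d) k)) (ζ : kˣ) :
    AddSubgroup (Fin d → ℝ) :=
  AddSubgroup.closure
    ({y | ∃ z : Fin d → ℤ, y = fun i => (z i : ℝ)} ∪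
      {y | ∃ a : Fin d → ℤ, diagGL (fun i => ζ ^ a i) ∈ G ∧
        y = fun i => (a i : ℝ) / (Nat.card G : ℝ)})

/-- The dual lattice of `N`. -/
def dualLattice (N : AddSubgroup (Fin d → ℝ)) : Set (Fin d → ℝ) :=
  {x | ∀ y ∈ N, ∃ n : ℤ, x ⬝ᵥ y = n}

variable (d) in
/-- The cone `σ = (ℝ_{≥ 0})^d`. -/
def coneσ : AddSubmonoid (Fin d → ℝ) where
  carrier := {y | ∀ i, 0 ≤ y i}
  zero_mem' _ := le_rfl
  add_mem' ha hb i := add_nonneg (ha i) (hb i)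

/-- The dual of a cone. -/
def dualCone (S : AddSubmonoid (Fin d → ℝ)) : Set (Fin d → ℝ) :=
  {x | ∀ y ∈ S, 0 ≤ x ⬝ᵥ y}

/-- The level `c` subpolyhedron `Λ^w_{(=c)}` of the dual cone of `σ`. -/
def levelPolyhedron (w : Fin d → ℝ) (c : ℝ) : Set (Fin d → ℝ) :=
  dualCone (coneσ d) ∩ {a | a ⬝ᵥ w = c}

/-- The Hilbert basis of a monoid, its smallest set of generators: the elements that lie in every
set of generators. -/
def hilbertBasis (B : AddSubmonoid (Fin d → ℝ)) : Set (Fin d → ℝ) :=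
  {w | ∀ S : Set (Fin d → ℝ), AddSubmonoid.closure S = B → w ∈ S}

end Toric

end QuotSing

end

/-!
The theorem separates into a geometric input, which turns the assumption on the singularities of
`𝔸³ / G` into a condition on the lattice `N`, and a question about plane lattice geometry.

**Ages.** Write `r` for the order of `G`, and call the coordinate sum of an element of `N` its age.
The ring of invariants is spanned by the monomials with exponents in `M` (`isToric_invariantRing`).
Its function field is generated by the Laurent monomials of any basis of `M`, so that every basis
gives a birational chart of affine space, and a primitive element `v` of `N` in the octant is the
weight of a coordinate divisor `E` of such a chart. If `v` has at least two positive coordinates,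
then `E` is exceptional, and its discrepancy has to be `∑ vᵢ - 1`. This is seen from the "defect"
`ord_E - ∑ vᵢ ord_{xᵢ}`, a homomorphism from the nonzero rational functions to the reals: it
vanishes on monomials, and it is nonnegative on Laurent polynomials, as the order of a sum is the
minimum of the orders of its monomials. Hence it vanishes on each prime of the chart outside the
toric boundary whose divisor does not pass through the generic point of the center of `E`, and so
also on the quotient of a local generator of the pluricanonical forms by a power of the logarithmic
volume form, which has neither zeros nor poles along the other ones (`IsToric.defect_eq_zero`). If
the singularities are canonical, it follows that every nonzero element of `N` in the octant has age
at least one (`IsToric.one_le_sum`, `card_le_sum_of_isCanonical`). That `G` has no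
pseudo-reflections enters through the existence of invariant Laurent monomials in which a given
variable has exponent one (`exists_dualExponents_eq_one`).

**Unimodular triangles.** The lattice `N` is scaled to the lattice `L = r N` of integer vectors. The
elements of `N` of age one in the octant, the junior elements, are the lattice points of a triangle
whose vertices are the unit vectors. A lattice polygon can be cut into unimodular triangles, so that
an irreducible element `w` of integral age is junior (`exists_unimodular`), and a junior element
other than a unit vector is the midpoint of two junior elements or the centroid of three, with
unimodular triangles around it (`exists_unimodular_of_junior`). Let `1 / m` be the least positive
age in `N`, and `u` an element of this age. As there are no elements of smaller age than one in the
octant apart from `0`, the tetrahedron over a unimodular triangle `a b c` contains no further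
lattice points, and White's theorem on such tetrahedra (`exists_eq_one_of_sum_mod`,
`IsCanonicalLattice.eq_one`) says that the coefficients of `m u = α a + β b + γ c` are units modulo
`m`, one of which is `1`, if `m ≥ 2`.

**Level one points.** The required element of `M` is mostly the sum of the three coordinates, or
this sum plus or minus one coordinate with respect to a suitable unimodular triangle. For `m = 1`
the sum of the coordinates lies in `M` and takes the value one on `w`. For `m ≥ 3`, White's theorem
leaves little room: it settles the case that only the unit vectors are junior, and otherwise all
junior elements lie on one side of a line on which there is a midpoint
(`IsCanonicalLattice.coord_nonneg`), which makes the sum of two of the coordinates an element of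
`M`, and a centroid is possible only for the group of type `1/9 (1, 4, 7)`
(`hasLevelOnePoint_of_centroid`). For `m = 2`, a junior element never has three odd coefficients
with respect to a unimodular triangle, as it could then be halved
(`IsCanonicalLattice.not_isJunior_of_odd`). If `w` is junior, it is a midpoint, and the sum of the
coordinates plus or minus the coefficient function that vanishes on this line will do. Otherwise
`w = (a + b + c) / 2` for a unimodular triangle `a b c`, and the sum of the coordinates minus any
one of the coefficient functions of the triangle takes the value one on `w`. These three vectors of
`M` all have negative entries only if the unit vectors are `2 a - b`, `2 b - c` and `2 c - a` in
some order, up to exchanging `b` and `c` (`hasLevelOnePoint_or_isFourteen_of_not_dvd`,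
`isFourteen_of_cyclic`), which is the exceptional lattice.

Conversely, in the exceptional case an element of `M` at level one would be the exponent vector of
an invariant monomial of degree two, and there is none (`levelPolyhedron_inter_eq_empty`).
-/


noncomputable section

namespace QuotSing

section

open MvPolynomial

/-! ### Charts and the local rings of their divisors -/

section Chart

variable (k : Type*) (A : Type*) [Field k] [CommRing A] [IsDomain A] [Algebra k A]

/-- A birational map from affine three-space to `Spec A`, given as an identification of the
function field of `A` with the field of fractions of a polynomial ring in three variables. -/
structure Chart where
  /-- the embedding of the polynomial ring into the function field -/
  θ : MvPolynomial (Fin 3) k →ₐ[k] FractionRing A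
  inj : Function.Injective θ
  surj : ∀ z : FractionRing A, ∃ p s, s ≠ 0 ∧ z = θ p / θ s

variable {k A}

namespace Chart

variable (c : Chart k A) {q : MvPolynomial (Fin 3) k}

lemma map_ne_zero {p : MvPolynomial (Fin 3) k} (hp : p ≠ 0) : c.θ p ≠ 0 := by
  simpa using (map_ne_zero_iff c.θ c.inj).2 hp

lemma ne_zero_of_not_dvd {p : MvPolynomial (Fin 3) k} (hp : ¬ q ∣ p) : p ≠ 0 := by
  rintro rfl; exact hp (dvd_zero _)

/-- The rational function `z` has order `n` along the prime divisor `q = 0` of the chart. -/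
def HasOrd (q : MvPolynomial (Fin 3) k) (z : FractionRing A) (n : ℤ) : Prop :=
  ∃ p s, ¬ q ∣ p ∧ ¬ q ∣ s ∧ z = c.θ q ^ n * (c.θ p / c.θ s)

variable {c}

lemma HasOrd.ne_zero (hq : Prime q) {z : FractionRing A} {n : ℤ} (h : c.HasOrd q z n) :
    z ≠ 0 := by
  obtain ⟨p, s, hp, hs, rfl⟩ := h
  exact mul_ne_zero (zpow_ne_zero _ (c.map_ne_zero hq.ne_zero))
    (div_ne_zero (c.map_ne_zero (ne_zero_of_not_dvd hp)) (c.map_ne_zero (ne_zero_of_not_dvd hs)))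

lemma HasOrd.mul (hq : Prime q) {z z' : FractionRing A} {n n' : ℤ} (h : c.HasOrd q z n)
    (h' : c.HasOrd q z' n') : c.HasOrd q (z * z') (n + n') := by
  obtain ⟨p, s, hp, hs, rfl⟩ := h
  obtain ⟨p', s', hp', hs', rfl⟩ := h'
  refine ⟨p * p', s * s', fun h => (hq.dvd_or_dvd h).elim hp hp',
    fun h => (hq.dvd_or_dvd h).elim hs hs', ?_⟩
  rw [zpow_add₀ (c.map_ne_zero hq.ne_zero), map_mul, map_mul]
  ring

lemma HasOrd.inv {z : FractionRing A} {n : ℤ} (h : c.HasOrd q z n) :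
    c.HasOrd q z⁻¹ (-n) := by
  obtain ⟨p, s, hp, hs, rfl⟩ := h
  exact ⟨s, p, hs, hp, by rw [mul_inv, inv_div, zpow_neg]⟩

lemma hasOrd_one (hq : Prime q) : c.HasOrd q 1 0 :=
  ⟨1, 1, fun h => hq.not_isUnit (isUnit_of_dvd_one h), fun h => hq.not_isUnit (isUnit_of_dvd_one h),
    by simp⟩

lemma HasOrd.pow (hq : Prime q) {z : FractionRing A} {n : ℤ} (h : c.HasOrd q z n) (m : ℕ) :
    c.HasOrd q (z ^ m) (m * n) := by
  induction m with
  | zero => simpa using hasOrd_one hq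
  | succ m ih =>
    rw [pow_succ, Nat.cast_succ, add_mul, one_mul]
    exact ih.mul hq h

lemma HasOrd.zpow (hq : Prime q) {z : FractionRing A} {n : ℤ} (h : c.HasOrd q z n) (m : ℤ) :
    c.HasOrd q (z ^ m) (m * n) := by
  obtain ⟨j, rfl | rfl⟩ := m.eq_nat_or_neg
  · simpa using h.pow hq j
  · simpa using (h.pow hq j).inv

lemma hasOrd_of_not_dvd (hq : Prime q) {p : MvPolynomial (Fin 3) k} (hp : ¬ q ∣ p) :
    c.HasOrd q (c.θ p) 0 :=
  ⟨p, 1, hp, fun h => hq.not_isUnit (isUnit_of_dvd_one h), by simp⟩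

lemma hasOrd_self (hq : Prime q) : c.HasOrd q (c.θ q) 1 :=
  ⟨1, 1, fun h => hq.not_isUnit (isUnit_of_dvd_one h), fun h => hq.not_isUnit (isUnit_of_dvd_one h),
    by simp⟩

lemma exists_hasOrd_poly (hq : Prime q) {p : MvPolynomial (Fin 3) k} (hp : p ≠ 0) :
    ∃ n : ℕ, c.HasOrd q (c.θ p) n := by
  obtain ⟨p', h, hp'⟩ :=
    (FiniteMultiplicity.of_prime_left hq hp).exists_eq_pow_mul_and_not_dvd
  refine ⟨multiplicity q p, ?_⟩
  rw [h, map_mul, map_pow, ← h]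
  simpa using ((hasOrd_self (c := c) hq).pow hq (multiplicity q p)).mul hq
    (hasOrd_of_not_dvd hq hp')

lemma exists_hasOrd (hq : Prime q) {z : FractionRing A} (hz : z ≠ 0) :
    ∃ n, c.HasOrd q z n := by
  obtain ⟨p, s, hs, rfl⟩ := c.surj z
  have hp : p ≠ 0 := by rintro rfl; simp at hz
  obtain ⟨n, hn⟩ := exists_hasOrd_poly (c := c) hq hp
  obtain ⟨n', hn'⟩ := exists_hasOrd_poly (c := c) hq hs
  exact ⟨_, hn.mul hq hn'.inv⟩

/-- The order of a quotient of polynomials with denominator prime to `q` is nonnegative, and it is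
positive only if `q` divides the numerator. -/
lemma hasOrd_nonneg_of_dvd (hq : Prime q) {p s : MvPolynomial (Fin 3) k} {n : ℤ} (hs : ¬ q ∣ s)
    (h : c.HasOrd q (c.θ p / c.θ s) n) : 0 ≤ n ∧ (q ∣ p ↔ 0 < n) := by
  obtain ⟨p', s', hp', hs', h⟩ := h
  have h1 := c.map_ne_zero (ne_zero_of_not_dvd hs)
  have h2 := c.map_ne_zero (ne_zero_of_not_dvd hs')
  have h3 := c.map_ne_zero hq.ne_zero
  obtain ⟨j, rfl | rfl⟩ := n.eq_nat_or_neg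
  · have : p * s' = q ^ j * (p' * s) := by
      apply c.inj
      rw [zpow_natCast] at h
      simp only [map_mul, map_pow]
      field_simp at h
      linear_combination h
    refine ⟨by positivity, ?_⟩
    rcases Nat.eq_zero_or_pos j with rfl | hj
    · simp only [CharP.cast_eq_zero, lt_self_iff_false, iff_false]
      intro hp
      have : q ∣ p' * s := by
        rw [pow_zero, one_mul] at this
        rw [← this]; exact hp.mul_right _
      exact (hq.dvd_or_dvd this).elim hp' hs
    · simp only [Nat.cast_pos, hj, iff_true]
      have : q ∣ p * s' := by rw [this]; exact (dvd_pow_self q hj.ne').mul_right _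
      exact (hq.dvd_or_dvd this).resolve_right hs'
  · have : q ^ j * (p * s') = p' * s := by
      apply c.inj
      rw [zpow_neg, zpow_natCast] at h
      simp only [map_mul, map_pow]
      field_simp at h
      linear_combination h
    rcases Nat.eq_zero_or_pos j with rfl | hj
    · simp only [CharP.cast_eq_zero, neg_zero, le_refl, lt_self_iff_false, iff_false, true_and]
      intro hp
      have : q ∣ p' * s := by
        rw [pow_zero, one_mul] at this
        rw [← this]; exact hp.mul_right _
      exact (hq.dvd_or_dvd this).elim hp' hs
    · have : q ∣ p' * s := by rw [← this]; exact (dvd_pow_self q hj.ne').mul_right _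
      exact ((hq.dvd_or_dvd this).elim hp' hs).elim

lemma HasOrd.unique (hq : Prime q) {z : FractionRing A} {n n' : ℤ} (h : c.HasOrd q z n)
    (h' : c.HasOrd q z n') : n = n' := by
  have key : ∀ {a : ℤ}, c.HasOrd q (1 : FractionRing A) a → 0 ≤ a := by
    intro a ha
    have h1 : ¬ q ∣ 1 := fun h => hq.not_isUnit (isUnit_of_dvd_one h)
    refine (hasOrd_nonneg_of_dvd (c := c) hq (p := 1) (s := 1) h1 ?_).1
    simpa using ha
  have h0 := h.ne_zero hq
  have h1 := key (by simpa [mul_inv_cancel₀ h0] using h.mul hq h'.inv)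
  have h2 := key (by simpa [mul_inv_cancel₀ h0] using h'.mul hq h.inv)
  omega

variable (c)

/-- Regularity of a rational function at the generic point of the divisor `q = 0`. -/
def IsRegularAlong (q : MvPolynomial (Fin 3) k) (z : FractionRing A) : Prop :=
  ∃ p s, ¬ q ∣ s ∧ z = c.θ p / c.θ s

variable {c}

lemma HasOrd.isRegularAlong {z : FractionRing A} {n : ℤ} (h : c.HasOrd q z n) (hn : 0 ≤ n) :
    c.IsRegularAlong q z := by
  obtain ⟨p, s, hp, hs, rfl⟩ := h
  lift n to ℕ using hn
  exact ⟨q ^ n * p, s, hs, by simp [mul_div_assoc]⟩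

lemma HasOrd.nonneg_of_isRegularAlong (hq : Prime q) {z : FractionRing A} {n : ℤ}
    (h : c.HasOrd q z n) (hz : c.IsRegularAlong q z) : 0 ≤ n := by
  obtain ⟨p, s, hs, rfl⟩ := hz
  exact (hasOrd_nonneg_of_dvd hq hs h).1

variable (c)

/-- The local ring of the divisor `q = 0` of the chart, as a ring of rational functions. -/
def localRing (hq : Prime q)
    (hA : ∀ f : A, c.IsRegularAlong q (algebraMap A (FractionRing A) f)) :
    Subalgebra A (FractionRing A) where
  carrier := {z | c.IsRegularAlong q z}
  mul_mem' := by
    rintro _ _ ⟨p, s, hs, rfl⟩ ⟨p', s', hs', rfl⟩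
    exact ⟨p * p', s * s', fun h => (hq.dvd_or_dvd h).elim hs hs', by
      rw [map_mul, map_mul, div_mul_div_comm]⟩
  add_mem' := by
    rintro _ _ ⟨p, s, hs, rfl⟩ ⟨p', s', hs', rfl⟩
    refine ⟨p * s' + s * p', s * s', fun h => (hq.dvd_or_dvd h).elim hs hs', ?_⟩
    rw [map_add, map_mul, map_mul, map_mul, div_add_div _ _
      (c.map_ne_zero (ne_zero_of_not_dvd hs)) (c.map_ne_zero (ne_zero_of_not_dvd hs'))]
  algebraMap_mem' := hA

variable (hq : Prime q)
    (hA : ∀ f : A, c.IsRegularAlong q (algebraMap A (FractionRing A) f))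

include hq in
lemma isRegularAlong_θ (p : MvPolynomial (Fin 3) k) : c.IsRegularAlong q (c.θ p) :=
  ⟨p, 1, fun h => hq.not_isUnit (isUnit_of_dvd_one h), by simp⟩

/-- A polynomial in the coordinates of a chart, as an element of the local ring. -/
def toLocalRing : MvPolynomial (Fin 3) k →ₐ[k] c.localRing hq hA where
  toFun p := ⟨c.θ p, c.isRegularAlong_θ hq p⟩
  map_one' := by ext; simp
  map_mul' _ _ := by ext; simp
  map_zero' := by ext; simp
  map_add' _ _ := by ext; simp
  commutes' r := by
    apply Subtype.ext
    exact c.θ.commutes r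

@[simp] lemma coe_toLocalRing (p : MvPolynomial (Fin 3) k) :
    (c.toLocalRing hq hA p : FractionRing A) = c.θ p := rfl

lemma isUnit_localRing_iff {z : c.localRing hq hA} :
    IsUnit z ↔ c.HasOrd q (z : FractionRing A) 0 := by
  constructor
  · intro h
    obtain ⟨u, rfl⟩ := h
    have h0 : ((u : c.localRing hq hA) : FractionRing A) ≠ 0 := by
      simp
    obtain ⟨n, hn⟩ := exists_hasOrd (c := c) hq h0
    have h1 := hn.nonneg_of_isRegularAlong hq (u : c.localRing hq hA).2
    have h2 : c.IsRegularAlong q (((u : c.localRing hq hA) : FractionRing A)⁻¹) := by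
      have := ((u⁻¹ : (c.localRing hq hA)ˣ) : c.localRing hq hA).2
      have e : (((u⁻¹ : (c.localRing hq hA)ˣ) : c.localRing hq hA) : FractionRing A) =
          ((u : c.localRing hq hA) : FractionRing A)⁻¹ := by
        exact eq_inv_of_mul_eq_one_left (congrArg Subtype.val u.inv_mul)
      rw [← e]; exact this
    have h3 := hn.inv.nonneg_of_isRegularAlong hq h2
    have : n = 0 := by omega
    rwa [this] at hn
  · intro h
    have h0 := h.ne_zero hq
    have h' : c.IsRegularAlong q (z : FractionRing A)⁻¹ := h.inv.isRegularAlong (by simp)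
    refine IsUnit.of_mul_eq_one ⟨_, h'⟩ ?_
    apply Subtype.ext
    exact mul_inv_cancel₀ h0

lemma irreducible_toLocalRing : Irreducible (c.toLocalRing hq hA q) := by
  refine ⟨fun h => ?_, fun a b hab => ?_⟩
  · rw [isUnit_localRing_iff, coe_toLocalRing] at h
    exact absurd (h.unique hq (hasOrd_self hq)) (by simp)
  · have hab' := congrArg Subtype.val hab
    simp only [coe_toLocalRing, MulMemClass.coe_mul] at hab'
    have hne := c.map_ne_zero hq.ne_zero
    rw [hab'] at hne
    obtain ⟨n, hn⟩ := exists_hasOrd (c := c) hq (left_ne_zero_of_mul hne)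
    obtain ⟨m, hm⟩ := exists_hasOrd (c := c) hq (right_ne_zero_of_mul hne)
    have h1 := hn.nonneg_of_isRegularAlong hq a.2
    have h2 := hm.nonneg_of_isRegularAlong hq b.2
    have h3 := (hn.mul hq hm).unique hq (hab' ▸ hasOrd_self hq)
    rw [isUnit_localRing_iff, isUnit_localRing_iff]
    rcases (show n = 0 ∨ m = 0 by omega) with rfl | rfl
    · exact Or.inl hn
    · exact Or.inr hm

instance isDVR_localRing : IsDiscreteValuationRing (c.localRing hq hA) := by
  apply IsDiscreteValuationRing.ofHasUnitMulPowIrreducibleFactorization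
  refine ⟨_, c.irreducible_toLocalRing hq hA, fun {x} hx => ?_⟩
  have hx0 : (x : FractionRing A) ≠ 0 := by simpa using hx
  obtain ⟨n, hn⟩ := exists_hasOrd (c := c) hq hx0
  have h1 := hn.nonneg_of_isRegularAlong hq x.2
  lift n to ℕ using h1
  obtain ⟨p, s, hp, hs, hx'⟩ := hn
  have hu : c.HasOrd q (c.θ p / c.θ s) 0 := ⟨p, s, hp, hs, by simp⟩
  refine ⟨n, (IsUnit.unit ((c.isUnit_localRing_iff hq hA (z := ⟨_, hu.isRegularAlong le_rfl⟩)).2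
    hu)), ?_⟩
  apply Subtype.ext
  simp [hx']

instance isFractionRing_localRing : IsFractionRing (c.localRing hq hA) (FractionRing A) := by
  refine IsFractionRing.of_field _ _ fun z => ?_
  obtain ⟨p, s, hs, rfl⟩ := c.surj z
  exact ⟨c.toLocalRing hq hA p, c.toLocalRing hq hA s, rfl⟩

lemma mem_maximalIdeal_iff {z : c.localRing hq hA} {n : ℤ}
    (hz : c.HasOrd q (z : FractionRing A) n) :
    z ∈ IsLocalRing.maximalIdeal (c.localRing hq hA) ↔ 0 < n := by
  rw [IsLocalRing.mem_maximalIdeal, mem_nonunits_iff, isUnit_localRing_iff]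
  have := hz.nonneg_of_isRegularAlong hq z.2
  constructor
  · intro h
    by_contra h'
    exact h ((show n = 0 by omega) ▸ hz)
  · intro h h'
    have := hz.unique hq h'
    omega

lemma toLocalRing_mem_maximalIdeal_iff {p : MvPolynomial (Fin 3) k} :
    c.toLocalRing hq hA p ∈ IsLocalRing.maximalIdeal (c.localRing hq hA) ↔ q ∣ p := by
  by_cases hp : p = 0
  · simp [hp]
  obtain ⟨n, hn⟩ := exists_hasOrd (c := c) hq (c.map_ne_zero hp)
  rw [c.mem_maximalIdeal_iff hq hA (n := n) (by simpa using hn)]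
  have h1 : ¬ q ∣ 1 := fun h => hq.not_isUnit (isUnit_of_dvd_one h)
  exact ((hasOrd_nonneg_of_dvd (c := c) hq (p := p) (s := 1) h1 (by simpa using hn)).2).symm

/-- The residue field of the divisor `q = 0` of a chart of dimension three has transcendence
degree two: the three coordinates generate it up to algebraic elements, they satisfy the relation
`q`, and dropping a coordinate that occurs in `q` leaves algebraically independent elements. -/
lemma trdeg_residueField :
    Algebra.trdeg k (IsLocalRing.ResidueField (c.localRing hq hA)) = 2 := by
  set κ := IsLocalRing.ResidueField (c.localRing hq hA)
  let ρ : MvPolynomial (Fin 3) k →ₐ[k] κ :=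
    (IsScalarTower.toAlgHom k (c.localRing hq hA) κ).comp (c.toLocalRing hq hA)
  have hρ : ∀ p, ρ p = 0 ↔ q ∣ p := by
    intro p
    rw [← c.toLocalRing_mem_maximalIdeal_iff hq hA, ← IsLocalRing.residue_eq_zero_iff]
    rfl
  have hρX : ρ = aeval (fun i => ρ (X i)) := by
    ext i; simp
  have halg : Algebra.IsAlgebraic (Algebra.adjoin k (Set.range fun i => ρ (X i))) κ := by
    have hmem : ∀ p, ρ p ∈ Algebra.adjoin k (Set.range fun i => ρ (X i)) := by
      intro p
      rw [hρX, Algebra.adjoin_range_eq_range_aeval]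
      simp
    refine ⟨fun z => ?_⟩
    obtain ⟨⟨z, p, s, hs, rfl⟩, rfl⟩ := IsLocalRing.residue_surjective z
    have hs0 : ρ s ≠ 0 := by rwa [Ne, hρ]
    have : (IsLocalRing.residue (c.localRing hq hA)) ⟨c.θ p / c.θ s, p, s, hs, rfl⟩ =
        ρ p * (ρ s)⁻¹ := by
      rw [eq_mul_inv_iff_mul_eq₀ hs0]
      change IsLocalRing.residue (c.localRing hq hA) _ *
        IsLocalRing.residue (c.localRing hq hA) (c.toLocalRing hq hA s) =
        IsLocalRing.residue (c.localRing hq hA) (c.toLocalRing hq hA p)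
      rw [← map_mul]
      congr 1
      apply Subtype.ext
      exact div_mul_cancel₀ _ (c.map_ne_zero (ne_zero_of_not_dvd hs))
    rw [this]
    have h1 : ∀ p, IsAlgebraic (Algebra.adjoin k (Set.range fun i => ρ (X i))) (ρ p) := fun p =>
      isAlgebraic_algebraMap (⟨ρ p, hmem p⟩ : Algebra.adjoin k (Set.range fun i => ρ (X i)))
    exact (h1 p).mul (h1 s).inv
  have hlt : Algebra.trdeg k κ < 3 := by
    by_contra h
    push Not at h
    have h3 : IsTranscendenceBasis k (fun i => ρ (X i)) := by
      refine Algebra.IsAlgebraic.isTranscendenceBasis_of_lift_le_trdeg_of_finite k (fun i => ρ (X i)) ?_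
      simpa using h
    have hinj := h3.1
    rw [AlgebraicIndependent, ← hρX] at hinj
    exact hq.ne_zero (hinj (by rw [map_zero, hρ]))
  have hle : Algebra.trdeg k κ ≤ 2 := by
    have h3 : (3 : Cardinal) = Order.succ ((2 : ℕ) : Cardinal) := by
      rw [Cardinal.succ_natCast]; norm_num
    rw [h3] at hlt
    exact_mod_cast Order.lt_succ_iff.1 hlt
  refine le_antisymm hle ?_
  obtain ⟨i, hi⟩ : ∃ i, degreeOf i q ≠ 0 := by
    by_contra h
    push Not at h
    have : q.vars = ∅ := by
      ext i
      simp [mem_vars_iff_degreeOf_ne_zero, h i]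
    rw [vars_eq_empty_iff_eq_C] at this
    rw [this] at hq
    refine hq.not_isUnit ((isUnit_iff_ne_zero.2 ?_).map C)
    rintro h0
    rw [h0] at hq
    exact hq.ne_zero (by simp)
  have hind : AlgebraicIndependent k (fun j : {j // j ≠ i} => ρ (X j)) := by
    rw [AlgebraicIndependent, injective_iff_map_eq_zero]
    intro g hg
    have : ρ (rename (Subtype.val) g) = 0 := by
      rw [hρX, aeval_rename]
      exact hg
    rw [hρ] at this
    obtain ⟨t, ht⟩ := this
    by_contra hg0
    have hg' : rename (Subtype.val : {j // j ≠ i} → Fin 3) g ≠ 0 := fun h =>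
      hg0 (rename_injective _ Subtype.val_injective (by rw [h, map_zero]))
    have ht0 : t ≠ 0 := by rintro rfl; simp [ht] at hg'
    have hdeg : degreeOf i (rename (Subtype.val : {j // j ≠ i} → Fin 3) g) = 0 := by
      by_contra h
      rw [← Ne, ← mem_vars_iff_degreeOf_ne_zero] at h
      have := vars_rename (Subtype.val : {j // j ≠ i} → Fin 3) g h
      simp at this
    rw [ht, degreeOf_mul_eq hq.ne_zero ht0] at hdeg
    omega
  have := hind.lift_cardinalMk_le_trdeg
  simpa using this

end Chart

end Chart

end

section

open MvPolynomial

/-! ### Volume forms and the divisors of a chart -/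

/-- An alternating map multiplies by the determinant under a linear substitution. -/
lemma alternatingMap_sum_smul {R V W : Type*} [CommRing R] [AddCommGroup V] [Module R V]
    [AddCommGroup W] [Module R W] {n : ℕ} (g : V [⋀^Fin n]→ₗ[R] W) (C : Matrix (Fin n) (Fin n) R)
    (v : Fin n → V) : g (fun i => ∑ j, C i j • v j) = C.det • g v := by
  have key : g.compLinearMap (Fintype.linearCombination R v) =
      (LinearMap.toSpanSingleton R W (g v)).compAlternatingMap Matrix.detRowAlternating := by
    refine (Pi.basisFun R (Fin n)).ext_alternating fun σ hσ => ?_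
    obtain ⟨τ, rfl⟩ : ∃ τ : Equiv.Perm (Fin n), σ = τ :=
      ⟨Equiv.ofBijective σ (Finite.injective_iff_bijective.1 hσ), rfl⟩
    have h1 := (g.compLinearMap (Fintype.linearCombination R v)).map_perm
      (fun i => Pi.basisFun R (Fin n) i) τ
    have h2 := ((LinearMap.toSpanSingleton R W (g v)).compAlternatingMap
      Matrix.detRowAlternating).map_perm (fun i => Pi.basisFun R (Fin n) i) τ
    refine h1.trans (Eq.trans ?_ h2.symm)
    congr 1
    have h3 : Matrix.detRowAlternating (fun i => Pi.basisFun R (Fin n) i) = 1 := by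
      have : (fun i => Pi.basisFun R (Fin n) i) = (1 : Matrix (Fin n) (Fin n) R) := by
        ext i j; simp [Matrix.one_apply, Pi.single_apply, eq_comm]
      rw [this]
      exact Matrix.det_one
    simp only [LinearMap.compAlternatingMap_apply, h3, AlternatingMap.compLinearMap_apply]
    simp [Fintype.linearCombination_apply_single]
  have := DFunLike.congr_fun key (fun i => C i)
  simp only [AlternatingMap.compLinearMap_apply, Fintype.linearCombination_apply] at this
  exact this

section Chart

variable {k : Type*} {A : Type*} [Field k] [CommRing A] [IsDomain A] [Algebra k A]

namespace Chart

variable (c : Chart k A) {q : MvPolynomial (Fin 3) k} (hq : Prime q)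
    (hA : ∀ f : A, c.IsRegularAlong q (algebraMap A (FractionRing A) f))

/-- The divisor `q = 0` of a chart, as a divisor over `Spec A`. -/
def divisor : DivisorOver k A 3 where
  ring := c.localRing hq hA
  isDVR := inferInstance
  isFractionRing := inferInstance
  trdeg_residueField := by
    rw [c.trdeg_residueField hq hA]; norm_num

/-- The volume form `dx₀ ∧ dx₁ ∧ dx₂` of a chart. -/
def vol : RationalForms k A 3 :=
  exteriorPower.ιMulti (FractionRing A) 3
    fun i => KaehlerDifferential.D k (FractionRing A) (c.θ (X i))

lemma D_θ_mem (p : MvPolynomial (Fin 3) k) :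
    KaehlerDifferential.D k (FractionRing A) (c.θ p) ∈ Submodule.span (c.localRing hq hA)
      (Set.range fun i => KaehlerDifferential.D k (FractionRing A) (c.θ (X i))) := by
  induction p using MvPolynomial.induction_on with
  | C a =>
    have : c.θ (C a) = algebraMap k (FractionRing A) a := c.θ.commutes a
    rw [this, Derivation.map_algebraMap]
    exact zero_mem _
  | add p p' h h' => rw [map_add, map_add]; exact add_mem h h'
  | mul_X p i h =>
    rw [map_mul, Derivation.leibniz]
    exact add_mem
      (Submodule.smul_mem _ (c.toLocalRing hq hA p) (Submodule.subset_span ⟨i, rfl⟩))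
      (Submodule.smul_mem _ (c.toLocalRing hq hA (X i)) h)

/-- The differentials of the coordinates generate those of the local ring. -/
lemma D_mem (z : c.localRing hq hA) :
    KaehlerDifferential.D k (FractionRing A) (z : FractionRing A) ∈
      Submodule.span (c.localRing hq hA)
        (Set.range fun i => KaehlerDifferential.D k (FractionRing A) (c.θ (X i))) := by
  obtain ⟨z, p, s, hs, rfl⟩ := z
  have h1 : ¬ q ∣ 1 := fun h => hq.not_isUnit (isUnit_of_dvd_one h)
  let w : c.localRing hq hA := ⟨(c.θ s)⁻¹, 1, s, hs, by simp⟩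
  have : KaehlerDifferential.D k (FractionRing A) (c.θ p / c.θ s) =
      w ^ 2 • (c.toLocalRing hq hA s • KaehlerDifferential.D k (FractionRing A) (c.θ p) -
        c.toLocalRing hq hA p • KaehlerDifferential.D k (FractionRing A) (c.θ s)) :=
    Derivation.leibniz_div _ _ _
  change KaehlerDifferential.D k (FractionRing A) (c.θ p / c.θ s) ∈ _
  rw [this]
  exact Submodule.smul_mem _ _ (sub_mem (Submodule.smul_mem _ _ (c.D_θ_mem hq hA p))
    (Submodule.smul_mem _ _ (c.D_θ_mem hq hA s)))

/-- The volume form of a chart generates the forms regular along any divisor of the chart. -/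
lemma regularForms_divisor :
    (c.divisor hq hA).regularForms = Submodule.span (c.localRing hq hA) {c.vol} := by
  apply le_antisymm
  · refine Submodule.span_le.2 ?_
    rintro _ ⟨f, rfl⟩
    have h : ∀ i, ∃ a : Fin 3 → c.localRing hq hA, ∑ j, a j •
        KaehlerDifferential.D k (FractionRing A) (c.θ (X j)) =
          KaehlerDifferential.D k (FractionRing A) (f i : FractionRing A) := fun i =>
      (Submodule.mem_span_range_iff_exists_fun _).1 (c.D_mem hq hA (f i))
    choose a ha using h
    have := alternatingMap_sum_smul (exteriorPower.ιMulti (FractionRing A) 3)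
      (fun i j => (a i j : FractionRing A))
      (fun j => KaehlerDifferential.D k (FractionRing A) (c.θ (X j)))
    have h2 : (fun i => KaehlerDifferential.D k (FractionRing A) (f i : FractionRing A)) =
        fun i => ∑ j, (a i j : FractionRing A) •
          KaehlerDifferential.D k (FractionRing A) (c.θ (X j)) := by
      funext i; exact (ha i).symm
    rw [h2, this]
    have h3 : Matrix.det (fun i j => (a i j : FractionRing A)) =
        ((Matrix.det (fun i j => a i j) : c.localRing hq hA) : FractionRing A) :=
      ((c.localRing hq hA).val.toRingHom.map_det (fun i j => a i j)).symm
    rw [h3]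
    exact Submodule.smul_mem _ (Matrix.det (fun i j => a i j) : c.localRing hq hA)
      (Submodule.mem_span_singleton_self _)
  · refine Submodule.span_le.2 ?_
    rintro _ rfl
    exact Submodule.subset_span ⟨fun i => c.toLocalRing hq hA (X i), rfl⟩

/-- The order of a pluricanonical form along a divisor of a chart can be computed with the volume
form of the chart. -/
lemma exists_hasOrd_of_hasOrder {h : FractionRing A} {ω : RationalForms k A 3} {m : ℕ} {e : ℤ}
    (hω : ω ≠ 0) (H : (c.divisor hq hA).HasOrder h ω m e) :
    ∃ b, ω = b • c.vol ∧ c.HasOrd q (h * b ^ m) e := by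
  obtain ⟨η, a, (ϖ : c.localRing hq hA), (u : (c.localRing hq hA)ˣ), hη, rfl, hϖ, hu⟩ := H
  rw [c.regularForms_divisor hq hA] at hη
  change Submodule.span (c.localRing hq hA) {η} = _ at hη
  have hη0 : η ≠ 0 := by rintro rfl; simp at hω
  obtain ⟨s, hs⟩ : ∃ s : c.localRing hq hA, s • c.vol = η := by
    rw [← Submodule.mem_span_singleton, ← hη]
    exact Submodule.mem_span_singleton_self _
  obtain ⟨t, ht⟩ : ∃ t : c.localRing hq hA, t • η = c.vol := by
    refine Submodule.mem_span_singleton.1 ?_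
    rw [hη]
    exact Submodule.mem_span_singleton_self _
  have hs' : (s : FractionRing A) • c.vol = η := hs
  have ht' : (t : FractionRing A) • η = c.vol := ht
  have hst : s * t = 1 := by
    have h1 : ((s : FractionRing A) * t) • η = (1 : FractionRing A) • η := by
      rw [one_smul, ← smul_smul, ht', hs']
    exact Subtype.ext (smul_left_injective (FractionRing A) hη0 h1)
  have hs0 : c.HasOrd q (s : FractionRing A) 0 :=
    (c.isUnit_localRing_iff hq hA).1 (IsUnit.of_mul_eq_one _ hst)
  refine ⟨a * s, by rw [← hs', smul_smul], ?_⟩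
  have hϖ1 : c.HasOrd q (ϖ : FractionRing A) 1 := by
    obtain ⟨v, hv⟩ := IsDiscreteValuationRing.associated_of_irreducible _
      (c.irreducible_toLocalRing hq hA) hϖ
    have hv' : (ϖ : FractionRing A) = c.θ q * ((v : c.localRing hq hA) : FractionRing A) :=
      (congrArg Subtype.val hv).symm
    rw [hv']
    simpa using (hasOrd_self hq).mul hq ((c.isUnit_localRing_iff hq hA).1 v.isUnit)
  have hu0 : c.HasOrd q ((u : c.localRing hq hA) : FractionRing A) 0 :=
    (c.isUnit_localRing_iff hq hA).1 u.isUnit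
  have : h * (a * s) ^ m = ((u : c.localRing hq hA) : FractionRing A) *
      (ϖ : FractionRing A) ^ e * (s : FractionRing A) ^ m := by
    have hu' : h * a ^ m = ((u : c.localRing hq hA) : FractionRing A) *
      (ϖ : FractionRing A) ^ e := hu
    rw [← hu']; ring
  rw [this]
  simpa using (hu0.mul hq (hϖ1.zpow hq e)).mul hq (hs0.pow hq m)

lemma mem_center_divisor_iff {f : A} {n : ℤ}
    (hn : c.HasOrd q (algebraMap A (FractionRing A) f) n) :
    f ∈ (c.divisor hq hA).center ↔ 0 < n := by
  rw [DivisorOver.center, Ideal.mem_comap]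
  exact c.mem_maximalIdeal_iff hq hA (z := algebraMap A (c.localRing hq hA) f) hn

instance isPrime_center_divisor : (c.divisor hq hA).center.IsPrime :=
  inferInstanceAs (Ideal.IsPrime (Ideal.comap _ _))

/-- If every polynomial in the coordinates of the chart becomes an element of `A` after
multiplication by an element of `A` that is a unit along the divisor, then the center of the
divisor has height one: it is minimal over the ideal generated by a multiple of `q`. -/
lemma isPrimeDivisor_divisor [IsNoetherianRing A]
    (H : ∀ p, ∃ u f : A, c.HasOrd q (algebraMap A (FractionRing A) u) 0 ∧
      algebraMap A (FractionRing A) f = algebraMap A (FractionRing A) u * c.θ p) :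
    (c.divisor hq hA).IsPrimeDivisor := by
  set P := (c.divisor hq hA).center with hP
  have hinj := IsFractionRing.injective A (FractionRing A)
  obtain ⟨u₀, g, hu₀, hg⟩ := H q
  have hu : ∀ {u : A}, c.HasOrd q (algebraMap A (FractionRing A) u) 0 → u ∉ P := by
    intro u hu h
    rw [hP, c.mem_center_divisor_iff hq hA hu] at h
    exact lt_irrefl _ h
  have hg1 : c.HasOrd q (algebraMap A (FractionRing A) g) 1 := by
    rw [hg]
    simpa using hu₀.mul hq (hasOrd_self hq)
  have hgP : g ∈ P := by
    rw [hP, c.mem_center_divisor_iff hq hA hg1]; norm_num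
  have hg0 : g ≠ 0 := by
    rintro rfl
    exact hg1.ne_zero hq (by simp)
  have hmin : P ∈ (Ideal.span {g}).minimalPrimes := by
    refine ⟨⟨inferInstance, by simpa [Ideal.span_le] using hgP⟩, ?_⟩
    rintro Q ⟨hQ, hgQ⟩ hQP f hf
    have hgQ' : g ∈ Q := hgQ (Ideal.mem_span_singleton_self g)
    by_cases hf0 : f = 0
    · rw [hf0]; exact Q.zero_mem
    have hf0' : algebraMap A (FractionRing A) f ≠ 0 := by simpa using hf0
    obtain ⟨n, hn⟩ := exists_hasOrd (c := c) hq hf0'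
    have hn0 : 0 < n := by
      rwa [hP, c.mem_center_divisor_iff hq hA hn] at hf
    obtain ⟨p, s, hp, hs, hfs⟩ := hn
    lift n to ℕ using hn0.le
    obtain ⟨n, rfl⟩ : ∃ j, n = j + 1 := ⟨n - 1, by omega⟩
    obtain ⟨u₁, g₁, hu₁, hg₁⟩ := H (q ^ n * p)
    obtain ⟨u₂, g₂, hu₂, hg₂⟩ := H s
    have hg₂0 : c.HasOrd q (algebraMap A (FractionRing A) g₂) 0 := by
      rw [hg₂]
      simpa using hu₂.mul hq (hasOrd_of_not_dvd hq hs)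
    have key : f * (g₂ * u₁ * u₀) = g * (g₁ * u₂) := by
      apply hinj
      have h3 := c.map_ne_zero (ne_zero_of_not_dvd hs)
      simp only [map_mul, hfs, hg, hg₁, hg₂, map_pow]
      rw [zpow_natCast]
      field_simp
      ring
    have h4 : f * (g₂ * u₁ * u₀) ∈ Q := by
      rw [key]; exact Q.mul_mem_right _ hgQ'
    refine (hQ.mem_or_mem h4).resolve_right fun h => ?_
    rcases hQ.mem_or_mem h with h | h
    · rcases hQ.mem_or_mem h with h | h
      · exact hu hg₂0 (hQP h)
      · exact hu hu₁ (hQP h)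
    · exact hu hu₀ (hQP h)
  change P.height = 1
  refine le_antisymm (Ideal.height_le_one_of_isPrincipal_of_mem_minimalPrimes _ _ hmin) ?_
  have hlt : (⊥ : Ideal A) < P := bot_lt_iff_ne_bot.2 fun h => hg0 (by simpa [h] using hgP)
  simpa using Ideal.height_add_one_le_of_lt_of_isPrime hlt

end Chart

end Chart

end

section

open MvPolynomial

/-! ### Toric algebras and Laurent monomials -/

section ToricAlgebra

/-- An exponent vector as an integer vector. -/
def intExp (s : Fin 3 →₀ ℕ) : Fin 3 → ℤ := fun i => s i

lemma intExp_add (s t : Fin 3 →₀ ℕ) : intExp (s + t) = intExp s + intExp t := by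
  funext i; simp [intExp]

lemma intExp_injective : Function.Injective intExp := fun s t h => by
  ext i; have := congrFun h i; simpa [intExp] using this

/-- The exponent vector of a non-negative integer vector. -/
def natExp (a : Fin 3 → ℤ) : Fin 3 →₀ ℕ := Finsupp.equivFunOnFinite.symm fun i => (a i).toNat

lemma intExp_natExp {a : Fin 3 → ℤ} (ha : ∀ i, 0 ≤ a i) : intExp (natExp a) = a := by
  funext i; simp [intExp, natExp, ha i]

variable {k : Type*} [Field k] (A : Subalgebra k (MvPolynomial (Fin 3) k))
  (M : AddSubgroup (Fin 3 → ℤ)) (r : ℕ)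

/-- The algebra `A` consists of the polynomials all of whose exponents lie in the lattice `M`,
which contains `r ℤ³`. -/
structure IsToric : Prop where
  mem_iff : ∀ f, f ∈ A ↔ ∀ s ∈ f.support, intExp s ∈ M
  pos : 0 < r
  mem : ∀ z : Fin 3 → ℤ, (fun i => r * z i) ∈ M

variable {A M r}

namespace IsToric

variable (T : IsToric A M r)

include T in
lemma monomial_mem {s : Fin 3 →₀ ℕ} (hs : intExp s ∈ M) (x : k) : monomial s x ∈ A := by
  rw [T.mem_iff]
  intro t ht
  rwa [Finset.mem_singleton.1 (support_monomial_subset ht)]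

/-- A monomial of the toric algebra. -/
def mono {s : Fin 3 →₀ ℕ} (hs : intExp s ∈ M) : A := ⟨monomial s 1, T.monomial_mem hs 1⟩

/-- A monomial of the toric algebra, in its function field. -/
def monoK {s : Fin 3 →₀ ℕ} (hs : intExp s ∈ M) : FractionRing A :=
  algebraMap A (FractionRing A) (T.mono hs)

lemma monoK_ne_zero {s : Fin 3 →₀ ℕ} (hs : intExp s ∈ M) : T.monoK hs ≠ 0 := by
  rw [monoK, Ne, IsFractionRing.to_map_eq_zero_iff]
  intro h
  have := congrArg Subtype.val h
  simp [mono] at this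

lemma monoK_mul {s t u : Fin 3 →₀ ℕ} (hs : intExp s ∈ M) (ht : intExp t ∈ M) (hu : intExp u ∈ M)
    (h : u = s + t) : T.monoK hs * T.monoK ht = T.monoK hu := by
  subst h
  rw [monoK, monoK, monoK, ← map_mul]
  congr 1
  apply Subtype.ext
  simp [mono, monomial_mul]

/-- A non-negative multiple of `r` that bounds the entries of an integer vector. -/
def denExp (r : ℕ) (a : Fin 3 → ℤ) : Fin 3 → ℤ := fun _ => r * ∑ j, |a j|

include T in
lemma denExp_mem (a : Fin 3 → ℤ) : denExp r a ∈ M := T.mem _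

lemma denExp_nonneg (a : Fin 3 → ℤ) (i : Fin 3) : 0 ≤ denExp r a i := by
  unfold denExp
  positivity

include T in
lemma add_denExp_nonneg (a : Fin 3 → ℤ) (i : Fin 3) : 0 ≤ (a + denExp r a) i := by
  have h1 : |a i| ≤ ∑ j, |a j| :=
    Finset.single_le_sum (f := fun j => |a j|) (fun j _ => abs_nonneg _) (Finset.mem_univ i)
  have h2 : (1 : ℤ) ≤ r := by exact_mod_cast T.pos
  have h3 : (0 : ℤ) ≤ ∑ j, |a j| := by positivity
  have h4 := neg_abs_le (a i)
  simp only [Pi.add_apply, denExp]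
  nlinarith

include T in
lemma num_mem (a : M) : intExp (natExp ((a : Fin 3 → ℤ) + denExp r a)) ∈ M := by
  rw [intExp_natExp (T.add_denExp_nonneg a)]
  exact add_mem a.2 (T.denExp_mem a)

include T in
lemma den_mem (a : M) : intExp (natExp (denExp r (a : Fin 3 → ℤ))) ∈ M := by
  rw [intExp_natExp (denExp_nonneg _)]
  exact T.denExp_mem _

/-- The Laurent monomial with exponent `a ∈ M`, in the function field of the toric algebra. -/
def mon (a : M) : FractionRing A := T.monoK (T.num_mem a) / T.monoK (T.den_mem a)

lemma mon_eq {s t : Fin 3 →₀ ℕ} (hs : intExp s ∈ M) (ht : intExp t ∈ M) {a : M}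
    (h : intExp s = a + intExp t) : T.mon a = T.monoK hs / T.monoK ht := by
  rw [mon, div_eq_div_iff (T.monoK_ne_zero _) (T.monoK_ne_zero _)]
  have hu : intExp (natExp ((a : Fin 3 → ℤ) + denExp r a) + t) ∈ M := by
    rw [intExp_add]; exact add_mem (T.num_mem a) ht
  rw [T.monoK_mul _ _ hu rfl, T.monoK_mul _ _ hu]
  apply intExp_injective
  rw [intExp_add, intExp_add, intExp_natExp (T.add_denExp_nonneg a),
    intExp_natExp (denExp_nonneg _), h]
  abel

lemma mon_intExp {s : Fin 3 →₀ ℕ} (hs : intExp s ∈ M) : T.mon ⟨intExp s, hs⟩ = T.monoK hs := by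
  have h0 : intExp 0 ∈ M := by
    have : intExp 0 = 0 := by funext i; simp [intExp]
    rw [this]; exact zero_mem _
  rw [T.mon_eq hs h0 (by funext i; simp [intExp])]
  have : T.mono h0 = 1 := by
    apply Subtype.ext; simp [mono]
  rw [monoK, monoK, this, map_one, div_one]

lemma mon_ne_zero (a : M) : T.mon a ≠ 0 :=
  div_ne_zero (T.monoK_ne_zero _) (T.monoK_ne_zero _)

lemma mon_add (a b : M) : T.mon (a + b) = T.mon a * T.mon b := by
  have hs : intExp (natExp ((a : Fin 3 → ℤ) + denExp r a) +
      natExp ((b : Fin 3 → ℤ) + denExp r b)) ∈ M := by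
    rw [intExp_add]; exact add_mem (T.num_mem a) (T.num_mem b)
  have ht : intExp (natExp (denExp r (a : Fin 3 → ℤ)) + natExp (denExp r (b : Fin 3 → ℤ))) ∈ M := by
    rw [intExp_add]; exact add_mem (T.den_mem a) (T.den_mem b)
  rw [T.mon_eq hs ht, mon, mon, div_mul_div_comm, T.monoK_mul _ _ hs rfl, T.monoK_mul _ _ ht rfl]
  rw [intExp_add, intExp_add, intExp_natExp (T.add_denExp_nonneg a),
    intExp_natExp (T.add_denExp_nonneg b), intExp_natExp (denExp_nonneg _),
    intExp_natExp (denExp_nonneg _), AddSubgroup.coe_add]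
  abel

/-- The Laurent monomials, as a homomorphism from the lattice of exponents. -/
def monHom : Multiplicative M →* FractionRing A where
  toFun a := T.mon a.toAdd
  map_one' := by
    have := T.mon_add 0 0
    rw [add_zero] at this
    exact (mul_eq_left₀ (T.mon_ne_zero 0)).1 this.symm
  map_mul' a b := T.mon_add _ _

lemma mon_zero : T.mon 0 = 1 := T.monHom.map_one

lemma mon_nsmul (n : ℕ) (a : M) : T.mon (n • a) = T.mon a ^ n :=
  T.monHom.map_pow (Multiplicative.ofAdd a) n

lemma mon_neg (a : M) : T.mon (-a) = (T.mon a)⁻¹ := by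
  refine eq_inv_of_mul_eq_one_left ?_
  rw [← T.mon_add, neg_add_cancel, T.mon_zero]

lemma mon_zsmul (n : ℤ) (a : M) : T.mon (n • a) = T.mon a ^ n := by
  obtain ⟨j, rfl | rfl⟩ := n.eq_nat_or_neg
  · simp [T.mon_nsmul]
  · simp [T.mon_nsmul, T.mon_neg]

/-- The Laurent polynomial with given coefficients, in the function field of the toric algebra. -/
def laur : (M →₀ k) →ₗ[k] FractionRing A := Finsupp.linearCombination k T.mon

lemma laur_single (a : M) (x : k) : T.laur (Finsupp.single a x) = x • T.mon a := by
  simp [laur]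

lemma laur_mul_mon (f : M →₀ k) (a : M) :
    T.laur f * T.mon a = f.sum fun b x => x • T.mon (b + a) := by
  rw [laur, Finsupp.linearCombination_apply, Finsupp.sum_mul]
  simp [T.mon_add]

/-- A Laurent polynomial becomes an element of the toric algebra after multiplication by a monomial
that makes all exponents non-negative. -/
lemma exists_algebraMap_eq_laur_mul_mon {f : M →₀ k} {a₀ : M}
    (h : ∀ a ∈ f.support, ∀ i, 0 ≤ (a + a₀ : Fin 3 → ℤ) i) :
    ∃ g : A, algebraMap A (FractionRing A) g = T.laur f * T.mon a₀ ∧ (f ≠ 0 → g ≠ 0) := by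
  have hm : ∀ a ∈ f.support, intExp (natExp (a + a₀ : Fin 3 → ℤ)) ∈ M := fun a ha => by
    rw [intExp_natExp (h a ha)]; exact add_mem a.2 a₀.2
  refine ⟨∑ a ∈ f.support.attach, f a • T.mono (hm a.1 a.2), ?_, ?_⟩
  · rw [laur_mul_mon, Finsupp.sum, map_sum (algebraMap A (FractionRing A)),
      ← Finset.sum_attach f.support]
    refine Finset.sum_congr rfl fun a _ => ?_
    have h1 : T.mon (a.1 + a₀) = T.monoK (hm a.1 a.2) := by
      rw [← T.mon_intExp]
      congr 1
      apply Subtype.ext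
      exact (intExp_natExp (h a.1 a.2)).symm
    rw [h1, monoK]
    exact map_smul (IsScalarTower.toAlgHom k A (FractionRing A)) (f a.1) _
  · intro hf hg
    obtain ⟨b, hb⟩ := Finsupp.ne_iff.1 hf
    have hb' : b ∈ f.support := by simpa using hb
    have h2 := congrArg (fun g : A => coeff (natExp (b + a₀ : Fin 3 → ℤ))
      (g : MvPolynomial (Fin 3) k)) hg
    simp only [AddSubmonoidClass.coe_finsetSum, SetLike.val_smul, mono, coeff_sum, coeff_smul,
      ZeroMemClass.coe_zero, coeff_zero, coeff_monomial] at h2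
    rw [Finset.sum_eq_single ⟨b, hb'⟩] at h2
    · simp at h2
      exact hb h2
    · intro a _ hab
      rw [if_neg, smul_zero]
      intro h3
      apply hab
      have h4 := congrArg intExp h3
      rw [intExp_natExp (h a.1 a.2), intExp_natExp (h b hb'), add_left_inj] at h4
      exact Subtype.ext (Subtype.ext h4)
    · simp

include T in
/-- Multiplying by a monomial that is a power of `(xⱼ)^r` for `j` in a given set of coordinates. -/
lemma exists_mon_bound (S : Finset M) (J : Set (Fin 3)) :
    ∃ a₀ : M, (∀ i ∈ J, ∀ a ∈ S, 0 ≤ (a + a₀ : Fin 3 → ℤ) i) ∧ (∀ i, 0 ≤ (a₀ : Fin 3 → ℤ) i) ∧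
      ∀ i ∉ J, (a₀ : Fin 3 → ℤ) i = 0 := by
  classical
  refine ⟨⟨fun i => r * if i ∈ J then ∑ a ∈ S, ∑ j, |(a : Fin 3 → ℤ) j| else 0, T.mem _⟩, ?_, ?_,
    ?_⟩
  · intro i hi a ha
    have h0 : |(a : Fin 3 → ℤ) i| ≤ ∑ j, |(a : Fin 3 → ℤ) j| :=
      Finset.single_le_sum (f := fun j => |(a : Fin 3 → ℤ) j|) (fun j _ => abs_nonneg _)
        (Finset.mem_univ i)
    have h1 : ∑ j, |(a : Fin 3 → ℤ) j| ≤ ∑ a ∈ S, ∑ j, |(a : Fin 3 → ℤ) j| :=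
      Finset.single_le_sum (f := fun a : M => ∑ j, |(a : Fin 3 → ℤ) j|)
        (fun j _ => by positivity) ha
    have h2 : (1 : ℤ) ≤ r := by exact_mod_cast T.pos
    have h4 := neg_abs_le ((a : Fin 3 → ℤ) i)
    have h5 := abs_nonneg ((a : Fin 3 → ℤ) i)
    simp only [Pi.add_apply, if_pos hi]
    nlinarith
  · intro i
    dsimp only
    split_ifs
    · positivity
    · simp
  · intro i hi
    simp [hi]

lemma laur_ne_zero {f : M →₀ k} (hf : f ≠ 0) : T.laur f ≠ 0 := by
  obtain ⟨a₀, h, -⟩ := T.exists_mon_bound f.support Set.univ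
  obtain ⟨g, hg, hg0⟩ := T.exists_algebraMap_eq_laur_mul_mon (f := f) (a₀ := a₀)
    fun a ha i => h i trivial a ha
  intro h0
  rw [h0, zero_mul, IsFractionRing.to_map_eq_zero_iff] at hg
  exact hg0 hf hg

/-- The elements of the toric algebra are the Laurent polynomials with non-negative exponents. -/
lemma exists_laur_eq_algebraMap (g : A) :
    ∃ f : M →₀ k, T.laur f = algebraMap A (FractionRing A) g ∧
      ∀ a ∈ f.support, ∀ i, 0 ≤ (a : Fin 3 → ℤ) i := by
  classical
  have hm : ∀ s ∈ (g : MvPolynomial (Fin 3) k).support, intExp s ∈ M := (T.mem_iff _).1 g.2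
  refine ⟨∑ s ∈ (g : MvPolynomial (Fin 3) k).support.attach,
    Finsupp.single ⟨intExp s.1, hm s.1 s.2⟩ (coeff s.1 (g : MvPolynomial (Fin 3) k)), ?_, ?_⟩
  · rw [map_sum]
    simp only [laur_single, T.mon_intExp, monoK]
    have h : g = ∑ s ∈ (g : MvPolynomial (Fin 3) k).support.attach,
        coeff s.1 (g : MvPolynomial (Fin 3) k) • T.mono (hm s.1 s.2) := by
      apply Subtype.ext
      simp only [AddSubmonoidClass.coe_finsetSum, SetLike.val_smul, mono, smul_monomial,
        smul_eq_mul, mul_one]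
      rw [Finset.sum_attach (g : MvPolynomial (Fin 3) k).support
        (fun s => monomial s (coeff s (g : MvPolynomial (Fin 3) k)))]
      exact (support_sum_monomial_coeff _).symm
    conv_rhs => rw [h, map_sum (algebraMap A (FractionRing A))]
    refine Finset.sum_congr rfl fun a _ => ?_
    exact (map_smul (IsScalarTower.toAlgHom k A (FractionRing A)) _ _).symm
  · intro a ha i
    have := Finsupp.support_finsetSum ha
    simp only [Finset.mem_biUnion] at this
    obtain ⟨s, -, hs⟩ := this
    have := Finsupp.support_single_subset hs
    rw [Finset.mem_singleton.1 this]
    simp [intExp]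

/-! ### Charts from lattice bases -/

variable (b : Module.Basis (Fin 3) ℤ M)

/-- The lattice vector with given non-negative coordinates. -/
def latticeVec (b : Module.Basis (Fin 3) ℤ M) (s : Fin 3 →₀ ℕ) : M := ∑ i, (s i : ℤ) • b i

lemma repr_latticeVec (s : Fin 3 →₀ ℕ) (i : Fin 3) : b.repr (latticeVec b s) i = s i := by
  simp [latticeVec, Finsupp.single_apply]

lemma latticeVec_injective : Function.Injective (latticeVec b) := fun s t h => by
  ext i
  have := congrArg (fun a => b.repr a i) h
  simpa [repr_latticeVec] using this

lemma latticeVec_natExp {a : M} (ha : ∀ i, 0 ≤ b.repr a i) :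
    latticeVec b (natExp fun i => b.repr a i) = a := by
  apply b.repr.injective
  ext i
  rw [repr_latticeVec]
  exact congrFun (intExp_natExp ha) i

/-- The homomorphism that sends the coordinates to the Laurent monomials of a lattice basis. -/
def basisHom : MvPolynomial (Fin 3) k →ₐ[k] FractionRing A := aeval fun i => T.mon (b i)

lemma basisHom_monomial (s : Fin 3 →₀ ℕ) (x : k) :
    T.basisHom b (monomial s x) = x • T.mon (latticeVec b s) := by
  rw [basisHom, aeval_monomial, Algebra.smul_def, Finsupp.prod_fintype _ _ (by simp)]
  congr 1
  have : T.mon (latticeVec b s) = T.monHom (Multiplicative.ofAdd (latticeVec b s)) := rfl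
  rw [this, latticeVec, ofAdd_sum, map_prod]
  refine Finset.prod_congr rfl fun i _ => ?_
  exact (by simp [T.mon_nsmul] : T.mon (b i) ^ s i = T.mon ((s i : ℤ) • b i))

/-- Polynomials in the coordinates of a lattice basis are Laurent polynomials. -/
lemma exists_laur_eq_basisHom (p : MvPolynomial (Fin 3) k) :
    ∃ f : M →₀ k, T.laur f = T.basisHom b p ∧ (p ≠ 0 → f ≠ 0) ∧
      ∀ a ∈ f.support, ∃ s ∈ p.support, a = latticeVec b s := by
  classical
  refine ⟨∑ s ∈ p.support, Finsupp.single (latticeVec b s) (coeff s p), ?_, ?_, ?_⟩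
  · rw [map_sum]
    conv_rhs => rw [p.as_sum, map_sum]
    simp only [laur_single, basisHom_monomial]
  · intro hp h
    obtain ⟨s, hs⟩ := MvPolynomial.ne_zero_iff.1 hp
    have h1 := DFunLike.congr_fun h (latticeVec b s)
    rw [Finsupp.finsetSum_apply, Finset.sum_eq_single s] at h1
    · exact hs (by simpa using h1)
    · intro t _ hts
      rw [Finsupp.single_eq_of_ne]
      exact fun h => hts (latticeVec_injective b h.symm)
    · intro h2; simpa using h2
  · intro a ha
    have := Finsupp.support_finsetSum ha
    simp only [Finset.mem_biUnion] at this
    obtain ⟨s, hs, hs'⟩ := this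
    exact ⟨s, hs, Finset.mem_singleton.1 (Finsupp.support_single_subset hs')⟩

/-- A Laurent polynomial becomes a polynomial in the coordinates of a lattice basis after
multiplication by a monomial that makes its coordinate exponents non-negative. -/
lemma exists_basisHom_eq_laur_mul_mon {f : M →₀ k} {a₀ : M}
    (h : ∀ a ∈ f.support, ∀ i, 0 ≤ b.repr (a + a₀) i) :
    ∃ p, T.basisHom b p = T.laur f * T.mon a₀ ∧
      ∀ a ∈ f.support, coeff (natExp fun i => b.repr (a + a₀) i) p = f a := by
  refine ⟨∑ a ∈ f.support, monomial (natExp fun i => b.repr (a + a₀) i) (f a), ?_, ?_⟩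
  · rw [laur_mul_mon, Finsupp.sum, map_sum]
    refine Finset.sum_congr rfl fun a ha => ?_
    rw [basisHom_monomial, latticeVec_natExp b (h a ha)]
  · intro a ha
    rw [coeff_sum, Finset.sum_eq_single a]
    · simp
    · intro a' ha' haa
      rw [coeff_monomial, if_neg]
      intro h3
      apply haa
      have h4 := congrArg (latticeVec b) h3
      rw [latticeVec_natExp b (h a ha), latticeVec_natExp b (h a' ha'), add_left_inj] at h4
      exact h4
    · intro h; exact absurd ha h

lemma exists_repr_bound (S : Finset M) :
    ∃ N : ℕ, ∀ a ∈ S, ∀ i, 0 ≤ b.repr a i + N := by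
  refine ⟨∑ a ∈ S, ∑ i, (b.repr a i).natAbs, fun a ha i => ?_⟩
  have h0 : (b.repr a i).natAbs ≤ ∑ j, (b.repr a j).natAbs :=
    Finset.single_le_sum (f := fun j => (b.repr a j).natAbs) (fun j _ => Nat.zero_le _)
      (Finset.mem_univ i)
  have h1 : ∑ j, (b.repr a j).natAbs ≤ ∑ a ∈ S, ∑ j, (b.repr a j).natAbs :=
    Finset.single_le_sum (f := fun a : M => ∑ j, (b.repr a j).natAbs)
      (fun j _ => Nat.zero_le _) ha
  omega

/-- The chart of the toric variety whose coordinates are the Laurent monomials of a lattice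
basis. -/
def chart : Chart k A where
  θ := T.basisHom b
  inj := by
    rw [injective_iff_map_eq_zero]
    intro p hp
    by_contra hp0
    obtain ⟨f, hf, hf0, -⟩ := T.exists_laur_eq_basisHom b p
    exact T.laur_ne_zero (hf0 hp0) (hf.trans hp)
  surj := by
    have key : ∀ g : A, ∃ p s, s ≠ 0 ∧
        algebraMap A (FractionRing A) g = T.basisHom b p / T.basisHom b s := by
      intro g
      obtain ⟨f, hf, -⟩ := T.exists_laur_eq_algebraMap g
      obtain ⟨N, hN⟩ := exists_repr_bound b f.support
      have h1 : ∀ i, b.repr (latticeVec b (natExp fun _ => N)) i = N := by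
        intro i; simp [repr_latticeVec, natExp]
      obtain ⟨p, hp, -⟩ := T.exists_basisHom_eq_laur_mul_mon b (f := f)
        (a₀ := latticeVec b (natExp fun _ => N)) (by
          intro a ha i
          rw [map_add, Finsupp.add_apply, h1]
          exact hN a ha i)
      refine ⟨p, monomial (natExp fun _ => N) 1, by simp, ?_⟩
      rw [basisHom_monomial, one_smul, hp, hf, mul_div_cancel_right₀ _ (T.mon_ne_zero _)]
    have hne : ∀ {p}, p ≠ 0 → T.basisHom b p ≠ 0 := by
      intro p hp
      obtain ⟨f, hf, hf0, -⟩ := T.exists_laur_eq_basisHom b p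
      rw [← hf]; exact T.laur_ne_zero (hf0 hp)
    intro z
    obtain ⟨x, y, hy, rfl⟩ := IsFractionRing.div_surjective (A := A) z
    obtain ⟨p, s, hs, h1⟩ := key x
    obtain ⟨p', s', hs', h2⟩ := key y
    have hp' : p' ≠ 0 := by
      rintro rfl
      rw [map_zero, zero_div, IsFractionRing.to_map_eq_zero_iff] at h2
      exact nonZeroDivisors.ne_zero hy h2
    refine ⟨p * s', s * p', mul_ne_zero hs hp', ?_⟩
    rw [h1, h2, map_mul, map_mul, div_div_div_eq]

lemma chart_θ : (T.chart b).θ = T.basisHom b := rfl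

lemma chart_θ_X (i : Fin 3) : (T.chart b).θ (X i) = T.mon (b i) := by
  simp [chart_θ, basisHom]

lemma mon_eq_zpow (a : M) : T.mon a = ∏ i, (T.mon (b i)) ^ b.repr a i := by
  have : T.mon a = T.monHom (Multiplicative.ofAdd a) := rfl
  conv_lhs => rw [this, ← b.sum_repr a, ofAdd_sum, map_prod]
  refine Finset.prod_congr rfl fun i _ => ?_
  exact T.mon_zsmul _ _

lemma prime_X (i : Fin 3) : Prime (X i : MvPolynomial (Fin 3) k) := X_prime

lemma not_X_dvd {i : Fin 3} {p : MvPolynomial (Fin 3) k} {s : Fin 3 →₀ ℕ} (hs : s i = 0)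
    (hp : coeff s p ≠ 0) : ¬ X i ∣ p := by
  rintro ⟨t, rfl⟩
  rw [coeff_X_mul', if_neg (by simpa using hs)] at hp
  exact hp rfl

/-- The order of a monomial along a coordinate divisor. -/
lemma hasOrd_mon (a : M) : (T.chart b).HasOrd (X 0) (T.mon a) (b.repr a 0) := by
  have h0 : (T.chart b).HasOrd (X 0) (T.mon (b 0)) 1 := by
    have := Chart.hasOrd_self (c := T.chart b) (prime_X 0)
    rwa [chart_θ_X] at this
  have h1 : ∀ i ≠ 0, (T.chart b).HasOrd (X 0) (T.mon (b i)) 0 := by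
    intro i hi
    have := Chart.hasOrd_of_not_dvd (c := T.chart b) (prime_X (k := k) 0) (p := X i)
      (not_X_dvd (s := Finsupp.single i 1) (by simp [hi]) (by simp))
    rwa [chart_θ_X] at this
  rw [T.mon_eq_zpow b a, Fin.prod_univ_three]
  simpa using ((h0.zpow (prime_X 0) (b.repr a 0)).mul (prime_X 0)
    ((h1 1 (by decide)).zpow (prime_X 0) (b.repr a 1))).mul (prime_X 0)
    ((h1 2 (by decide)).zpow (prime_X 0) (b.repr a 2))

/-- The order of a Laurent polynomial along a coordinate divisor is the minimum of the orders of
its monomials. -/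
lemma hasOrd_laur {f : M →₀ k} {n : ℤ} (h1 : ∃ a ∈ f.support, b.repr a 0 = n)
    (h2 : ∀ a ∈ f.support, n ≤ b.repr a 0) : (T.chart b).HasOrd (X 0) (T.laur f) n := by
  obtain ⟨N, hN⟩ := exists_repr_bound b f.support
  set a₀ : M := (-n) • b 0 + (N : ℤ) • b 1 + (N : ℤ) • b 2 with ha₀
  have e0 : b.repr a₀ 0 = -n := by simp [ha₀]
  have e1 : b.repr a₀ 1 = N := by simp [ha₀]
  have e2 : b.repr a₀ 2 = N := by simp [ha₀]
  obtain ⟨p, hp, hc⟩ := T.exists_basisHom_eq_laur_mul_mon b (f := f) (a₀ := a₀) (by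
    intro a ha i
    rw [map_add, Finsupp.add_apply]
    fin_cases i
    · simp only [Fin.zero_eta, e0]; linarith [h2 a ha]
    · simp only [Fin.mk_one, e1]; exact hN a ha 1
    · simp only [Fin.reduceFinMk, e2]; exact hN a ha 2)
  obtain ⟨a, ha, han⟩ := h1
  have hp0 : ¬ X 0 ∣ p := by
    refine not_X_dvd (s := natExp fun i => b.repr (a + a₀) i) ?_ ?_
    · simp [natExp, e0, han]
    · rw [hc a ha]; simpa using ha
  have : T.laur f = (T.chart b).θ p * T.mon (-a₀) := by
    rw [chart_θ, hp, T.mon_neg, mul_inv_cancel_right₀ (T.mon_ne_zero _)]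
  rw [this]
  simpa [e0] using (Chart.hasOrd_of_not_dvd (c := T.chart b) (prime_X 0) hp0).mul (prime_X 0)
    (T.hasOrd_mon b (-a₀))

lemma exists_hasOrd_laur {f : M →₀ k} (hf : f ≠ 0) :
    ∃ n, (T.chart b).HasOrd (X 0) (T.laur f) n ∧ (∃ a ∈ f.support, b.repr a 0 = n) ∧
      ∀ a ∈ f.support, n ≤ b.repr a 0 := by
  obtain ⟨a, ha, hmin⟩ := Finset.exists_min_image f.support (fun a => b.repr a 0)
    (Finsupp.support_nonempty_iff.2 hf)
  exact ⟨b.repr a 0, T.hasOrd_laur b ⟨a, ha, rfl⟩ hmin, ⟨a, ha, rfl⟩, hmin⟩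

end IsToric

end ToricAlgebra

end

section

open MvPolynomial

/-! ### Orders of pluricanonical forms -/

section OrderFunction

variable {k : Type*} {A : Type*} [Field k] [CommRing A] [IsDomain A] [Algebra k A]
  (c : Chart k A)

open Classical in
/-- The order of a rational function along the first coordinate divisor of a chart (zero for the
zero function). -/
def Chart.ordX (z : FractionRing A) : ℤ :=
  if h : ∃ n, c.HasOrd (X 0) z n then h.choose else 0

variable {c}

lemma Chart.ordX_eq {z : FractionRing A} {n : ℤ} (h : c.HasOrd (X 0) z n) : c.ordX z = n := by
  have h' : ∃ n, c.HasOrd (X 0) z n := ⟨n, h⟩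
  rw [Chart.ordX, dif_pos h']
  exact h'.choose_spec.unique X_prime h

lemma Chart.hasOrd_ordX {z : FractionRing A} (hz : z ≠ 0) : c.HasOrd (X 0) z (c.ordX z) := by
  obtain ⟨n, hn⟩ := Chart.exists_hasOrd (c := c) (X_prime (i := (0 : Fin 3)) (R := k)) hz
  rwa [Chart.ordX_eq hn]

lemma Chart.ordX_mul {z w : FractionRing A} (hz : z ≠ 0) (hw : w ≠ 0) :
    c.ordX (z * w) = c.ordX z + c.ordX w :=
  Chart.ordX_eq ((Chart.hasOrd_ordX hz).mul X_prime (Chart.hasOrd_ordX hw))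

/-- The volume form of a chart in terms of the logarithmic differentials of its coordinates. -/
lemma Chart.vol_eq_smul (v : Fin 3 → Ω[FractionRing A⁄k])
    (hv : ∀ i, v i = (c.θ (X i))⁻¹ • KaehlerDifferential.D k (FractionRing A) (c.θ (X i))) :
    c.vol = (∏ i, c.θ (X i)) • exteriorPower.ιMulti (FractionRing A) 3 v := by
  have h : (fun i => KaehlerDifferential.D k (FractionRing A) (c.θ (X i))) =
      fun i => c.θ (X i) • v i := by
    funext i
    rw [hv, smul_smul, mul_inv_cancel₀ (c.map_ne_zero (X_ne_zero i)), one_smul]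
  rw [Chart.vol, h, AlternatingMap.map_smul_univ]

/-- The effect of an integral substitution on a rational form of top degree. -/
lemma ιMulti_int_sum_smul (v w : Fin 3 → Ω[FractionRing A⁄k]) (B : Matrix (Fin 3) (Fin 3) ℤ)
    (hw : ∀ i, w i = ∑ j, B i j • v j) :
    exteriorPower.ιMulti (FractionRing A) 3 w =
      ((B.det : ℤ) : FractionRing A) • exteriorPower.ιMulti (FractionRing A) 3 v := by
  have h : w = fun i => ∑ j, ((B i j : ℤ) : FractionRing A) • v j := by
    funext i
    rw [hw]
    exact Finset.sum_congr rfl fun j _ => (Int.cast_smul_eq_zsmul _ _ _).symm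
  have := alternatingMap_sum_smul (exteriorPower.ιMulti (FractionRing A) 3)
      (fun i j => ((B i j : ℤ) : FractionRing A)) v
  rw [h, this]
  congr 1
  exact ((Int.castRingHom (FractionRing A)).map_det B).symm

/-- Comparison of the order of a pluricanonical form computed with the volume form of the chart
and computed with a form that differs from it by a factor of known order. -/
lemma Chart.hasOrd_of_hasOrder {q : MvPolynomial (Fin 3) k} (hq : Prime q)
    (hA : ∀ f : A, c.IsRegularAlong q (algebraMap A (FractionRing A) f))
    {h C t : FractionRing A} {ω τ : RationalForms k A 3} {m : ℕ} {e n : ℤ}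
    (hω : ω ≠ 0) (H : (c.divisor hq hA).HasOrder h ω m e)
    (hC : ω = C • τ) (ht : c.vol = t • τ) (hn : c.HasOrd q t n) :
    c.HasOrd q (h * C ^ m) (e + m * n) := by
  obtain ⟨β, hβ, hord⟩ := c.exists_hasOrd_of_hasOrder hq hA hω H
  rw [ht, smul_smul] at hβ
  have hne : τ ≠ 0 := by
    intro h0; rw [hC, h0, smul_zero] at hω; exact hω rfl
  have hCβ : C = β * t := smul_left_injective (FractionRing A) hne (hC.symm.trans hβ)
  have : h * C ^ m = h * β ^ m * t ^ m := by
    rw [hCβ]; ring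
  rw [this]
  exact hord.mul hq (hn.pow hq m)

lemma Chart.isRegularAlong_zero (c : Chart k A) {q : MvPolynomial (Fin 3) k} (hq : Prime q) :
    c.IsRegularAlong q 0 := by
  simpa using c.isRegularAlong_θ hq 0

end OrderFunction

namespace IsToric

variable {k : Type*} [Field k] {A : Subalgebra k (MvPolynomial (Fin 3) k)}
  {M : AddSubgroup (Fin 3 → ℤ)} {r : ℕ} (T : IsToric A M r)

include T in
lemma finrank_eq : Module.finrank ℤ M = 3 := by
  apply le_antisymm
  · have := LinearMap.finrank_le_finrank_of_injective (f := M.subtype.toIntLinearMap)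
      Subtype.val_injective
    simpa using this
  · let f : (Fin 3 → ℤ) →ₗ[ℤ] M :=
      (AddMonoidHom.mk' (fun z : Fin 3 → ℤ => (⟨fun i => r * z i, T.mem z⟩ : M)) (by
        intro a b
        apply Subtype.ext
        funext i
        simp [mul_add])).toIntLinearMap
    have hf : Function.Injective f := by
      intro a b hab
      funext i
      have h1 := congrFun (congrArg Subtype.val hab) i
      have h2 : (r : ℤ) * a i = r * b i := h1
      exact mul_left_cancel₀ (by exact_mod_cast T.pos.ne') h2
    have : Module.Finite ℤ M := inferInstanceAs (Module.Finite ℤ M.toIntSubmodule)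
    have := LinearMap.finrank_le_finrank_of_injective hf
    simpa using this

include T in
/-- A surjective functional on the lattice is the first coordinate of a lattice basis. -/
lemma exists_basis (φ : M →ₗ[ℤ] ℤ) (hφ : Function.Surjective φ) :
    ∃ b : Module.Basis (Fin 3) ℤ M, ∀ a, b.repr a 0 = φ a := by
  have : Module.Finite ℤ M := inferInstanceAs (Module.Finite ℤ M.toIntSubmodule)
  have : Module.Free ℤ M := inferInstanceAs (Module.Free ℤ M.toIntSubmodule)
  obtain ⟨y, hy⟩ := hφ 1
  have hk : Module.finrank ℤ (LinearMap.ker φ) = 2 := by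
    have h1 := Submodule.finrank_quotient_add_finrank (LinearMap.ker φ)
    rw [(φ.quotKerEquivOfSurjective hφ).finrank_eq, T.finrank_eq, Module.finrank_self] at h1
    omega
  let b := Module.finBasisOfFinrankEq ℤ (LinearMap.ker φ) hk
  let b' := Module.Basis.mkFinCons y b (by
    intro c x hx h
    have := congrArg φ h
    simpa [hy, LinearMap.mem_ker.1 hx] using this) (by
    intro z
    exact ⟨-φ z, by simp [hy]⟩)
  refine ⟨b', fun a => ?_⟩
  have h0 : b' 0 = y := by simp [b']
  have hs : ∀ i : Fin 2, φ (b' i.succ) = 0 := fun i => by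
    have : b' i.succ = (b i : M) := by simp [b']
    rw [this]; exact (b i).2
  conv_rhs => rw [← b'.sum_repr a]
  rw [map_sum, Fin.sum_univ_succ]
  simp [h0, hy, hs]

/-! ### The logarithmic volume form -/

/-- The logarithmic differential of a Laurent monomial. -/
def dlog : M →+ Ω[FractionRing A⁄k] where
  toFun a := (T.mon a)⁻¹ • KaehlerDifferential.D k (FractionRing A) (T.mon a)
  map_zero' := by simp [T.mon_zero]
  map_add' a b := by
    rw [T.mon_add, Derivation.leibniz, smul_add, smul_smul, smul_smul, add_comm]
    have h1 := T.mon_ne_zero a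
    have h2 := T.mon_ne_zero b
    congr 2
    · field_simp
    · field_simp

/-- The logarithmic volume form of a lattice basis. -/
def logVol (b : Module.Basis (Fin 3) ℤ M) : RationalForms k A 3 :=
  exteriorPower.ιMulti (FractionRing A) 3 fun i => T.dlog (b i)

lemma mon_sum {ι : Type*} (s : Finset ι) (f : ι → M) :
    T.mon (∑ i ∈ s, f i) = ∏ i ∈ s, T.mon (f i) := by
  have : T.mon (∑ i ∈ s, f i) = T.monHom (Multiplicative.ofAdd (∑ i ∈ s, f i)) := rfl
  rw [this, ofAdd_sum, map_prod]
  rfl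

lemma vol_chart (b : Module.Basis (Fin 3) ℤ M) :
    (T.chart b).vol = T.mon (∑ i, b i) • T.logVol b := by
  rw [Chart.vol_eq_smul (c := T.chart b) (fun i => T.dlog (b i)) fun i => by
    rw [chart_θ_X]; rfl]
  rw [logVol]
  congr 1
  rw [mon_sum]
  exact Finset.prod_congr rfl fun i _ => T.chart_θ_X b i

/-- Up to sign, the logarithmic volume form does not depend on the lattice basis. -/
lemma logVol_eq (b b' : Module.Basis (Fin 3) ℤ M) :
    ∃ ε : ℤ, (ε = 1 ∨ ε = -1) ∧ T.logVol b' = (ε : FractionRing A) • T.logVol b := by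
  refine ⟨(Matrix.of fun i j => b.repr (b' i) j).det, ?_, ?_⟩
  · have h1 : IsUnit (b.toMatrix b').det := by
      rw [← Module.Basis.det_apply]
      exact b.isUnit_det b'
    have h2 : (Matrix.of fun i j => b.repr (b' i) j) = (b.toMatrix b')ᵀ := by
      ext i j; simp [Module.Basis.toMatrix_apply]
    rw [h2, Matrix.det_transpose]
    exact Int.isUnit_iff.1 h1
  · refine ιMulti_int_sum_smul (fun i => T.dlog (b i)) (fun i => T.dlog (b' i)) _ fun i => ?_
    conv_lhs => rw [← b.sum_repr (b' i), map_sum]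
    exact Finset.sum_congr rfl fun j _ => map_zsmul _ _ _

/-- The order of a pluricanonical form along a divisor of a toric chart, computed with the
logarithmic volume form of any lattice basis. -/
lemma hasOrd_of_hasOrder (b b' : Module.Basis (Fin 3) ℤ M) {q : MvPolynomial (Fin 3) k}
    (hq : Prime q) (hA : ∀ f : A, (T.chart b').IsRegularAlong q (algebraMap A (FractionRing A) f))
    {h C : FractionRing A} {ω : RationalForms k A 3} {m : ℕ} {e n : ℤ}
    (hω : ω ≠ 0) (H : ((T.chart b').divisor hq hA).HasOrder h ω m e)
    (hC : ω = C • T.logVol b) (hn : (T.chart b').HasOrd q (T.mon (∑ i, b' i)) n) :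
    (T.chart b').HasOrd q (h * C ^ m) (e + m * n) := by
  obtain ⟨ε, hε, hlog⟩ := T.logVol_eq b b'
  have hε' : (T.chart b').HasOrd q ((ε : FractionRing A)) 0 := by
    have h1 : ¬ q ∣ 1 := fun h => hq.not_isUnit (isUnit_of_dvd_one h)
    rcases hε with rfl | rfl
    · simpa using Chart.hasOrd_one hq
    · exact ⟨-1, 1, by simpa using h1, h1, by simp⟩
  refine Chart.hasOrd_of_hasOrder hq hA hω H hC (t := T.mon (∑ i, b' i) * ε) ?_ ?_
  · rw [vol_chart, hlog, smul_smul]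
  · simpa using hn.mul hq hε'

/-! ### Toric and non-toric divisors -/

variable (b : Module.Basis (Fin 3) ℤ M)

lemma isRegularAlong_X (hb : ∀ a : M, (∀ i, 0 ≤ (a : Fin 3 → ℤ) i) → 0 ≤ b.repr a 0) (f : A) :
    (T.chart b).IsRegularAlong (X 0) (algebraMap A (FractionRing A) f) := by
  obtain ⟨f', hf', hpos⟩ := T.exists_laur_eq_algebraMap f
  rw [← hf']
  by_cases h0 : f' = 0
  · rw [h0, map_zero]
    exact (T.chart b).isRegularAlong_zero (prime_X 0)
  · obtain ⟨n, hn, ⟨a, ha, rfl⟩, -⟩ := T.exists_hasOrd_laur b h0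
    exact hn.isRegularAlong (hb a (hpos a ha))

/-- The toric divisor of a lattice basis whose first coordinate is non-negative on the exponents
of the toric algebra. -/
def toricDivisor (hb : ∀ a : M, (∀ i, 0 ≤ (a : Fin 3 → ℤ) i) → 0 ≤ b.repr a 0) :
    DivisorOver k A 3 :=
  (T.chart b).divisor (prime_X 0) (T.isRegularAlong_X b hb)

lemma mem_center_toricDivisor_iff
    (hb : ∀ a : M, (∀ i, 0 ≤ (a : Fin 3 → ℤ) i) → 0 ≤ b.repr a 0) {f : A} {f' : M →₀ k}
    (hf : T.laur f' = algebraMap A (FractionRing A) f) :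
    f ∈ (T.toricDivisor b hb).center ↔ ∀ a ∈ f'.support, 0 < b.repr a 0 := by
  by_cases h0 : f' = 0
  · have : f = 0 := by
      rw [h0, map_zero] at hf
      exact IsFractionRing.to_map_eq_zero_iff.1 hf.symm
    rw [this, h0]
    exact ⟨fun _ a ha => absurd ha (by simp), fun _ => Ideal.zero_mem _⟩
  · obtain ⟨n, hn, ⟨a, ha, rfl⟩, hmin⟩ := T.exists_hasOrd_laur b h0
    rw [hf] at hn
    rw [toricDivisor, (T.chart b).mem_center_divisor_iff _ _ hn]
    exact ⟨fun h a' ha' => h.trans_le (hmin a' ha'), fun h => h a ha⟩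

variable {b} in
lemma hasOrd_mon_of_not_dvd {q : MvPolynomial (Fin 3) k} (hq : Prime q) (hqX : ∀ i, ¬ q ∣ X i)
    (a : M) : (T.chart b).HasOrd q (T.mon a) 0 := by
  have h1 : ∀ i, (T.chart b).HasOrd q (T.mon (b i)) 0 := fun i => by
    have := Chart.hasOrd_of_not_dvd (c := T.chart b) hq (hqX i)
    rwa [chart_θ_X] at this
  rw [T.mon_eq_zpow b a, Fin.prod_univ_three]
  simpa using (((h1 0).zpow hq (b.repr a 0)).mul hq ((h1 1).zpow hq (b.repr a 1))).mul hq
    ((h1 2).zpow hq (b.repr a 2))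

/-- An element of the toric algebra is a polynomial in the coordinates of a toric chart, up to a
Laurent monomial. -/
lemma exists_eq_basisHom_mul_mon (f : A) :
    ∃ p a, algebraMap A (FractionRing A) f = (T.chart b).θ p * T.mon a := by
  obtain ⟨f', hf', -⟩ := T.exists_laur_eq_algebraMap f
  obtain ⟨N, hN⟩ := exists_repr_bound b f'.support
  have h1 : ∀ i, b.repr (latticeVec b (natExp fun _ => N)) i = N := by
    intro i; simp [repr_latticeVec, natExp]
  obtain ⟨p, hp, -⟩ := T.exists_basisHom_eq_laur_mul_mon b (f := f')
    (a₀ := latticeVec b (natExp fun _ => N)) (by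
      intro a ha i
      rw [map_add, Finsupp.add_apply, h1]
      exact hN a ha i)
  refine ⟨p, -latticeVec b (natExp fun _ => N), ?_⟩
  rw [chart_θ, hp, T.mon_neg, mul_inv_cancel_right₀ (T.mon_ne_zero _), hf']

variable {b} in
lemma isRegularAlong_of_not_dvd {q : MvPolynomial (Fin 3) k} (hq : Prime q)
    (hqX : ∀ i, ¬ q ∣ X i) (f : A) :
    (T.chart b).IsRegularAlong q (algebraMap A (FractionRing A) f) := by
  obtain ⟨p, a, h⟩ := T.exists_eq_basisHom_mul_mon b f
  rw [h]
  by_cases hp : p = 0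
  · rw [hp, map_zero, zero_mul]
    exact (T.chart b).isRegularAlong_zero hq
  · obtain ⟨n, hn⟩ := Chart.exists_hasOrd_poly (c := T.chart b) hq hp
    exact (hn.mul hq (T.hasOrd_mon_of_not_dvd hq hqX a)).isRegularAlong (by simp)

/-- A Laurent monomial with non-negative exponents, as an element of the toric algebra. -/
lemma exists_algebraMap_eq_mon {a : M} (ha : ∀ i, 0 ≤ (a : Fin 3 → ℤ) i) :
    ∃ u : A, algebraMap A (FractionRing A) u = T.mon a := by
  have h : intExp (natExp a) ∈ M := by rw [intExp_natExp ha]; exact a.2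
  refine ⟨T.mono h, ?_⟩
  have : a = ⟨intExp (natExp a), h⟩ := Subtype.ext (intExp_natExp ha).symm
  conv_rhs => rw [this, T.mon_intExp]
  rfl

/-- The divisors of a toric chart outside the toric boundary have centers of codimension one, as
multiplying by a monomial takes any Laurent polynomial to the toric algebra. -/
lemma isPrimeDivisor_of_not_dvd [IsNoetherianRing A] {q : MvPolynomial (Fin 3) k} (hq : Prime q)
    (hqX : ∀ i, ¬ q ∣ X i) :
    ((T.chart b).divisor hq (T.isRegularAlong_of_not_dvd hq hqX)).IsPrimeDivisor := by
  refine (T.chart b).isPrimeDivisor_divisor _ _ fun p => ?_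
  obtain ⟨f, hf, -⟩ := T.exists_laur_eq_basisHom b p
  obtain ⟨a₀, h1, h2, -⟩ := T.exists_mon_bound f.support Set.univ
  obtain ⟨g, hg, -⟩ := T.exists_algebraMap_eq_laur_mul_mon (f := f) (a₀ := a₀)
    fun a ha i => h1 i trivial a ha
  obtain ⟨u, hu⟩ := T.exists_algebraMap_eq_mon h2
  refine ⟨u, g, ?_, ?_⟩
  · rw [hu]; exact T.hasOrd_mon_of_not_dvd hq hqX a₀
  · rw [hg, hf, hu, chart_θ, mul_comm]

lemma isPrimeDivisor_coordinate [IsNoetherianRing A] {i : Fin 3}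
    (hb : ∀ a : M, b.repr a 0 = (a : Fin 3 → ℤ) i) :
    (T.toricDivisor b fun a ha => (hb a).symm ▸ ha i).IsPrimeDivisor := by
  refine (T.chart b).isPrimeDivisor_divisor _ _ fun p => ?_
  obtain ⟨f, hf, -, hs⟩ := T.exists_laur_eq_basisHom b p
  obtain ⟨a₀, h1, h2, h3⟩ := T.exists_mon_bound f.support {i}ᶜ
  obtain ⟨g, hg, -⟩ := T.exists_algebraMap_eq_laur_mul_mon (f := f) (a₀ := a₀) (by
    intro a ha j
    by_cases hj : j = i
    · subst hj
      obtain ⟨s, -, rfl⟩ := hs a ha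
      have := h3 j (by simp)
      rw [Pi.add_apply, this, ← hb, repr_latticeVec]
      simp
    · exact h1 j hj a ha)
  obtain ⟨u, hu⟩ := T.exists_algebraMap_eq_mon h2
  refine ⟨u, g, ?_, ?_⟩
  · rw [hu]
    have := T.hasOrd_mon b a₀
    rwa [hb, h3 i (by simp)] at this
  · rw [hg, hf, hu, chart_θ, mul_comm]

end IsToric

end

section

open MvPolynomial

/-! ### Discrepancies of toric divisors -/

namespace IsToric

variable {k : Type*} [Field k] {A : Subalgebra k (MvPolynomial (Fin 3) k)}
  {M : AddSubgroup (Fin 3 → ℤ)} {r : ℕ} (T : IsToric A M r)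
  (b : Module.Basis (Fin 3) ℤ M) (β : Fin 3 → Module.Basis (Fin 3) ℤ M) (v : Fin 3 → ℝ)

/-- The difference between the order along the toric divisor with weight `v` and the corresponding
combination of the orders along the three coordinate divisors. -/
def defect (z : FractionRing A) : ℝ :=
  (T.chart b).ordX z - ∑ i, v i * (T.chart (β i)).ordX z

lemma defect_mul {z w : FractionRing A} (hz : z ≠ 0) (hw : w ≠ 0) :
    T.defect b β v (z * w) = T.defect b β v z + T.defect b β v w := by
  simp only [defect, Chart.ordX_mul hz hw, Int.cast_add, mul_add, Finset.sum_add_distrib]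
  ring

variable {b β v} (hb : ∀ a : M, (b.repr a 0 : ℝ) = ∑ i, v i * (a : Fin 3 → ℤ) i)
  (hβ : ∀ i (a : M), (β i).repr a 0 = (a : Fin 3 → ℤ) i) (hv : ∀ i, 0 ≤ v i)

include hb hβ in
lemma defect_mon (a : M) : T.defect b β v (T.mon a) = 0 := by
  simp only [defect, Chart.ordX_eq (T.hasOrd_mon _ a), hb, hβ, sub_self]

include hb hβ hv in
/-- The minimum of a sum is at least the sum of the minima. -/
lemma defect_laur_nonneg {f : M →₀ k} (hf : f ≠ 0) : 0 ≤ T.defect b β v (T.laur f) := by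
  obtain ⟨n, hn, ⟨a, ha, rfl⟩, -⟩ := T.exists_hasOrd_laur b hf
  rw [defect, Chart.ordX_eq hn, hb, ← Finset.sum_sub_distrib]
  refine Finset.sum_nonneg fun i _ => ?_
  obtain ⟨m, hm, -, hmin⟩ := T.exists_hasOrd_laur (β i) hf
  rw [Chart.ordX_eq hm, ← mul_sub]
  refine mul_nonneg (hv i) (sub_nonneg.2 ?_)
  rw [← hβ i a]
  exact_mod_cast hmin a ha

include hb hβ hv in
lemma defect_poly_nonneg {p : MvPolynomial (Fin 3) k} (hp : p ≠ 0) :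
    0 ≤ T.defect b β v ((T.chart b).θ p) := by
  obtain ⟨f, hf, hf0, -⟩ := T.exists_laur_eq_basisHom b p
  rw [chart_θ, ← hf]
  exact T.defect_laur_nonneg hb hβ hv (hf0 hp)

include hβ hv in
lemma defect_algebraMap_nonpos {f : A} (hf : f ≠ 0)
    (h0 : (T.chart b).ordX (algebraMap A (FractionRing A) f) = 0) :
    T.defect b β v (algebraMap A (FractionRing A) f) ≤ 0 := by
  obtain ⟨f', hf', hpos⟩ := T.exists_laur_eq_algebraMap f
  have hf0 : f' ≠ 0 := by
    rintro rfl
    rw [map_zero] at hf'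
    exact hf (IsFractionRing.to_map_eq_zero_iff.1 hf'.symm)
  rw [defect, h0, Int.cast_zero, zero_sub, neg_nonpos]
  refine Finset.sum_nonneg fun i _ => mul_nonneg (hv i) ?_
  obtain ⟨m, hm, ⟨a, ha, rfl⟩, -⟩ := T.exists_hasOrd_laur (β i) hf0
  rw [← hf', Chart.ordX_eq hm, hβ]
  exact_mod_cast hpos a ha i

include hb hβ hv in
lemma defect_isUnit {p : MvPolynomial (Fin 3) k} (hp : IsUnit p) :
    T.defect b β v ((T.chart b).θ p) = 0 := by
  obtain ⟨p', hp'⟩ := hp.exists_right_inv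
  have h1 : p ≠ 0 := hp.ne_zero
  have h2 : p' ≠ 0 := by rintro rfl; simp at hp'
  have h3 := T.defect_mul b β v ((T.chart b).map_ne_zero h1) ((T.chart b).map_ne_zero h2)
  have h4 : T.defect b β v 1 = 0 := by
    rw [← T.mon_zero]; exact T.defect_mon hb hβ 0
  rw [← map_mul, hp', map_one, h4] at h3
  have h5 := T.defect_poly_nonneg hb hβ hv h1
  have h6 := T.defect_poly_nonneg hb hβ hv h2
  linarith

include hb hβ hv in
lemma defect_of_dvd_X {q : MvPolynomial (Fin 3) k} (hq : Prime q) {i : Fin 3} (h : q ∣ X i) :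
    T.defect b β v ((T.chart b).θ q) = 0 := by
  obtain ⟨u, hu⟩ := hq.associated_of_dvd X_prime h
  have h1 := T.defect_mul b β v ((T.chart b).map_ne_zero hq.ne_zero)
    ((T.chart b).map_ne_zero u.isUnit.ne_zero)
  rw [← map_mul, hu, chart_θ_X, T.defect_mon hb hβ, T.defect_isUnit hb hβ hv u.isUnit] at h1
  linarith

include hb hv in
lemma repr_nonneg (a : M) (ha : ∀ i, 0 ≤ (a : Fin 3 → ℤ) i) : 0 ≤ b.repr a 0 := by
  have : (0 : ℝ) ≤ b.repr a 0 := by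
    rw [hb]
    exact Finset.sum_nonneg fun i _ => mul_nonneg (hv i) (by exact_mod_cast ha i)
  exact_mod_cast this

include hβ in
/-- A prime divisor outside the toric boundary that does not pass through the generic point of the
center of a toric divisor has defect zero. -/
lemma defect_of_not_center_le {q : MvPolynomial (Fin 3) k} (hq : Prime q) (hqX : ∀ i, ¬ q ∣ X i)
    (h : ¬ ((T.chart b).divisor hq (T.isRegularAlong_of_not_dvd hq hqX)).center ≤
      (T.toricDivisor b (repr_nonneg hb hv)).center) :
    T.defect b β v ((T.chart b).θ q) = 0 := by
  obtain ⟨f, hf, hfE⟩ := SetLike.not_le_iff_exists.1 h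
  have hf0 : f ≠ 0 := by
    rintro rfl; exact hfE (Ideal.zero_mem _)
  have hfK : algebraMap A (FractionRing A) f ≠ 0 := by
    rwa [Ne, IsFractionRing.to_map_eq_zero_iff]
  have hord := Chart.hasOrd_ordX (c := T.chart b) hfK
  rw [toricDivisor, (T.chart b).mem_center_divisor_iff _ _ hord] at hfE
  have hnn := hord.nonneg_of_isRegularAlong (prime_X 0)
    (T.isRegularAlong_X b (repr_nonneg hb hv) f)
  have hnp := T.defect_algebraMap_nonpos (b := b) hβ hv hf0 (by omega)
  obtain ⟨p, a, hpa⟩ := T.exists_eq_basisHom_mul_mon b f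
  have hp0 : p ≠ 0 := by
    rintro rfl; rw [hpa, map_zero, zero_mul] at hfK; exact hfK rfl
  obtain ⟨n, hn⟩ := Chart.exists_hasOrd_poly (c := T.chart b) hq hp0
  have hfn : (T.chart b).HasOrd q (algebraMap A (FractionRing A) f) n := by
    rw [hpa]
    simpa using hn.mul hq (T.hasOrd_mon_of_not_dvd hq hqX a)
  rw [(T.chart b).mem_center_divisor_iff _ _ hfn] at hf
  have h1 : ¬ q ∣ 1 := fun h => hq.not_isUnit (isUnit_of_dvd_one h)
  obtain ⟨p', rfl⟩ := (Chart.hasOrd_nonneg_of_dvd (c := T.chart b) hq (p := p) (s := 1) h1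
    (by simpa using hn)).2.2 hf
  have hp' : p' ≠ 0 := right_ne_zero_of_mul hp0
  have h2 := (T.chart b).map_ne_zero hq.ne_zero
  have h3 := (T.chart b).map_ne_zero hp'
  rw [hpa, map_mul, T.defect_mul b β v (mul_ne_zero h2 h3) (T.mon_ne_zero a),
    T.defect_mul b β v h2 h3, T.defect_mon hb hβ] at hnp
  -- The defects of `q` and of the cofactor `p'` are nonnegative with nonpositive sum.
  have h4 := T.defect_poly_nonneg hb hβ hv hq.ne_zero
  have h5 := T.defect_poly_nonneg hb hβ hv hp'
  linarith

include hb hβ hv in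
lemma defect_poly_eq_zero {p : MvPolynomial (Fin 3) k} (hp : p ≠ 0)
    (h : ∀ q, Prime q → q ∣ p → T.defect b β v ((T.chart b).θ q) = 0) :
    T.defect b β v ((T.chart b).θ p) = 0 := by
  induction p using UniqueFactorizationMonoid.induction_on_prime with
  | h₁ => exact absurd rfl hp
  | h₂ x hx => exact T.defect_isUnit hb hβ hv hx
  | h₃ a q ha hq ih =>
    rw [map_mul, T.defect_mul b β v ((T.chart b).map_ne_zero hq.ne_zero)
      ((T.chart b).map_ne_zero ha), h q hq (dvd_mul_right _ _),
      ih ha fun q' hq' hd => h q' hq' (hd.mul_left _), add_zero]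

include hβ in
/-- A rational function without zeros and poles along the prime divisors outside the toric boundary
that pass through the generic point of the center of a toric divisor has defect zero. -/
lemma defect_eq_zero {z : FractionRing A} (hz : z ≠ 0)
    (h : ∀ q, ∀ hq : Prime q, ∀ hqX : ∀ i, ¬ q ∣ X i,
      ((T.chart b).divisor hq (T.isRegularAlong_of_not_dvd hq hqX)).center ≤
        (T.toricDivisor b (repr_nonneg hb hv)).center → (T.chart b).HasOrd q z 0) :
    T.defect b β v z = 0 := by
  obtain ⟨p, s, hs, rfl⟩ := (T.chart b).surj z
  have hp : p ≠ 0 := by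
    rintro rfl; rw [map_zero, zero_div] at hz; exact hz rfl
  obtain ⟨p, s, c, hrel, rfl, rfl⟩ := UniqueFactorizationMonoid.exists_reduced_factors p hp s
  have hc := (T.chart b).map_ne_zero (left_ne_zero_of_mul hp)
  have hp := right_ne_zero_of_mul hp
  have hs := right_ne_zero_of_mul hs
  have hp0 := (T.chart b).map_ne_zero hp
  have hs0 := (T.chart b).map_ne_zero hs
  rw [map_mul, map_mul, mul_div_mul_left _ _ hc] at h ⊢
  have key : ∀ {p s : MvPolynomial (Fin 3) k}, p ≠ 0 → IsRelPrime p s →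
      (∀ q, ∀ hq : Prime q, ∀ hqX : ∀ i, ¬ q ∣ X i,
      ((T.chart b).divisor hq (T.isRegularAlong_of_not_dvd hq hqX)).center ≤
        (T.toricDivisor b (repr_nonneg hb hv)).center →
        (T.chart b).HasOrd q ((T.chart b).θ p / (T.chart b).θ s) 0) →
      T.defect b β v ((T.chart b).θ p) = 0 := by
    intro p s hp hrel h
    refine T.defect_poly_eq_zero hb hβ hv hp fun q hq hqp => ?_
    by_cases hqX : ∀ i, ¬ q ∣ X i
    · refine T.defect_of_not_center_le hb hβ hv hq hqX fun hle => ?_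
      have hqs : ¬ q ∣ s := fun hqs => hq.not_isUnit (hrel hqp hqs)
      exact lt_irrefl _ ((Chart.hasOrd_nonneg_of_dvd hq hqs (h q hq hqX hle)).2.1 hqp)
    · push Not at hqX
      obtain ⟨i, hi⟩ := hqX
      exact T.defect_of_dvd_X hb hβ hv hq hi
  have h1 := key hp hrel h
  have h2 := key hs hrel.symm fun q hq hqX hle => by
    simpa using (h q hq hqX hle).inv
  have h3 := T.defect_mul b β v (div_ne_zero hp0 hs0) hs0
  rw [div_mul_cancel₀ _ hs0] at h3
  linarith

end IsToric

variable {k : Type*} [Field k] {A : Subalgebra k (MvPolynomial (Fin 3) k)}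
  {M : AddSubgroup (Fin 3 → ℤ)} {r : ℕ}

/-- The discrepancy of the toric divisor with primitive weight `v` is `∑ vᵢ - 1`: on a canonical
toric variety without ramification along the coordinate hyperplanes, `∑ vᵢ ≥ 1`. -/
theorem IsToric.one_le_sum_of_surjective (T : IsToric A M r) (hcan : IsCanonical k A 3)
    (hprim : ∀ i, ∃ a : M, (a : Fin 3 → ℤ) i = 1) {v : Fin 3 → ℝ} (hv : ∀ i, 0 ≤ v i)
    (φ : M →ₗ[ℤ] ℤ) (hφ : ∀ a : M, (φ a : ℝ) = ∑ i, v i * (a : Fin 3 → ℤ) i)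
    (hsurj : Function.Surjective φ) {i₀ j₀ : Fin 3} (hij : i₀ ≠ j₀) (hi₀ : 0 < v i₀)
    (hj₀ : 0 < v j₀) : 1 ≤ ∑ i, v i := by
  have : Algebra.FiniteType k A := hcan.finiteType
  have : IsNoetherianRing A := Algebra.FiniteType.isNoetherianRing k A
  obtain ⟨b, hbφ⟩ := T.exists_basis φ hsurj
  have hb : ∀ a : M, (b.repr a 0 : ℝ) = ∑ i, v i * (a : Fin 3 → ℤ) i := fun a => by
    rw [hbφ, hφ]
  have hβ : ∀ i, ∃ β : Module.Basis (Fin 3) ℤ M, ∀ a, β.repr a 0 = (a : Fin 3 → ℤ) i := by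
    intro i
    refine T.exists_basis ((Pi.evalAddMonoidHom (fun _ : Fin 3 => ℤ) i).comp
      M.subtype).toIntLinearMap fun n => ?_
    obtain ⟨a, ha⟩ := hprim i
    exact ⟨n • a, by simp [ha]⟩
  choose β hβ using hβ
  have hb0 := IsToric.repr_nonneg hb hv
  have hβ0 : ∀ i, ∀ a : M, (∀ j, 0 ≤ (a : Fin 3 → ℤ) j) → 0 ≤ (β i).repr a 0 :=
    fun i a ha => (hβ i a).symm ▸ ha i
  set E := T.toricDivisor b hb0 with hE
  have hP : ∀ i, (T.toricDivisor (β i) (hβ0 i)).IsPrimeDivisor := fun i =>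
    T.isPrimeDivisor_coordinate (β i) (hβ i)
  have hle : ∀ i, 0 < v i → (T.toricDivisor (β i) (hβ0 i)).center ≤ E.center := by
    intro i hi f hf
    obtain ⟨f', hf', hpos⟩ := T.exists_laur_eq_algebraMap f
    rw [T.mem_center_toricDivisor_iff _ _ hf'] at hf
    rw [hE, T.mem_center_toricDivisor_iff _ _ hf']
    intro a ha
    have h1 := hf a ha
    rw [hβ] at h1
    have h2 : (0 : ℝ) < b.repr a 0 := by
      rw [hb]
      exact Finset.sum_pos' (fun j _ => mul_nonneg (hv j) (by exact_mod_cast hpos a ha j))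
        ⟨i, Finset.mem_univ i, mul_pos hi (by exact_mod_cast h1)⟩
    exact_mod_cast h2
  have hexc : E.IsExceptional := by
    have hlt : (T.toricDivisor (β i₀) (hβ0 i₀)).center < E.center := by
      refine lt_of_le_of_ne (hle i₀ hi₀) fun heq => ?_
      -- the monomial `x_{j₀} ^ r` separates the two centers
      let a : M := ⟨fun i => r * if i = j₀ then 1 else 0, T.mem _⟩
      have ha : ∀ i, 0 ≤ (a : Fin 3 → ℤ) i := by
        intro i
        change 0 ≤ (r : ℤ) * if i = j₀ then 1 else 0
        positivity
      obtain ⟨u, hu⟩ := T.exists_algebraMap_eq_mon ha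
      have hu' : T.laur (Finsupp.single a 1) = algebraMap A (FractionRing A) u := by
        rw [T.laur_single, one_smul, hu]
      have h1 : u ∈ E.center := by
        rw [hE, T.mem_center_toricDivisor_iff _ _ hu']
        intro a' ha'
        rw [Finset.mem_singleton.1 (Finsupp.support_single_subset ha')]
        have h2 : (0 : ℝ) < b.repr a 0 := by
          rw [hb]
          have hr : (0 : ℝ) < r := by exact_mod_cast T.pos
          exact Finset.sum_pos' (fun j _ => mul_nonneg (hv j) (by exact_mod_cast ha j))
            ⟨j₀, Finset.mem_univ _, by simpa [a] using mul_pos hj₀ hr⟩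
        exact_mod_cast h2
      rw [← heq, T.mem_center_toricDivisor_iff _ _ hu'] at h1
      have h3 := h1 a (by simp)
      rw [hβ] at h3
      simp [a, hij] at h3
    have h1 : (T.toricDivisor (β i₀) (hβ0 i₀)).center.height = 1 := hP i₀
    have : (T.toricDivisor (β i₀) (hβ0 i₀)).center.IsPrime :=
      (T.chart (β i₀)).isPrime_center_divisor _ _
    have : E.center.IsPrime := (T.chart b).isPrime_center_divisor _ _
    have h2 := Ideal.height_strict_mono_of_isPrime_of_isPrime hlt
    rwa [h1] at h2
  obtain ⟨d, ⟨m, h, ω, e, hm, hh, hω, hprime, hord, hd⟩, hd0⟩ :=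
    hcan.discrepancy_nonneg E hexc
  have he : 0 ≤ e := by
    by_contra hneg
    push Not at hneg
    have h1 : (e : ℚ) / m < 0 :=
      div_neg_of_neg_of_pos (by exact_mod_cast hneg) (by exact_mod_cast hm)
    rw [hd] at hd0
    exact absurd hd0 (not_le.2 h1)
  obtain ⟨C, hC⟩ : ∃ C : FractionRing A, ω = C • T.logVol b := by
    obtain ⟨t, ht, -⟩ := (T.chart b).exists_hasOrd_of_hasOrder _ _ hω hord
    exact ⟨_, by rw [ht, T.vol_chart, smul_smul]⟩
  have hsum : ∀ b' : Module.Basis (Fin 3) ℤ M,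
      (T.chart b').HasOrd (X 0) (T.mon (∑ i, b' i)) 1 := by
    intro b'
    have := T.hasOrd_mon b' (∑ i, b' i)
    rwa [show b'.repr (∑ i, b' i) 0 = 1 by
      rw [map_sum, Finset.sum_apply']; simp [Finsupp.single_apply]] at this
  -- A pluricanonical form is `h C ^ m` times a power of the logarithmic volume form, which has a
  -- simple pole along each coordinate divisor: this accounts for the shift of the orders by `m`.
  have hE1 := T.hasOrd_of_hasOrder b b _ _ hω hord hC (hsum b)
  have hP1 : ∀ i, 0 < v i → (T.chart (β i)).HasOrd (X 0) (h * C ^ m) m := by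
    intro i hi
    have := T.hasOrd_of_hasOrder b (β i) _ _ hω (hprime _ (hP i) (hle i hi)) hC (hsum (β i))
    simpa using this
  have hdef := T.defect_eq_zero hb hβ hv (hE1.ne_zero (prime_X 0)) fun q hq hqX hcen => by
    have := T.hasOrd_of_hasOrder b b hq _ hω
      (hprime _ (T.isPrimeDivisor_of_not_dvd b hq hqX) hcen) hC
      (T.hasOrd_mon_of_not_dvd hq hqX (∑ i, b i))
    simpa using this
  have hsumv : ∑ i, v i * ((T.chart (β i)).ordX (h * C ^ m) : ℝ) = ∑ i, v i * m := by
    refine Finset.sum_congr rfl fun i _ => ?_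
    rcases (hv i).eq_or_lt with h0 | h0
    · rw [← h0, zero_mul, zero_mul]
    · rw [Chart.ordX_eq (hP1 i h0)]
      norm_cast
  rw [IsToric.defect, Chart.ordX_eq hE1, hsumv, ← Finset.sum_mul] at hdef
  push_cast at hdef
  have hm' : (0 : ℝ) < m := by exact_mod_cast hm
  have he' : (0 : ℝ) ≤ e := by exact_mod_cast he
  have h3 : (m : ℝ) * 1 ≤ m * ∑ i, v i := by linarith
  exact le_of_mul_le_mul_left h3 hm'

end

section

/-! ### Ages on canonical toric varieties -/

variable {k : Type*} [Field k] {A : Subalgebra k (MvPolynomial (Fin 3) k)}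
  {M : AddSubgroup (Fin 3 → ℤ)} {r : ℕ}

/-- On a canonical toric variety without ramification along the coordinate hyperplanes, every
element of the dual lattice in the interior of a face of dimension at least two of the octant has
coordinate sum at least one. -/
theorem IsToric.one_le_sum (T : IsToric A M r) (hcan : IsCanonical k A 3)
    (hprim : ∀ i, ∃ a : M, (a : Fin 3 → ℤ) i = 1) {y : Fin 3 → ℝ} (hy : ∀ i, 0 ≤ y i)
    (hint : ∀ a : M, ∃ n : ℤ, ∑ i, y i * ((a : Fin 3 → ℤ) i : ℝ) = n) {i₀ j₀ : Fin 3}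
    (hij : i₀ ≠ j₀) (hi₀ : 0 < y i₀) (hj₀ : 0 < y j₀) : 1 ≤ ∑ i, y i := by
  choose n hn using hint
  let ψ : M →ₗ[ℤ] ℤ := (AddMonoidHom.mk' n (by
    intro a b
    have : ((n (a + b) : ℤ) : ℝ) = ((n a + n b : ℤ) : ℝ) := by
      rw [← hn, Int.cast_add, ← hn, ← hn, ← Finset.sum_add_distrib]
      refine Finset.sum_congr rfl fun i _ => ?_
      simp [mul_add]
    exact_mod_cast this)).toIntLinearMap
  have hψ : ∀ a, ψ a = n a := fun _ => rfl
  -- Dividing `y` by a generator `d` of its values makes it primitive and does not increase its sum.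
  obtain ⟨d, hd⟩ := (inferInstance : (LinearMap.range ψ).IsPrincipal).principal
  have hmem : ∀ x, (∃ a, ψ a = x) ↔ d ∣ x := by
    intro x
    rw [← LinearMap.mem_range, hd, Submodule.mem_span_singleton]
    exact ⟨fun ⟨c, hc⟩ => ⟨c, by rw [← hc, smul_eq_mul, mul_comm]⟩,
      fun ⟨c, hc⟩ => ⟨c, by rw [hc, smul_eq_mul, mul_comm]⟩⟩
  have hd0 : d ≠ 0 := by
    rintro rfl
    have h1 := (hmem (ψ ⟨_, T.mem fun i => if i = i₀ then 1 else 0⟩)).1 ⟨_, rfl⟩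
    rw [zero_dvd_iff, hψ] at h1
    have h2 := hn ⟨_, T.mem fun i => if i = i₀ then 1 else 0⟩
    rw [h1] at h2
    have hr : (0 : ℝ) < r := by exact_mod_cast T.pos
    simp at h2
    rcases h2 with h2 | h2
    · exact hi₀.ne' h2
    · exact hr.ne' (by exact_mod_cast h2)
  have hdpos : (1 : ℝ) ≤ |d| := by exact_mod_cast Int.one_le_abs hd0
  have hdiv : ∀ a, |d| ∣ ψ a := fun a => (abs_dvd _ _).2 ((hmem _).1 ⟨a, rfl⟩)
  let φ : M →ₗ[ℤ] ℤ := (AddMonoidHom.mk' (fun a => ψ a / |d|) (by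
    intro a b
    rw [map_add, Int.add_ediv_of_dvd_left (hdiv a)])).toIntLinearMap
  have hφ : ∀ a, φ a = ψ a / |d| := fun _ => rfl
  have hle := T.one_le_sum_of_surjective hcan hprim (v := fun i => y i / |d|)
    (fun i => div_nonneg (hy i) (by positivity)) φ (by
      intro a
      have h1 : ((ψ a / |d| : ℤ) : ℝ) = (ψ a : ℝ) / (|d| : ℤ) :=
        Int.cast_div (hdiv a) (by simpa using hd0)
      rw [hφ, h1, hψ, ← hn, Finset.sum_div]
      refine Finset.sum_congr rfl fun i _ => ?_
      push_cast
      ring) (by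
      intro c
      obtain ⟨a, ha⟩ := (hmem (c * |d|)).2 ((self_dvd_abs d).mul_left c)
      exact ⟨a, by rw [hφ, ha, Int.mul_ediv_cancel _ (by simpa using hd0)]⟩) hij
    (div_pos hi₀ (by linarith)) (div_pos hj₀ (by linarith))
  rw [← Finset.sum_div, le_div_iff₀ (by linarith)] at hle
  linarith

/-! ### The arithmetic of empty tetrahedra -/

lemma exists_least_mul_ge {c x : ℕ} (j : ℕ) (h : c ≤ j * x) :
    ∃ n, c ≤ n * x ∧ ∀ i < n, i * x < c := by
  have hex : ∃ j, c ≤ j * x := ⟨j, h⟩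
  exact ⟨Nat.find hex, Nat.find_spec hex, fun i hi => not_le.1 (Nat.find_min hex hi)⟩

/-- The case of `exists_eq_one_of_sum_mod` where both `B / m` and `C / m` have multiples above one
is impossible: the jumps of the multiples of `a / m` are shared out between `B / m`, which gets the
first one, and `C / m`, and around the first jump of `C / m` the jumps of `B / m` would be too far
apart. -/
lemma false_of_div_eq_add_div {m a B C n : ℕ} (ham : 2 * a < m) (hC : 2 ≤ C)
    (hdiv : ∀ j, 0 < j → j < m → j * a / m = j * B / m + j * C / m)
    (hn0 : 0 < n) (hnm : n < m) (hn : (n - 1) * a < m) (hnB : m ≤ n * B) (hnC : n * C < m) :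
    False := by
  have hm : 0 < m := by omega
  have hCm : C < m := lt_of_le_of_lt (Nat.le_mul_of_pos_left C hn0) hnC
  have hex : m ≤ (m - n) * C := by
    obtain ⟨t, rfl⟩ : ∃ t, m = n + t := ⟨m - n, by omega⟩
    rw [Nat.add_sub_cancel_left]
    nlinarith
  obtain ⟨K, hK, hKmin⟩ : ∃ K, m ≤ K * C ∧ ∀ j < K, j * C < m :=
    exists_least_mul_ge (m - n) hex
  have hKle : K ≤ m - n := by
    by_contra h
    have := hKmin (m - n) (by omega)
    omega
  have hnK : n < K := by
    by_contra h
    have := Nat.mul_le_mul_right C (not_lt.1 h)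
    omega
  obtain ⟨K, rfl⟩ : ∃ t, K = t + 1 := ⟨K - 1, by omega⟩
  -- The first jump of the multiples of `C / m` takes place at `K + 1`, and as those of `a / m` jump
  -- by one at most, the value `q` of those of `B / m` has been reached before.
  have hg : (K + 1) * C / m = 1 := by
    have h1 := hKmin K (by omega)
    apply Nat.div_eq_of_lt_le
    · rwa [one_mul]
    · rw [Nat.add_mul]; omega
  set q := (K + 1) * B / m with hq
  have hq1 : 1 ≤ q := by
    rw [hq, Nat.le_div_iff_mul_le hm, one_mul]
    exact hnB.trans (Nat.mul_le_mul_right B hnK.le)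
  have hKq : q * m ≤ K * B := by
    rw [← Nat.le_div_iff_mul_le hm]
    have h1 := hdiv (K + 1) (by omega) (by omega)
    have h2 := hdiv K (by omega) (by omega)
    have h3 : K * C / m = 0 := Nat.div_eq_of_lt (hKmin K (by omega))
    have h4 : (K + 1) * a / m ≤ K * a / m + 1 := by
      rw [← Nat.add_div_right _ hm]
      apply Nat.div_le_div_right
      rw [Nat.add_mul]; omega
    omega
  obtain ⟨J, hJ, hJmin⟩ : ∃ J, q * m ≤ J * B ∧ ∀ j < J, j * B < q * m :=
    exists_least_mul_ge K hKq
  have hJK : J ≤ K := by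
    by_contra h
    have := hJmin K (by omega)
    omega
  have hJ0 : J ≠ 0 := by
    rintro rfl
    have := Nat.mul_pos hq1 hm
    omega
  obtain ⟨J, rfl⟩ : ∃ t, J = t + 1 := ⟨J - 1, by omega⟩
  -- The multiples of `B / m` jump to `q` at `J + 1`. After `n` more steps there is another jump of
  -- `B / m`, so that this is after the jump of `C / m`, and the multiples of `a / m` have jumped
  -- twice since `J` within `n + 1` steps, although `(n - 1) * a < m` and `2 * a < m`.
  have h1 : J * a < q * m := by
    rcases Nat.eq_zero_or_pos J with rfl | hJ'
    · have := Nat.mul_pos hq1 hm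
      omega
    · have h2 := hdiv J hJ' (by omega)
      have h3 : J * C / m = 0 := Nat.div_eq_of_lt (hKmin J (by omega))
      have h4 : J * B / m < q := (Nat.div_lt_iff_lt_mul hm).2 (hJmin J (by omega))
      rw [← Nat.div_lt_iff_lt_mul hm]
      omega
  have h2 : q + 1 ≤ (J + 1 + n) * B / m := by
    rw [Nat.le_div_iff_mul_le hm, Nat.add_mul, Nat.add_mul, one_mul]
    omega
  have h3 : K + 1 ≤ J + 1 + n := by
    by_contra h
    have h4 : (J + 1 + n) * B / m ≤ q :=
      Nat.div_le_div_right (Nat.mul_le_mul_right B (by omega))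
    omega
  have h4 : 1 ≤ (J + 1 + n) * C / m := by
    rw [Nat.le_div_iff_mul_le hm, one_mul]
    exact hK.trans (Nat.mul_le_mul_right C h3)
  have h5 := hdiv (J + 1 + n) (by omega) (by omega)
  have h6 : (q + 2) * m ≤ (J + 1 + n) * a := by
    rw [← Nat.le_div_iff_mul_le hm]
    omega
  obtain ⟨n, rfl⟩ : ∃ t, n = t + 1 := ⟨n - 1, by omega⟩
  rw [Nat.add_sub_cancel] at hn
  nlinarith

/-- White's theorem in the form that the jumps of the multiples of `a / m` are shared out between
those of `B / m` and of `C / m`. -/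
lemma exists_eq_one_of_two_mul_lt {m a B C : ℕ} (ham : 2 * a < m) (hB : 0 < B) (hC : 0 < C)
    (hsum : B + C = a + 1)
    (hdiv : ∀ j, 0 < j → j < m → j * a / m = j * B / m + j * C / m) : B = 1 ∨ C = 1 := by
  by_contra h
  push Not at h
  have hm : 0 < m := by omega
  have hex : m ≤ (m - 1) * a := by
    obtain ⟨t, rfl⟩ : ∃ t, m = 1 + t := ⟨m - 1, by omega⟩
    rw [Nat.add_sub_cancel_left]
    have : 3 ≤ a := by omega
    nlinarith
  obtain ⟨n, hn, hmin⟩ : ∃ n, m ≤ n * a ∧ ∀ j < n, j * a < m :=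
    exists_least_mul_ge (m - 1) hex
  have hnm : n < m := by
    by_contra h
    have := hmin (m - 1) (by omega)
    omega
  have hn0 : 0 < n := by
    rcases Nat.eq_zero_or_pos n with rfl | h
    · omega
    · exact h
  have h1 := hmin (n - 1) (by omega)
  have h2 : n * a / m = 1 := by
    apply Nat.div_eq_of_lt_le
    · rwa [one_mul]
    · obtain ⟨n, rfl⟩ : ∃ t, n = t + 1 := ⟨n - 1, by omega⟩
      rw [Nat.add_sub_cancel] at h1
      rw [Nat.add_mul]; omega
  have h3 := hdiv n hn0 hnm
  have key : ∀ {x}, 1 ≤ x / m → m ≤ x := fun hx => by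
    rw [Nat.le_div_iff_mul_le hm] at hx; omega
  have key0 : ∀ {x}, x / m = 0 → x < m := fun hx => by
    rcases Nat.div_eq_zero_iff.1 hx with h | h <;> omega
  have h3' : ∀ x y : ℕ, 1 = x + y → (1 ≤ x ∧ y = 0) ∨ (1 ≤ y ∧ x = 0) := by omega
  rcases (show (1 ≤ n * B / m ∧ n * C / m = 0) ∨ (1 ≤ n * C / m ∧ n * B / m = 0) from
    h3' _ _ (h2 ▸ h3)) with
    ⟨h4, h5⟩ | ⟨h4, h5⟩
  · exact false_of_div_eq_add_div ham (by omega) hdiv hn0 hnm h1 (key h4) (key0 h5)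
  · exact false_of_div_eq_add_div ham (by omega) (fun j h0 hj => by rw [hdiv j h0 hj, add_comm])
      hn0 hnm h1 (key h4) (key0 h5)

lemma exists_eq_one_of_lt_two_mul {m A B C : ℕ} (hA : m < 2 * A) (hAm : A < m) (hB : 0 < B)
    (hC : 0 < C) (hsum : A + B + C = m + 1) (hnd : ∀ j, 0 < j → j < m → ¬ m ∣ j * A)
    (hdiv : ∀ j, 0 < j → j < m → j * A / m + j * B / m + j * C / m + 1 = j) : B = 1 ∨ C = 1 := by
  refine exists_eq_one_of_two_mul_lt (m := m) (a := m - A) (by omega) hB hC (by omega)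
    fun j h0 hj => ?_
  have h1 := hdiv j h0 hj
  have h2 : j * (m - A) / m + j * A / m + 1 = j := by
    have hm : 0 < m := by omega
    have h3 := Nat.div_add_mod (j * A) m
    have h4 : 0 < j * A % m := Nat.pos_of_ne_zero fun h => hnd j h0 hj (Nat.dvd_of_mod_eq_zero h)
    have h5 := Nat.mod_lt (j * A) hm
    have h6 : j * (m - A) + j * A = m * j := by
      rw [← Nat.mul_add, Nat.sub_add_cancel hAm.le, Nat.mul_comm]
    have h7 : j * A / m + 1 ≤ j := by
      have : j * A / m < j := by
        rw [Nat.div_lt_iff_lt_mul hm]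
        exact Nat.mul_lt_mul_of_pos_left hAm h0
      omega
    obtain ⟨t, ht⟩ : ∃ t, j = j * A / m + 1 + t := ⟨j - (j * A / m + 1), by omega⟩
    have h8 : j * (m - A) / m = t := by
      have h9 : m * j = m * (j * A / m) + m + m * t := by
        conv_lhs => rw [ht]
        ring
      apply Nat.div_eq_of_lt_le
      · rw [Nat.mul_comm t m]; omega
      · rw [Nat.add_mul, Nat.mul_comm t m]; omega
    omega
  omega

/-- White's theorem on empty tetrahedra, in arithmetic form: if the residues of the multiples of
three integers modulo `m` add up to the least amount possible after the first, then one of the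
integers is `1`. -/
lemma exists_eq_one_of_sum_mod {m A B C : ℕ} (hm1 : 1 < m) (hA : A < m) (hB : B < m) (hC : C < m)
    (hnA : ∀ j, 0 < j → j < m → ¬ m ∣ j * A) (hnB : ∀ j, 0 < j → j < m → ¬ m ∣ j * B)
    (hnC : ∀ j, 0 < j → j < m → ¬ m ∣ j * C)
    (hmod : ∀ j, 0 < j → j < m → j * A % m + j * B % m + j * C % m = m + j) :
    A = 1 ∨ B = 1 ∨ C = 1 := by
  have hm : 0 < m := by omega
  have hpos : ∀ {x}, (∀ j, 0 < j → j < m → ¬ m ∣ j * x) → 0 < x := fun {x} h => by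
    rcases Nat.eq_zero_or_pos x with rfl | hx
    · exact absurd (by simp) (h 1 one_pos hm1)
    · exact hx
  have hA0 := hpos hnA
  have hB0 := hpos hnB
  have hC0 := hpos hnC
  have hsum : A + B + C = m + 1 := by
    have := hmod 1 one_pos hm1
    rwa [one_mul, one_mul, one_mul, Nat.mod_eq_of_lt hA, Nat.mod_eq_of_lt hB,
      Nat.mod_eq_of_lt hC] at this
  have hdiv : ∀ j, 0 < j → j < m → j * A / m + j * B / m + j * C / m + 1 = j := by
    intro j h0 hj
    have h1 := hmod j h0 hj
    have h2 := Nat.div_add_mod (j * A) m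
    have h3 := Nat.div_add_mod (j * B) m
    have h4 := Nat.div_add_mod (j * C) m
    have h5 : j * A + j * B + j * C = j * m + j := by rw [← Nat.mul_add, ← Nat.mul_add, hsum]; ring
    have h6 : m * (j * A / m + j * B / m + j * C / m + 1) = m * j := by
      rw [Nat.mul_comm m j]
      simp only [Nat.mul_add]
      omega
    exact Nat.eq_of_mul_eq_mul_left hm h6
  rcases (show m = 2 ∨ 2 < m by omega) with rfl | hm2
  · omega
  have h2 := hdiv 2 two_pos hm2
  have hnA2 := hnA 2 two_pos hm2
  have hnB2 := hnB 2 two_pos hm2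
  have hnC2 := hnC 2 two_pos hm2
  have key : ∀ {x}, ¬ m ∣ 2 * x → 2 * x / m ≠ 0 → m < 2 * x := by
    intro x hx h
    have h1 : m ≤ 2 * x := by
      by_contra h'
      exact h (Nat.div_eq_of_lt (by omega))
    refine lt_of_le_of_ne h1 fun h' => hx (by rw [← h'])
  by_cases hA' : 2 * A / m = 0
  · by_cases hB' : 2 * B / m = 0
    · have := exists_eq_one_of_lt_two_mul (key hnC2 (by omega)) hC hA0 hB0 (by omega) hnC
        fun j h0 hj => by have := hdiv j h0 hj; omega
      tauto
    · have := exists_eq_one_of_lt_two_mul (key hnB2 hB') hB hA0 hC0 (by omega) hnB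
        fun j h0 hj => by have := hdiv j h0 hj; omega
      tauto
  · have := exists_eq_one_of_lt_two_mul (key hnA2 hA') hA hB0 hC0 (by omega) hnA hdiv
    tauto

end

section

/-! ### Junior elements and unimodular triangles -/

/-- The elements of age one of the lattice `r⁻¹ L`, scaled by `r`: the elements of `L` in the
octant with coordinate sum `r`. -/
def IsJunior (L : AddSubgroup (Fin 3 → ℤ)) (r : ℤ) (v : Fin 3 → ℤ) : Prop :=
  v ∈ L ∧ (∀ i, 0 ≤ v i) ∧ v 0 + v 1 + v 2 = r

/-- Three junior elements are the vertices of a unimodular triangle if every element of `L` of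
integral age is an integer combination of them. -/
structure IsUnimodular (L : AddSubgroup (Fin 3 → ℤ)) (r : ℤ) (a b c : Fin 3 → ℤ) : Prop where
  fst : IsJunior L r a
  snd : IsJunior L r b
  thd : IsJunior L r c
  exists_eq : ∀ n ∈ L, r ∣ n 0 + n 1 + n 2 → ∃ x y z : ℤ, n = x • a + y • b + z • c

variable {L : AddSubgroup (Fin 3 → ℤ)} {r : ℤ} {a b c : Fin 3 → ℤ}

lemma comb_mem (ha : a ∈ L) (hb : b ∈ L) (hc : c ∈ L) (x y z : ℤ) :
    x • a + y • b + z • c ∈ L :=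
  L.add_mem (L.add_mem (L.zsmul_mem ha x) (L.zsmul_mem hb y)) (L.zsmul_mem hc z)

lemma IsJunior.of_nonneg {q : Fin 3 → ℤ} (hq : q ∈ L) {K : ℤ} (hK : 0 < K)
    (h : ∀ i, 0 ≤ K * q i) (hs : q 0 + q 1 + q 2 = r) : IsJunior L r q :=
  ⟨hq, fun i => nonneg_of_mul_nonneg_right (h i) hK, hs⟩

lemma IsUnimodular.swap (h : IsUnimodular L r a b c) : IsUnimodular L r b a c :=
  ⟨h.snd, h.fst, h.thd, fun n hn hs => by
    obtain ⟨x, y, z, e⟩ := h.exists_eq n hn hs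
    exact ⟨y, x, z, by rw [e, add_comm (x • a)]⟩⟩

lemma IsUnimodular.rotate (h : IsUnimodular L r a b c) : IsUnimodular L r b c a :=
  ⟨h.snd, h.thd, h.fst, fun n hn hs => by
    obtain ⟨x, y, z, e⟩ := h.exists_eq n hn hs
    exact ⟨y, z, x, by rw [e, add_assoc, add_comm (x • a)]⟩⟩

/-- Coordinates in a unimodular triangle are given by an integer vector. -/
lemma IsUnimodular.exists_dual (hr : 0 < r) (he : ∀ z : Fin 3 → ℤ, r • z ∈ L)
    (h : IsUnimodular L r a b c) :
    ∃ f : Fin 3 → ℤ, ∀ x y z : ℤ, f ⬝ᵥ (x • a + y • b + z • c) = r * z := by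
  have h1 : ∀ j : Fin 3, ∃ t : Fin 3 → ℤ,
      r • (Pi.single j 1 : Fin 3 → ℤ) = t 0 • a + t 1 • b + t 2 • c := by
    intro j
    obtain ⟨x, y, z, e⟩ := h.exists_eq (r • (Pi.single j 1 : Fin 3 → ℤ)) (he _) (by
      simp only [Pi.smul_apply, smul_eq_mul]
      exact dvd_add (dvd_add ⟨_, rfl⟩ ⟨_, rfl⟩) ⟨_, rfl⟩)
    exact ⟨![x, y, z], by simpa using e⟩
  choose t ht using h1
  let C : Matrix (Fin 3) (Fin 3) ℤ := t
  let V : Matrix (Fin 3) (Fin 3) ℤ := ![a, b, c]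
  have hCV : C * V = r • (1 : Matrix (Fin 3) (Fin 3) ℤ) := by
    ext j l
    have := congrFun (ht j) l
    simp only [Matrix.mul_apply, Fin.sum_univ_three, Matrix.smul_apply, Matrix.one_apply]
    simp only [Pi.smul_apply, Pi.single_apply, Pi.add_apply, smul_eq_mul] at this
    simp only [C, V, Matrix.cons_val_zero, Matrix.cons_val_one, Matrix.cons_val,
      smul_eq_mul]
    rw [← this]
    simp [eq_comm]
  have hdet : V.det ≠ 0 := by
    intro h0
    have := congrArg Matrix.det hCV
    rw [Matrix.det_mul, h0, mul_zero, Matrix.det_smul, Matrix.det_one, mul_one] at this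
    exact (pow_pos hr _).ne this
  have hVC : V * C = r • (1 : Matrix (Fin 3) (Fin 3) ℤ) := by
    have h2 : (V * C - r • 1) * V = 0 := by
      rw [sub_mul, Matrix.mul_assoc, hCV, Matrix.mul_smul, Matrix.smul_mul, Matrix.mul_one,
        Matrix.one_mul, sub_self]
    have h3 : (V * C - r • 1) * V * V.adjugate = 0 := by rw [h2, Matrix.zero_mul]
    rw [Matrix.mul_assoc, Matrix.mul_adjugate, Matrix.mul_smul, Matrix.mul_one] at h3
    exact sub_eq_zero.1 ((smul_eq_zero.1 h3).resolve_left hdet)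
  have e : ∀ i, V i 0 * C 0 2 + V i 1 * C 1 2 + V i 2 * C 2 2 = if i = 2 then r else 0 := by
    intro i
    have := congrFun (congrFun hVC i) 2
    simp only [Matrix.mul_apply, Fin.sum_univ_three, Matrix.smul_apply, Matrix.one_apply] at this
    rw [this]
    simp
  have e0 : a 0 * C 0 2 + a 1 * C 1 2 + a 2 * C 2 2 = 0 := e 0
  have e1 : b 0 * C 0 2 + b 1 * C 1 2 + b 2 * C 2 2 = 0 := e 1
  have e2 : c 0 * C 0 2 + c 1 * C 1 2 + c 2 * C 2 2 = r := e 2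
  refine ⟨fun j => C j 2, fun x y z => ?_⟩
  simp only [dotProduct, Fin.sum_univ_three, Pi.add_apply, Pi.smul_apply, smul_eq_mul]
  linear_combination x * e0 + y * e1 + z * e2

/-- Among the triangles with vertices in `S` whose cone contains `y`, one of least determinant
contains no further element of `S`. -/
lemma exists_triangle_of_minimal {S : Set (Fin 3 → ℤ)} (h0 : (0 : Fin 3 → ℤ) ∉ S) {y : Fin 3 → ℤ}
    (V : Matrix (Fin 3) (Fin 3) ℤ) (hV : ∀ i, V i ∈ S) (hdet : 0 < V.det) {t : ℤ} (ht : 0 < t)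
    {l : Fin 3 → ℤ} (hl : ∀ i, 0 ≤ l i) (hy : t • y = ∑ i, l i • V i) :
    ∃ V : Matrix (Fin 3) (Fin 3) ℤ, (∀ i, V i ∈ S) ∧ 0 < V.det ∧
      (∃ t : ℤ, 0 < t ∧ ∃ l : Fin 3 → ℤ, (∀ i, 0 ≤ l i) ∧ t • y = ∑ i, l i • V i) ∧
      ∀ q ∈ S, ∀ μ : Fin 3 → ℤ, (∀ i, 0 ≤ μ i ∧ μ i < V.det) → V.det • q ≠ ∑ i, μ i • V i := by
  induction hn : V.det.toNat using Nat.strong_induction_on generalizing V t l with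
  | _ n ih =>
  by_cases hmin : ∀ q ∈ S, ∀ μ : Fin 3 → ℤ, (∀ i, 0 ≤ μ i ∧ μ i < V.det) →
      V.det • q ≠ ∑ i, μ i • V i
  · exact ⟨V, hV, hdet, ⟨t, ht, l, hl, hy⟩, hmin⟩
  push Not at hmin
  obtain ⟨q, hqS, μ, hμ, hq⟩ := hmin
  -- The vertex to be replaced by `q` is the one for which `y` stays in the cone.
  obtain ⟨i, hi, himin⟩ : ∃ i, 0 < μ i ∧ ∀ j, 0 < μ j → l i * μ j ≤ l j * μ i := by
    have hne : (Finset.univ.filter fun i => 0 < μ i).Nonempty := by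
      by_contra hne
      rw [Finset.not_nonempty_iff_eq_empty, Finset.filter_eq_empty_iff] at hne
      have hz : ∀ i, μ i = 0 := fun i => le_antisymm (not_lt.1 (hne (Finset.mem_univ i))) (hμ i).1
      rw [Finset.sum_eq_zero fun i _ => by rw [hz i, zero_smul]] at hq
      exact h0 ((smul_eq_zero.1 hq).resolve_left hdet.ne' ▸ hqS)
    obtain ⟨i, hi, hmin⟩ := Finset.exists_min_image _ (fun i => (l i : ℚ) / μ i) hne
    rw [Finset.mem_filter] at hi
    refine ⟨i, hi.2, fun j hj => ?_⟩
    have := hmin j (Finset.mem_filter.2 ⟨Finset.mem_univ j, hj⟩)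
    rw [div_le_div_iff₀ (by exact_mod_cast hi.2) (by exact_mod_cast hj)] at this
    exact_mod_cast this
  have hd : (V.updateRow i q).det = μ i := by
    have h1 : (V.updateRow i (V.det • q)).det = μ i * V.det := by
      rw [hq, Matrix.det_updateRow_sum, smul_eq_mul]
    rw [Matrix.det_updateRow_smul, mul_comm] at h1
    exact mul_right_cancel₀ hdet.ne' h1
  -- The new determinant is `μ i < V.det`.
  refine ih (V.updateRow i q).det.toNat ?_ (V.updateRow i q) ?_ (by rwa [hd])
    (t := μ i * t) (mul_pos hi ht)
    (l := fun j => if j = i then l i * V.det else l j * μ i - l i * μ j) ?_ ?_ rfl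
  · rw [hd]
    have := (hμ i).2
    omega
  · intro j
    by_cases hj : j = i
    · subst hj; rwa [Matrix.updateRow_self]
    · rw [Matrix.updateRow_ne hj]; exact hV j
  · intro j
    split_ifs with hj
    · exact mul_nonneg (hl i) hdet.le
    · rcases (hμ j).1.eq_or_lt with h | h
      · rw [← h, mul_zero, sub_zero]; exact mul_nonneg (hl j) hi.le
      · exact sub_nonneg.2 (himin j h)
  · ext x
    have e1 := congrFun hy x
    have e2 := congrFun hq x
    simp only [Finset.sum_apply, Pi.smul_apply, smul_eq_mul, Fin.sum_univ_three] at e1 e2 ⊢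
    obtain rfl | rfl | rfl : i = 0 ∨ i = 1 ∨ i = 2 := by fin_cases i <;> simp
    · simp [Matrix.updateRow_apply]
      linear_combination μ 0 * e1 - l 0 * e2
    · simp [Matrix.updateRow_apply]
      linear_combination μ 1 * e1 - l 1 * e2
    · simp [Matrix.updateRow_apply]
      linear_combination μ 2 * e1 - l 2 * e2

/-- Reduction of a lattice element of integral age modulo the vertices of a triangle. -/
lemma exists_eq_or_junior (hr : 0 < r) {V : Matrix (Fin 3) (Fin 3) ℤ} (hV : ∀ i, IsJunior L r (V i))
    (hdet : 0 < V.det) {n : Fin 3 → ℤ} (hn : n ∈ L) (hs : r ∣ n 0 + n 1 + n 2) :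
    ∃ c : Fin 3 → ℤ, n = ∑ i, c i • V i ∨ ∃ q, IsJunior L r q ∧
      (∃ μ : Fin 3 → ℤ, (∀ i, 0 ≤ μ i ∧ μ i < V.det) ∧ V.det • q = ∑ i, μ i • V i) ∧
      (n = ∑ i, c i • V i + q ∨ n = ∑ i, c i • V i - q) := by
  set D := V.det with hD
  obtain ⟨ν, hν⟩ : ∃ ν : Fin 3 → ℤ, D • n = ∑ i, ν i • V i := by
    refine ⟨n ᵥ* V.adjugate, ?_⟩
    have : (n ᵥ* V.adjugate) ᵥ* V = D • n := by
      rw [Matrix.vecMul_vecMul, Matrix.adjugate_mul, Matrix.vecMul_smul, Matrix.vecMul_one]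
    rw [← this]
    ext x
    simp [Matrix.vecMul, dotProduct]
  set μ : Fin 3 → ℤ := fun i => ν i % D with hμdef
  set c : Fin 3 → ℤ := fun i => ν i / D with hcdef
  have hμ : ∀ i, 0 ≤ μ i ∧ μ i < D := fun i =>
    ⟨Int.emod_nonneg _ hdet.ne', Int.emod_lt_of_pos _ hdet⟩
  have hνi : ∀ i, ν i = D * c i + μ i := fun i => (Int.mul_ediv_add_emod (ν i) D).symm
  set u := n - ∑ i, c i • V i with hu
  have huμ : ∀ x, D * u x = μ 0 * V 0 x + μ 1 * V 1 x + μ 2 * V 2 x := by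
    intro x
    have e := congrFun hν x
    simp only [hu, Fin.sum_univ_three, Pi.add_apply, Pi.smul_apply, Pi.sub_apply,
      smul_eq_mul] at e ⊢
    rw [hνi 0, hνi 1, hνi 2] at e
    linear_combination e
  have huL : u ∈ L := L.sub_mem hn (L.sum_mem fun i _ => L.zsmul_mem (hV i).1 _)
  obtain ⟨k, hk⟩ : r ∣ u 0 + u 1 + u 2 := by
    obtain ⟨t, ht⟩ := hs
    refine ⟨t - (c 0 + c 1 + c 2), ?_⟩
    simp only [hu, Fin.sum_univ_three, Pi.add_apply, Pi.smul_apply, Pi.sub_apply, smul_eq_mul]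
    linear_combination ht - c 0 * (hV 0).2.2 - c 1 * (hV 1).2.2 - c 2 * (hV 2).2.2
  have hksum : D * k = μ 0 + μ 1 + μ 2 := by
    have : r * (D * k) = r * (μ 0 + μ 1 + μ 2) := by
      linear_combination huμ 0 + huμ 1 + huμ 2 - D * hk + μ 0 * (hV 0).2.2 + μ 1 * (hV 1).2.2 +
        μ 2 * (hV 2).2.2
    exact mul_left_cancel₀ hr.ne' this
  obtain ⟨m0, m0'⟩ := hμ 0
  obtain ⟨m1, m1'⟩ := hμ 1
  obtain ⟨m2, m2'⟩ := hμ 2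
  have hk0 : 0 ≤ k := nonneg_of_mul_nonneg_right (by omega : 0 ≤ D * k) hdet
  have hk3 : k < 3 := lt_of_mul_lt_mul_left (by omega : D * k < D * 3) hdet.le
  have hnu : n = ∑ i, c i • V i + u := by rw [hu]; abel
  refine (show k = 0 ∨ k = 1 ∨ k = 2 by omega).elim ?_ fun h => h.elim ?_ ?_
  · rintro rfl
    refine ⟨c, Or.inl ?_⟩
    have hu0 : u = 0 := by
      ext x
      have h2 := huμ x
      rw [show μ 0 = 0 by omega, show μ 1 = 0 by omega, show μ 2 = 0 by omega] at h2
      simp only [zero_mul, add_zero, mul_eq_zero] at h2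
      exact h2.resolve_left hdet.ne'
    rw [hnu, hu0, add_zero]
  · rintro rfl
    refine ⟨c, Or.inr ⟨u, .of_nonneg huL hdet (fun x => ?_) (by linarith), ⟨μ, hμ, ?_⟩,
      Or.inl hnu⟩⟩
    · rw [huμ x]
      have h0 := mul_nonneg m0 ((hV 0).2.1 x)
      have h1 := mul_nonneg m1 ((hV 1).2.1 x)
      have h2 := mul_nonneg m2 ((hV 2).2.1 x)
      linarith
    · ext x
      simpa [Fin.sum_univ_three] using huμ x
  · rintro rfl
    refine ⟨fun i => c i + 1, Or.inr ⟨V 0 + V 1 + V 2 - u, .of_nonneg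
      (L.sub_mem (L.add_mem (L.add_mem (hV 0).1 (hV 1).1) (hV 2).1) huL) hdet (fun x => ?_) ?_,
      ⟨fun i => D - μ i, fun i => ?_, ?_⟩, Or.inr ?_⟩⟩
    · have h0 := mul_nonneg (sub_nonneg.2 m0'.le) ((hV 0).2.1 x)
      have h1 := mul_nonneg (sub_nonneg.2 m1'.le) ((hV 1).2.1 x)
      have h2 := mul_nonneg (sub_nonneg.2 m2'.le) ((hV 2).2.1 x)
      simp only [Pi.sub_apply, Pi.add_apply, mul_sub, huμ x]
      linarith
    · simp only [Pi.sub_apply, Pi.add_apply]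
      linarith [(hV 0).2.2, (hV 1).2.2, (hV 2).2.2]
    · fin_cases i <;> simp <;> omega
    · ext x
      simp only [Pi.sub_apply, Fin.sum_univ_three, Pi.add_apply, Pi.smul_apply, smul_eq_mul]
      linear_combination -huμ x
    · rw [hnu]
      simp only [Fin.sum_univ_three, add_smul, one_smul]
      abel

lemma IsJunior.ne_zero (hr : 0 < r) (ha : IsJunior L r a) : a ≠ 0 := by
  rintro rfl
  have := ha.2.2
  simp at this
  omega

lemma isJunior_single (hr : 0 < r) (he : ∀ z : Fin 3 → ℤ, r • z ∈ L) (i : Fin 3) :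
    IsJunior L r (r • (Pi.single i 1 : Fin 3 → ℤ)) := by
  refine ⟨he _, fun j => ?_, ?_⟩
  · by_cases h : j = i
    · subst h; simp [hr.le]
    · simp [h]
  · fin_cases i <;> simp

lemma diagonal_row (i : Fin 3) :
    (Matrix.diagonal fun _ : Fin 3 => r) i = r • (Pi.single i 1 : Fin 3 → ℤ) := by
  ext j
  simp [Matrix.diagonal_apply, Pi.single_apply, eq_comm]

lemma smul_eq_sum_diagonal (y : Fin 3 → ℤ) :
    r • y = ∑ i, y i • (Matrix.diagonal fun _ : Fin 3 => r) i := by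
  simp only [diagonal_row, Fin.sum_univ_three]
  ext j
  fin_cases j <;> simp [mul_comm]

/-- The octant is covered by the cones over unimodular triangles of junior elements. -/
lemma exists_unimodular (hr : 0 < r) (he : ∀ z : Fin 3 → ℤ, r • z ∈ L) {y : Fin 3 → ℤ}
    (hy : ∀ i, 0 ≤ y i) : ∃ a b c, IsUnimodular L r a b c ∧
      ∃ t x₀ x₁ x₂ : ℤ, 0 < t ∧ 0 ≤ x₀ ∧ 0 ≤ x₁ ∧ 0 ≤ x₂ ∧ t • y = x₀ • a + x₁ • b + x₂ • c := by
  obtain ⟨V, hV, hdet, ⟨t, ht, l, hl, hty⟩, hmin⟩ := exists_triangle_of_minimal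
    (S := {v | IsJunior L r v}) (fun h => IsJunior.ne_zero hr h rfl)
    (Matrix.diagonal fun _ => r) (fun i => by rw [diagonal_row]; exact isJunior_single hr he i)
    (by rw [Matrix.det_diagonal]; exact Finset.prod_pos fun _ _ => hr) hr hy
    (smul_eq_sum_diagonal y)
  refine ⟨V 0, V 1, V 2, ⟨hV 0, hV 1, hV 2, fun n hn hs => ?_⟩, t, l 0, l 1, l 2, ht, hl 0, hl 1,
    hl 2, by rw [hty, Fin.sum_univ_three]⟩
  obtain ⟨c, h | ⟨q, hq, ⟨μ, hμ, hqμ⟩, -⟩⟩ := exists_eq_or_junior hr hV hdet hn hs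
  · exact ⟨c 0, c 1, c 2, by rw [h, Fin.sum_univ_three]⟩
  · exact absurd hqμ (hmin q hq μ hμ)

lemma IsUnimodular.of_two_mul_eq {o : Fin 3 → ℤ} (ho : IsJunior L r o) (ha : IsJunior L r a)
    (hb : IsJunior L r b) (hc : IsJunior L r c)
    (hspan : ∀ n ∈ L, r ∣ n 0 + n 1 + n 2 → ∃ x y z e : ℤ, n = x • a + y • b + z • c + e • o)
    (h : (2 : ℤ) • o = a + b) :
    ∃ b c, IsUnimodular L r o b c ∧ IsJunior L r ((2 : ℤ) • o - b) := by
  refine ⟨a, c, ⟨ho, ha, hc, fun n hn hs => ?_⟩, by rwa [h, add_sub_cancel_left]⟩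
  obtain ⟨x, y, z, e, rfl⟩ := hspan n hn hs
  refine ⟨2 * y + e, x - y, z, ?_⟩
  rw [show b = (2 : ℤ) • o - a by rw [h, add_sub_cancel_left]]
  module

/-- A junior element `o` that is not a vertex of the octant is a vertex of a unimodular triangle
that belongs to a fan of such triangles around `o`, on a segment or on a triangle centered
at `o`. -/
lemma exists_unimodular_of_junior (hr : 0 < r) (he : ∀ z : Fin 3 → ℤ, r • z ∈ L) {o : Fin 3 → ℤ}
    (ho : IsJunior L r o) (hne : ∀ i, o ≠ r • (Pi.single i 1 : Fin 3 → ℤ)) :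
    (∃ b c, IsUnimodular L r o b c ∧ IsJunior L r ((2 : ℤ) • o - b)) ∨
      ∃ b c, IsUnimodular L r o b c ∧ IsJunior L r ((3 : ℤ) • o - b - c) := by
  obtain ⟨V, hV, hdet, ⟨t, ht, l, hl, hty⟩, hmin⟩ := exists_triangle_of_minimal
    (S := {v | IsJunior L r v ∧ v ≠ o}) (fun h => IsJunior.ne_zero hr h.1 rfl)
    (Matrix.diagonal fun _ => r)
    (fun i => by rw [diagonal_row]; exact ⟨isJunior_single hr he i, (hne i).symm⟩)
    (by rw [Matrix.det_diagonal]; exact Finset.prod_pos fun _ _ => hr) hr ho.2.1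
    (smul_eq_sum_diagonal o)
  have hVJ : ∀ i, IsJunior L r (V i) := fun i => (hV i).1
  have hind : ∀ x : Fin 3 → ℤ, ∑ i, x i • V i = 0 → x = 0 := fun x hx =>
    Matrix.eq_zero_of_vecMul_eq_zero hdet.ne' (by
      rw [← hx]
      ext j
      simp [Matrix.vecMul, dotProduct])
  have hspan : ∀ n ∈ L, r ∣ n 0 + n 1 + n 2 → ∃ (c : Fin 3 → ℤ) (e : ℤ),
      (e = 0 ∨ e = 1 ∨ e = -1) ∧ n = ∑ i, c i • V i + e • o := by
    intro n hn hs
    obtain ⟨c, h | ⟨q, hq, ⟨μ, hμ, hqμ⟩, h⟩⟩ := exists_eq_or_junior hr hVJ hdet hn hs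
    · exact ⟨c, 0, Or.inl rfl, by rw [h, zero_smul, add_zero]⟩
    · have hqo : q = o := by
        by_contra hqo
        exact hmin q ⟨hq, hqo⟩ μ hμ hqμ
      subst hqo
      rcases h with h | h
      · exact ⟨c, 1, by simp, by rw [h, one_smul]⟩
      · exact ⟨c, -1, by simp, by rw [h, neg_one_smul, sub_eq_add_neg]⟩
  set D := V.det with hD
  obtain ⟨ν, hν⟩ : ∃ ν : Fin 3 → ℤ, D • o = ∑ i, ν i • V i := by
    refine ⟨o ᵥ* V.adjugate, ?_⟩
    have : (o ᵥ* V.adjugate) ᵥ* V = D • o := by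
      rw [Matrix.vecMul_vecMul, Matrix.adjugate_mul, Matrix.vecMul_smul, Matrix.vecMul_one]
    rw [← this]
    ext x
    simp [Matrix.vecMul, dotProduct]
  have hν0 : ∀ i, 0 ≤ ν i := by
    have h1 : (fun i => t * ν i - D * l i) = 0 := by
      apply hind
      simp only [sub_smul, mul_smul, Finset.sum_sub_distrib]
      rw [← Finset.smul_sum, ← Finset.smul_sum, ← hν, ← hty, smul_smul, smul_smul, mul_comm,
        sub_self]
    intro i
    have h2 := congrFun h1 i
    simp only [Pi.zero_apply] at h2
    exact nonneg_of_mul_nonneg_right (by rw [sub_eq_zero.1 h2]; exact mul_nonneg hdet.le (hl i)) ht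
  have hνs : ν 0 + ν 1 + ν 2 = D := by
    have e : ∀ x, D * o x = ν 0 * V 0 x + ν 1 * V 1 x + ν 2 * V 2 x := fun x => by
      simpa [Fin.sum_univ_three] using congrFun hν x
    have : r * (ν 0 + ν 1 + ν 2) = r * D := by
      linear_combination D * ho.2.2 - e 0 - e 1 - e 2 - ν 0 * (hVJ 0).2.2 - ν 1 * (hVJ 1).2.2 -
        ν 2 * (hVJ 2).2.2
    exact mul_left_cancel₀ hr.ne' this
  have hνD : ∀ i, ν i < D := by
    intro i
    by_contra h
    have h1 : ν = fun j => if j = i then D else 0 := by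
      have := hν0 0
      have := hν0 1
      have := hν0 2
      ext j
      fin_cases i <;> fin_cases j <;> simp at h ⊢ <;> omega
    rw [h1] at hν
    simp only [ite_smul, zero_smul, Finset.sum_ite_eq', Finset.mem_univ, if_true] at hν
    exact (hV i).2 ((smul_right_injective (Fin 3 → ℤ) hdet.ne') hν).symm
  -- Reduction of `2 o` modulo the triangle leaves `0`, `o` or `- o`: in the first case `2 o` is a sum
  -- of two vertices, and in the last one `3 o` is the sum of all of them.
  have h2o : (2 : ℤ) • o ∈ L := L.zsmul_mem ho.1 2
  obtain ⟨c, e, he, hc⟩ := hspan ((2 : ℤ) • o) h2o ⟨2, by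
    simp only [Pi.smul_apply, smul_eq_mul]; linarith [ho.2.2]⟩
  have hcν : ∀ i, (2 - e) * ν i = D * c i := by
    have h1 : (fun i => (2 - e) * ν i - D * c i) = 0 := by
      apply hind
      simp only [sub_smul, mul_smul, Finset.sum_sub_distrib]
      rw [← Finset.smul_sum, ← Finset.smul_sum, ← Finset.smul_sum, ← hν]
      have : (2 : ℤ) • o - e • o = ∑ i, c i • V i := by rw [hc]; abel
      rw [← this]
      module
    intro i
    exact sub_eq_zero.1 (congrFun h1 i)
  have hspan' : ∀ n ∈ L, r ∣ n 0 + n 1 + n 2 →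
      ∃ x y z e : ℤ, n = x • V 0 + y • V 1 + z • V 2 + e • o := by
    intro n hn hs
    obtain ⟨c, e, -, h⟩ := hspan n hn hs
    exact ⟨c 0, c 1, c 2, e, by rw [h, Fin.sum_univ_three]⟩
  have n0 := hν0 0
  have n1 := hν0 1
  have n2 := hν0 2
  have l0 := hνD 0
  have l1 := hνD 1
  have l2 := hνD 2
  have c0 := hcν 0
  have c1 := hcν 1
  have c2 := hcν 2
  have hc' : ((2 : ℤ) - e) • o = c 0 • V 0 + c 1 • V 1 + c 2 • V 2 := by
    rw [sub_smul, hc, Fin.sum_univ_three]; abel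
  have cnn : ∀ {x k y: ℤ}, 0 ≤ y → k * y = D * x → 0 ≤ k → 0 ≤ x := fun {x k y} h1 h2 h3 =>
    nonneg_of_mul_nonneg_right (by rw [← h2]; positivity : 0 ≤ D * x) hdet
  have clt : ∀ {x k y: ℤ}, y < D → k * y = D * x → 0 < k → x < k := fun {x k y} h1 h2 h3 =>
    lt_of_mul_lt_mul_left (by rw [← h2]; nlinarith : D * x < D * k) hdet.le
  have hsum : c 0 + c 1 + c 2 = 2 - e := by
    have : D * (c 0 + c 1 + c 2) = D * (2 - e) := by
      linear_combination -c0 - c1 - c2 + (2 - e) * hνs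
    exact mul_left_cancel₀ hdet.ne' this
  rcases he with rfl | rfl | rfl
  · left
    have := cnn n0 c0 (by norm_num)
    have := cnn n1 c1 (by norm_num)
    have := cnn n2 c2 (by norm_num)
    have := clt l0 c0 (by norm_num)
    have := clt l1 c1 (by norm_num)
    have := clt l2 c2 (by norm_num)
    rcases (show (c 0 = 1 ∧ c 1 = 1 ∧ c 2 = 0) ∨ (c 0 = 1 ∧ c 1 = 0 ∧ c 2 = 1) ∨
      (c 0 = 0 ∧ c 1 = 1 ∧ c 2 = 1) by omega) with ⟨h0, h1, h2⟩ | ⟨h0, h1, h2⟩ | ⟨h0, h1, h2⟩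
    · exact IsUnimodular.of_two_mul_eq ho (hVJ 0) (hVJ 1) (hVJ 2) hspan'
        (by rw [h0, h1, h2] at hc'; simpa using hc')
    · exact IsUnimodular.of_two_mul_eq ho (hVJ 0) (hVJ 2) (hVJ 1) (fun n hn hs => by
        obtain ⟨x, y, z, e, h⟩ := hspan' n hn hs
        exact ⟨x, z, y, e, by rw [h]; abel⟩) (by rw [h0, h1, h2] at hc'; simpa using hc')
    · exact IsUnimodular.of_two_mul_eq ho (hVJ 1) (hVJ 2) (hVJ 0) (fun n hn hs => by
        obtain ⟨x, y, z, e, h⟩ := hspan' n hn hs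
        exact ⟨y, z, x, e, by rw [h]; abel⟩) (by rw [h0, h1, h2] at hc'; simpa using hc')
  · exfalso
    have := cnn n0 c0 (by norm_num)
    have := cnn n1 c1 (by norm_num)
    have := cnn n2 c2 (by norm_num)
    have := clt l0 c0 (by norm_num)
    have := clt l1 c1 (by norm_num)
    have := clt l2 c2 (by norm_num)
    omega
  · right
    have k0 := cnn n0 c0 (by norm_num)
    have k1 := cnn n1 c1 (by norm_num)
    have k2 := cnn n2 c2 (by norm_num)
    have k0' := clt l0 c0 (by norm_num)
    have k1' := clt l1 c1 (by norm_num)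
    have k2' := clt l2 c2 (by norm_num)
    have hle : ∀ i, c i ≤ 1 := by
      intro i
      by_contra h2
      have hci : c i = 2 := by fin_cases i <;> simp at h2 ⊢ <;> omega
      -- Otherwise `2 o - V i` is a further junior element of the triangle.
      have hD3 : 3 * ν i = 2 * D := by have := hcν i; rw [hci] at this; linarith
      have hqeq : D • ((2 : ℤ) • o - V i) =
          ∑ j, (2 * ν j - if j = i then D else 0) • V j := by
        simp only [sub_smul, mul_smul, Finset.sum_sub_distrib, ite_smul, zero_smul,
          Finset.sum_ite_eq', Finset.mem_univ, if_true, smul_sub]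
        rw [← Finset.smul_sum, ← hν, smul_comm]
      have hμ : ∀ j, 0 ≤ (2 * ν j - if j = i then D else 0) ∧
          (2 * ν j - if j = i then D else 0) < D := by
        intro j
        by_cases hj : j = i
        · rw [if_pos hj, hj]; omega
        · rw [if_neg hj]
          fin_cases i <;> fin_cases j <;> simp at hj hD3 ⊢ <;> omega
      refine hmin _ ⟨IsJunior.of_nonneg (L.sub_mem h2o (hVJ i).1) hdet (fun x => ?_) ?_, ?_⟩ _
        hμ hqeq
      · have := congrFun hqeq x
        simp only [Pi.smul_apply, Finset.sum_apply, smul_eq_mul] at this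
        rw [this]
        exact Finset.sum_nonneg fun j _ => mul_nonneg (hμ j).1 ((hVJ j).2.1 x)
      · simp only [Pi.sub_apply, Pi.smul_apply, smul_eq_mul]
        linarith [ho.2.2, (hVJ i).2.2]
      · intro h
        apply (hV i).2
        rw [two_smul, add_sub_assoc, add_eq_left, sub_eq_zero] at h
        exact h.symm
    have i0 := hle 0
    have i1 := hle 1
    have i2 := hle 2
    rw [show c 0 = 1 by omega, show c 1 = 1 by omega, show c 2 = 1 by omega] at hc'
    rw [show (2 : ℤ) - -1 = 3 by norm_num, one_smul, one_smul, one_smul] at hc'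
    have h3 : (3 : ℤ) • o - V 0 - V 1 = V 2 := by rw [hc']; abel
    refine ⟨V 0, V 1, ⟨ho, hVJ 0, hVJ 1, fun n hn hs => ?_⟩, by rw [h3]; exact hVJ 2⟩
    obtain ⟨x, y, z, e, rfl⟩ := hspan' n hn hs
    exact ⟨3 * z + e, x - z, y - z, by rw [← h3]; module⟩

end

section

/-! ### Canonical lattices and White's theorem for unimodular triangles -/

/-- The lattice `r⁻¹ L ⊇ ℤ³` has no nonzero element of the octant of age less than one, and `u` is
an element of least positive age, which is `1 / m`. -/
structure IsCanonicalLattice (L : AddSubgroup (Fin 3 → ℤ)) (r : ℤ) (m : ℕ) (u : Fin 3 → ℤ) :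
    Prop where
  pos : 0 < r
  smul_mem : ∀ z : Fin 3 → ℤ, r • z ∈ L
  le_sum : ∀ y ∈ L, (∀ i, 0 ≤ y i) → y ≠ 0 → r ≤ y 0 + y 1 + y 2
  mem : u ∈ L
  sum_eq : m * (u 0 + u 1 + u 2) = r
  exists_dvd : ∀ n ∈ L, ∃ j : ℤ, r ∣ n 0 + n 1 + n 2 - j * (u 0 + u 1 + u 2)

variable {L : AddSubgroup (Fin 3 → ℤ)} {r : ℤ} {m : ℕ} {u a b c : Fin 3 → ℤ}

lemma IsCanonicalLattice.coord_sum (H : IsCanonicalLattice L r m u) (h : IsUnimodular L r a b c)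
    {α β γ : ℤ} (hu : (m : ℤ) • u = α • a + β • b + γ • c) : α + β + γ = 1 := by
  have e : ∀ i, (m : ℤ) * u i = α * a i + β * b i + γ * c i := fun i => by
    simpa using congrFun hu i
  have : r * (α + β + γ) = r * 1 := by
    linear_combination H.sum_eq - e 0 - e 1 - e 2 - α * h.fst.2.2 - β * h.snd.2.2 - γ * h.thd.2.2
  exact mul_left_cancel₀ H.pos.ne' this

lemma IsCanonicalLattice.exists_coord (H : IsCanonicalLattice L r m u)
    (h : IsUnimodular L r a b c) : ∃ α β γ : ℤ, (m : ℤ) • u = α • a + β • b + γ • c :=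
  h.exists_eq _ (L.zsmul_mem H.mem _) ⟨1, by
    simp only [Pi.smul_apply, smul_eq_mul]; linarith [H.sum_eq]⟩

/-- The multiples of `u`, reduced modulo the vertices of a unimodular triangle, have the least age
possible. -/
lemma IsCanonicalLattice.sum_mod (H : IsCanonicalLattice L r m u) (h : IsUnimodular L r a b c)
    {v : Fin 3 → ℤ} (hv : v ∈ L) {A B C : ℕ} (hu : (m : ℤ) • v = (A : ℤ) • a + (B : ℤ) • b + (C : ℤ) • c)
    (hABC : (A + B + C) % m = 1 % m) {j : ℕ} (hj : 0 < j) (hjm : j < m) :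
    m + j ≤ j * A % m + j * B % m + j * C % m := by
  have hm : 0 < m := by omega
  have e : ∀ i, (m : ℤ) * v i = A * a i + B * b i + C * c i := fun i => by
    simpa using congrFun hu i
  set n : Fin 3 → ℤ := (j : ℤ) • v - (((j * A / m : ℕ) : ℤ) • a + ((j * B / m : ℕ) : ℤ) • b +
    ((j * C / m : ℕ) : ℤ) • c) with hn
  have hnL : n ∈ L := L.sub_mem (L.zsmul_mem hv _) (comb_mem h.fst.1 h.snd.1 h.thd.1 _ _ _)
  have hz : ∀ A : ℕ, ((j * A : ℕ) : ℤ) = m * ((j * A / m : ℕ) : ℤ) + ((j * A % m : ℕ) : ℤ) := by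
    intro A
    exact_mod_cast (Nat.div_add_mod (j * A) m).symm
  have hmn : ∀ i, (m : ℤ) * n i = ((j * A % m : ℕ) : ℤ) * a i + ((j * B % m : ℕ) : ℤ) * b i +
      ((j * C % m : ℕ) : ℤ) * c i := by
    intro i
    have hA := hz A
    have hB := hz B
    have hC := hz C
    push_cast at hA hB hC
    simp only [hn, Pi.sub_apply, Pi.add_apply, Pi.smul_apply, smul_eq_mul]
    push_cast
    linear_combination j * e i + a i * hA + b i * hB + c i * hC
  have hmod : (j * A % m + j * B % m + j * C % m) % m = j := by
    have h1 : j * (A + B + C) ≡ j * 1 [MOD m] := Nat.ModEq.mul_left j hABC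
    rw [mul_one, Nat.mul_add, Nat.mul_add] at h1
    have h2 : j * A % m + j * B % m + j * C % m ≡ j * A + j * B + j * C [MOD m] :=
      ((Nat.mod_modEq _ _).add (Nat.mod_modEq _ _)).add (Nat.mod_modEq _ _)
    have h3 : (j * A % m + j * B % m + j * C % m) % m = j % m := h2.trans h1
    rw [h3, Nat.mod_eq_of_lt hjm]
  have hsum : (m : ℤ) * (n 0 + n 1 + n 2) =
      r * ((j * A % m + j * B % m + j * C % m : ℕ) : ℤ) := by
    rw [Nat.cast_add, Nat.cast_add]
    linear_combination hmn 0 + hmn 1 + hmn 2 + ((j * A % m : ℕ) : ℤ) * h.fst.2.2 +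
      ((j * B % m : ℕ) : ℤ) * h.snd.2.2 + ((j * C % m : ℕ) : ℤ) * h.thd.2.2
  have hle : m ≤ j * A % m + j * B % m + j * C % m := by
    have hn0 : n ≠ 0 := by
      intro h0
      rw [h0] at hsum
      simp only [Pi.zero_apply, add_zero, mul_zero] at hsum
      have h1 := (mul_eq_zero.1 hsum.symm).resolve_left H.pos.ne'
      rw [Nat.cast_eq_zero.1 h1] at hmod
      simp at hmod
      omega
    have h1 := H.le_sum n hnL (fun i => nonneg_of_mul_nonneg_right (a := (m : ℤ)) (by
      rw [hmn i]
      have h0 := mul_nonneg (Int.natCast_nonneg (j * A % m)) (h.fst.2.1 i)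
      have h1 := mul_nonneg (Int.natCast_nonneg (j * B % m)) (h.snd.2.1 i)
      have h2 := mul_nonneg (Int.natCast_nonneg (j * C % m)) (h.thd.2.1 i)
      linarith) (by exact_mod_cast hm)) hn0
    have h2 : r * (m : ℤ) ≤ r * ((j * A % m + j * B % m + j * C % m : ℕ) : ℤ) := by
      rw [← hsum, mul_comm]
      exact mul_le_mul_of_nonneg_left h1 (by positivity)
    exact_mod_cast le_of_mul_le_mul_left h2 H.pos
  have h3 := Nat.div_add_mod (j * A % m + j * B % m + j * C % m) m
  rw [hmod] at h3
  have h4 : 1 ≤ (j * A % m + j * B % m + j * C % m) / m := by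
    rwa [Nat.le_div_iff_mul_le hm, one_mul]
  have h5 := Nat.mul_le_mul_left m h4
  omega

/-- White's theorem for the tetrahedron that is spanned by a unimodular triangle and the
origin. -/
theorem IsCanonicalLattice.eq_one (H : IsCanonicalLattice L r m u) (hm : 1 < m)
    (h : IsUnimodular L r a b c) {α β γ : ℤ} (hu : (m : ℤ) • u = α • a + β • b + γ • c) :
    ((α : ZMod m) = 1 ∨ (β : ZMod m) = 1 ∨ (γ : ZMod m) = 1) ∧
      IsUnit (α : ZMod m) ∧ IsUnit (β : ZMod m) ∧ IsUnit (γ : ZMod m) := by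
  have hm0 : (0 : ℤ) < m := by exact_mod_cast (by omega : 0 < m)
  have key : ∀ α : ℤ, ∃ A : ℕ, A < m ∧ α = m * (α / m) + A := fun α => by
    refine ⟨(α % m).toNat, ?_, ?_⟩
    · have := Int.emod_lt_of_pos α hm0
      omega
    · rw [Int.toNat_of_nonneg (Int.emod_nonneg _ hm0.ne')]
      exact (Int.mul_ediv_add_emod α m).symm
  obtain ⟨A, hA, hα⟩ := key α
  obtain ⟨B, hB, hβ⟩ := key β
  obtain ⟨C, hC, hγ⟩ := key γ
  have hcast : ∀ {α : ℤ} {A : ℕ}, α = m * (α / m) + A → (α : ZMod m) = (A : ZMod m) := by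
    intro α A h
    rw [h]
    simp
  rw [hcast hα, hcast hβ, hcast hγ]
  have hsum1 := H.coord_sum h hu
  have hABC : (A + B + C) % m = 1 % m := by
    apply (ZMod.natCast_eq_natCast_iff' _ _ _).1
    have := congrArg (Int.cast : ℤ → ZMod m) hsum1
    push_cast at this ⊢
    rwa [hcast hα, hcast hβ, hcast hγ] at this
  set v := u - ((α / m) • a + (β / m) • b + (γ / m) • c) with hv
  have hvL : v ∈ L := L.sub_mem H.mem (comb_mem h.fst.1 h.snd.1 h.thd.1 _ _ _)
  have hmv : (m : ℤ) • v = (A : ℤ) • a + (B : ℤ) • b + (C : ℤ) • c := by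
    rw [hv, smul_sub, hu]
    ext i
    simp only [Pi.sub_apply, Pi.add_apply, Pi.smul_apply, smul_eq_mul]
    linear_combination a i * hα + b i * hβ + c i * hγ
  have hS := fun j h0 hj => H.sum_mod h hvL hmv hABC (j := j) h0 hj
  -- The residues of `j * X` and of `(m - j) * X` add up to at most `m`.
  have hcompl : ∀ j X : ℕ, 0 < j → j < m → j * X % m + (m - j) * X % m ≤ m ∧
      (m ∣ j * X → j * X % m + (m - j) * X % m = 0) := by
    intro j X h0 hj
    have h1 : m ∣ j * X % m + (m - j) * X % m := by
      have : (j * X % m + (m - j) * X % m) % m = (j * X + (m - j) * X) % m := by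
        rw [← Nat.add_mod]
      rw [Nat.dvd_iff_mod_eq_zero, this, ← Nat.add_mul, Nat.add_sub_cancel' hj.le,
        Nat.mul_mod_right]
    have h2 := Nat.mod_lt (j * X) (by omega : m > 0)
    have h3 := Nat.mod_lt ((m - j) * X) (by omega : m > 0)
    obtain ⟨t, ht⟩ := h1
    have ht2 : t < 2 := lt_of_mul_lt_mul_left (by omega : m * t < m * 2) (Nat.zero_le m)
    refine ⟨by rw [ht]; nlinarith, fun h => ?_⟩
    rw [Nat.mod_eq_zero_of_dvd h] at ht ⊢
    have : t < 1 := lt_of_mul_lt_mul_left (by omega : m * t < m * 1) (Nat.zero_le m)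
    rw [ht, Nat.lt_one_iff.1 this, mul_zero]
  -- The bounds of `sum_mod` for `j` and for `m - j` add up to the greatest possible amount, so that
  -- they are equalities and no residue vanishes.
  have hnd : ∀ j, 0 < j → j < m → ¬ m ∣ j * A ∧ ¬ m ∣ j * B ∧ ¬ m ∣ j * C ∧
      j * A % m + j * B % m + j * C % m = m + j := by
    intro j h0 hj
    have h1 := hS j h0 hj
    have h2 := hS (m - j) (by omega) (by omega)
    obtain ⟨a1, a2⟩ := hcompl j A h0 hj
    obtain ⟨b1, b2⟩ := hcompl j B h0 hj
    obtain ⟨c1, c2⟩ := hcompl j C h0 hj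
    refine ⟨fun h => ?_, fun h => ?_, fun h => ?_, by omega⟩
    · have := a2 h; omega
    · have := b2 h; omega
    · have := c2 h; omega
  have hunit : ∀ X : ℕ, (∀ j, 0 < j → j < m → ¬ m ∣ j * X) → IsUnit (X : ZMod m) := by
    intro X hX
    rw [ZMod.isUnit_iff_coprime, Nat.coprime_iff_gcd_eq_one]
    by_contra hg
    have hg0 : 0 < X.gcd m := Nat.gcd_pos_of_pos_right _ (by omega)
    obtain ⟨t, ht⟩ := Nat.gcd_dvd_right X m
    obtain ⟨s, hs⟩ := Nat.gcd_dvd_left X m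
    have ht0 : 0 < t := Nat.pos_of_ne_zero fun h => by rw [h, mul_zero] at ht; omega
    refine hX t ht0 ?_ ⟨s, ?_⟩
    · conv_rhs => rw [ht]
      nlinarith [show 2 ≤ X.gcd m by omega]
    · conv_rhs => rw [ht]
      conv_lhs => rw [hs]
      ring
  refine ⟨?_, hunit A fun j h0 hj => (hnd j h0 hj).1, hunit B fun j h0 hj => (hnd j h0 hj).2.1,
    hunit C fun j h0 hj => (hnd j h0 hj).2.2.1⟩
  rcases exists_eq_one_of_sum_mod hm hA hB hC (fun j h0 hj => (hnd j h0 hj).1)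
    (fun j h0 hj => (hnd j h0 hj).2.1) (fun j h0 hj => (hnd j h0 hj).2.2.1)
    (fun j h0 hj => (hnd j h0 hj).2.2.2) with h | h | h
  · simp [h]
  · simp [h]
  · simp [h]

lemma IsUnimodular.coord_sum (hr : 0 < r) (h : IsUnimodular L r a b c) {x y z : ℤ}
    (hq : IsJunior L r (x • a + y • b + z • c)) : x + y + z = 1 := by
  have e := hq.2.2
  simp only [Pi.add_apply, Pi.smul_apply, smul_eq_mul] at e
  have : r * (x + y + z) = r * 1 := by
    linear_combination e - x * h.fst.2.2 - y * h.snd.2.2 - z * h.thd.2.2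
  exact mul_left_cancel₀ hr.ne' this

/-- Coordinates in a unimodular triangle are unique. -/
lemma IsUnimodular.coord_unique (H : IsCanonicalLattice L r m u) (h : IsUnimodular L r a b c)
    {x y z x' y' z' : ℤ} (e : x • a + y • b + z • c = x' • a + y' • b + z' • c) :
    x = x' ∧ y = y' ∧ z = z' := by
  obtain ⟨f, hf⟩ := h.exists_dual H.pos H.smul_mem
  have hz : z = z' := by
    have := hf x y z
    rw [e, hf] at this
    exact (mul_left_cancel₀ H.pos.ne' this).symm
  obtain ⟨g, hg⟩ := h.rotate.rotate.exists_dual H.pos H.smul_mem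
  have hy : y = y' := by
    have h1 := hg z x y
    have h2 := hg z' x' y'
    rw [show z • c + x • a + y • b = x • a + y • b + z • c by abel, e] at h1
    rw [show z' • c + x' • a + y' • b = x' • a + y' • b + z' • c by abel, h1] at h2
    exact mul_left_cancel₀ H.pos.ne' h2
  subst hz hy
  refine ⟨?_, rfl, rfl⟩
  have h1 : x • a = x' • a := by simpa using e
  have : (x - x') • a = 0 := by rw [sub_smul, h1, sub_self]
  exact sub_eq_zero.1 ((smul_eq_zero.1 this).resolve_right (h.fst.ne_zero H.pos))

/-- Convexity of the set of junior elements, in the form that the elements of `L` in the convex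
hull of junior elements are junior. -/
lemma IsJunior.of_convex {p₁ p₂ p₃ p₄ q : Fin 3 → ℤ} (h₁ : IsJunior L r p₁) (h₂ : IsJunior L r p₂)
    (h₃ : IsJunior L r p₃) (h₄ : IsJunior L r p₄) (hq : q ∈ L) {K x y z t : ℤ} (hK : 0 < K)
    (hx : 0 ≤ x) (hy : 0 ≤ y) (hz : 0 ≤ z) (ht : 0 ≤ t) (hs : x + y + z + t = K)
    (he : K • q = x • p₁ + y • p₂ + z • p₃ + t • p₄) : IsJunior L r q := by
  have e : ∀ i, K * q i = x * p₁ i + y * p₂ i + z * p₃ i + t * p₄ i := fun i => by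
    simpa using congrFun he i
  refine .of_nonneg hq hK (fun i => ?_) ?_
  · rw [e i]
    have h1 := mul_nonneg hx (h₁.2.1 i)
    have h2 := mul_nonneg hy (h₂.2.1 i)
    have h3 := mul_nonneg hz (h₃.2.1 i)
    have h4 := mul_nonneg ht (h₄.2.1 i)
    linarith
  · have : K * (q 0 + q 1 + q 2) = K * r := by
      linear_combination e 0 + e 1 + e 2 + x * h₁.2.2 + y * h₂.2.2 + z * h₃.2.2 + t * h₄.2.2 +
        r * hs
    exact mul_left_cancel₀ hK.ne' this

end

section

/-! ### Level one points: at least three classes of ages -/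

/-- The dual lattice of `r⁻¹ L` contains a point of the octant on which `w / r` takes the
value one. -/
def HasLevelOnePoint (L : AddSubgroup (Fin 3 → ℤ)) (r : ℤ) (w : Fin 3 → ℤ) : Prop :=
  ∃ x : Fin 3 → ℤ, (∀ i, 0 ≤ x i) ∧ (∀ n ∈ L, r ∣ x ⬝ᵥ n) ∧ x ⬝ᵥ w = r

/-- The irreducible elements of the monoid of elements of `L` in the octant, apart from the
multiples of the unit vectors by `r`. -/
structure IsIrreducibleElement (L : AddSubgroup (Fin 3 → ℤ)) (r : ℤ) (w : Fin 3 → ℤ) : Prop where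
  mem : w ∈ L
  nonneg : ∀ i, 0 ≤ w i
  ne_zero : w ≠ 0
  eq_of_le : ∀ y ∈ L, (∀ i, 0 ≤ y i) → (∀ i, y i ≤ w i) → y ≠ 0 → w = y
  ne_single : ∀ i, w ≠ r • (Pi.single i 1 : Fin 3 → ℤ)

variable {L : AddSubgroup (Fin 3 → ℤ)} {r : ℤ} {m : ℕ} {u a b c w : Fin 3 → ℤ}

lemma sum_eq_of_ne {i j l : Fin 3} (hij : i ≠ j) (hil : i ≠ l) (hjl : j ≠ l) (v : Fin 3 → ℤ) :
    v 0 + v 1 + v 2 = v i + v j + v l := by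
  fin_cases i <;> fin_cases j <;> fin_cases l <;> simp at hij hil hjl ⊢ <;> ring

lemma dotProduct_eq_of_ne {i j l : Fin 3} (hij : i ≠ j) (hil : i ≠ l) (hjl : j ≠ l)
    (f v : Fin 3 → ℤ) : f ⬝ᵥ v = f i * v i + f j * v j + f l * v l := by
  rw [dotProduct, Fin.sum_univ_three]
  exact sum_eq_of_ne hij hil hjl fun i => f i * v i

lemma exists_third {i j : Fin 3} (hij : i ≠ j) : ∃ l, i ≠ l ∧ j ≠ l := by
  revert i j
  decide

lemma eq_or_eq_of_ne {i j l : Fin 3} (hij : i ≠ j) (hil : i ≠ l) (hjl : j ≠ l) (t : Fin 3) :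
    t = i ∨ t = j ∨ t = l := by
  revert i j l t
  decide

lemma dotProduct_smul_single (f : Fin 3 → ℤ) (i : Fin 3) :
    f ⬝ᵥ (r • (Pi.single i 1 : Fin 3 → ℤ)) = r * f i := by
  rw [dotProduct_smul, dotProduct_single, mul_one, smul_eq_mul]

lemma IsIrreducibleElement.lt (H : IsCanonicalLattice L r m u) (hw : IsIrreducibleElement L r w)
    (i : Fin 3) : w i < r := by
  by_contra h
  refine hw.ne_single i (hw.eq_of_le _ (H.smul_mem _)
    (isJunior_single H.pos H.smul_mem i).2.1 (fun j => ?_)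
    ((isJunior_single H.pos H.smul_mem i).ne_zero H.pos))
  by_cases hj : j = i
  · subst hj; simpa using not_lt.1 h
  · simpa [hj] using hw.nonneg j

lemma IsIrreducibleElement.le_sum (H : IsCanonicalLattice L r m u)
    (hw : IsIrreducibleElement L r w) : r ≤ w 0 + w 1 + w 2 :=
  H.le_sum w hw.mem hw.nonneg hw.ne_zero

/-- Integrality on `L` can be checked on a unimodular triangle and on `u`. -/
lemma IsCanonicalLattice.dvd_dotProduct (H : IsCanonicalLattice L r m u)
    (h : IsUnimodular L r a b c) {α β γ : ℤ} (hu : (m : ℤ) • u = α • a + β • b + γ • c)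
    {x : Fin 3 → ℤ} {p q s : ℤ} (ha : x ⬝ᵥ a = r * p) (hb : x ⬝ᵥ b = r * q) (hc : x ⬝ᵥ c = r * s)
    (hm : (m : ℤ) ∣ p * α + q * β + s * γ) : ∀ n ∈ L, r ∣ x ⬝ᵥ n := by
  intro n hn
  have hm0 : (m : ℤ) ≠ 0 := by
    intro h0
    have := H.sum_eq
    rw [h0, zero_mul] at this
    exact H.pos.ne this
  have hxu : r ∣ x ⬝ᵥ u := by
    obtain ⟨t, ht⟩ := hm
    refine ⟨t, mul_left_cancel₀ hm0 ?_⟩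
    have := congrArg (x ⬝ᵥ ·) hu
    simp only [dotProduct_add, dotProduct_smul, smul_eq_mul, ha, hb, hc] at this
    rw [this]
    linear_combination r * ht
  obtain ⟨j, hj⟩ := H.exists_dvd n hn
  obtain ⟨x', y', z', e⟩ := h.exists_eq (n - j • u) (L.sub_mem hn (L.zsmul_mem H.mem j)) (by
    convert hj using 1
    simp only [Pi.sub_apply, Pi.smul_apply, smul_eq_mul]
    ring)
  have h1 : n = x' • a + y' • b + z' • c + j • u := by rw [← e]; abel
  rw [h1]
  simp only [dotProduct_add, dotProduct_smul, smul_eq_mul, ha, hb, hc]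
  exact dvd_add ⟨x' * p + y' * q + z' * s, by ring⟩ (hxu.mul_left j)

/-- An irreducible element of integral age is a vertex of the unimodular triangle whose cone
contains it. -/
lemma IsIrreducibleElement.isJunior (H : IsCanonicalLattice L r m u)
    (hw : IsIrreducibleElement L r w) (hs : r ∣ w 0 + w 1 + w 2) : IsJunior L r w := by
  obtain ⟨a, b, c, h, t, x₀, x₁, x₂, ht, h0, h1, h2, e⟩ :=
    exists_unimodular H.pos H.smul_mem hw.nonneg
  obtain ⟨x, y, z, rfl⟩ := h.exists_eq w hw.mem hs
  have e' : (t * x) • a + (t * y) • b + (t * z) • c = x₀ • a + x₁ • b + x₂ • c := by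
    rw [← e]; module
  obtain ⟨rfl, rfl, rfl⟩ := h.coord_unique H e'
  have hx := nonneg_of_mul_nonneg_right h0 ht
  have hy := nonneg_of_mul_nonneg_right h1 ht
  have hz := nonneg_of_mul_nonneg_right h2 ht
  have hax := fun i => mul_nonneg hx (h.fst.2.1 i)
  have hby := fun i => mul_nonneg hy (h.snd.2.1 i)
  have hcz := fun i => mul_nonneg hz (h.thd.2.1 i)
  have key : ∀ v, IsJunior L r v → (∀ i, v i ≤ (x • a + y • b + z • c) i) →
      IsJunior L r (x • a + y • b + z • c) := fun v hv hle => by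
    rw [hw.eq_of_le v hv.1 hv.2.1 hle (hv.ne_zero H.pos)]
    exact hv
  rcases hx.eq_or_lt with hx | hx
  · rcases hy.eq_or_lt with hy | hy
    · rcases hz.eq_or_lt with hz | hz
      · exact absurd (by rw [← hx, ← hy, ← hz]; simp) hw.ne_zero
      · refine key c h.thd fun i => ?_
        have := mul_le_mul_of_nonneg_right (show 1 ≤ z from hz) (h.thd.2.1 i)
        simp only [Pi.add_apply, Pi.smul_apply, smul_eq_mul]
        linarith [hax i, hby i]
    · refine key b h.snd fun i => ?_
      have := mul_le_mul_of_nonneg_right (show 1 ≤ y from hy) (h.snd.2.1 i)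
      simp only [Pi.add_apply, Pi.smul_apply, smul_eq_mul]
      linarith [hax i, hcz i]
  · refine key a h.fst fun i => ?_
    have := mul_le_mul_of_nonneg_right (show 1 ≤ x from hx) (h.fst.2.1 i)
    simp only [Pi.add_apply, Pi.smul_apply, smul_eq_mul]
    linarith [hby i, hcz i]

lemma hasLevelOnePoint_of_sum_eq_one (H : IsCanonicalLattice L r 1 u)
    (hw : IsIrreducibleElement L r w) : HasLevelOnePoint L r w := by
  have hall : ∀ n ∈ L, r ∣ n 0 + n 1 + n 2 := by
    intro n hn
    obtain ⟨j, hj⟩ := H.exists_dvd n hn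
    have := H.sum_eq
    rw [Nat.cast_one, one_mul] at this
    rw [this] at hj
    have := dvd_add hj (dvd_mul_left r j)
    rwa [sub_add_cancel] at this
  refine ⟨fun _ => 1, fun _ => zero_le_one, fun n hn => ?_, ?_⟩
  · simpa [dotProduct, Fin.sum_univ_three] using hall n hn
  · simpa [dotProduct, Fin.sum_univ_three] using (hw.isJunior H (hall w hw.mem)).2.2

/-- If the sum of two of the coordinates lies in the dual lattice, then it takes the value one. -/
lemma hasLevelOnePoint_of_dvd_add (H : IsCanonicalLattice L r m u)
    (hw : IsIrreducibleElement L r w) {i j : Fin 3} (hij : i ≠ j)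
    (hdvd : ∀ n ∈ L, r ∣ n i + n j) : HasLevelOnePoint L r w := by
  obtain ⟨l, hil, hjl⟩ := exists_third hij
  have hdot : ∀ n : Fin 3 → ℤ,
      (Pi.single i 1 + Pi.single j 1 : Fin 3 → ℤ) ⬝ᵥ n = n i + n j := fun n => by
    rw [add_dotProduct, single_dotProduct, single_dotProduct, one_mul, one_mul]
  refine ⟨Pi.single i 1 + Pi.single j 1, fun l => ?_, fun n hn => ?_, ?_⟩
  · simp only [Pi.add_apply, Pi.single_apply]
    split_ifs <;> norm_num
  · rw [hdot]; exact hdvd n hn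
  · rw [hdot]
    obtain ⟨t, ht⟩ := hdvd w hw.mem
    have hi := hw.lt H i
    have hj := hw.lt H j
    have hl := hw.lt H l
    have hi0 := hw.nonneg i
    have hj0 := hw.nonneg j
    have hsum := hw.le_sum H
    rw [sum_eq_of_ne hij hil hjl] at hsum
    have h0 : 0 ≤ t := nonneg_of_mul_nonneg_right (by omega : 0 ≤ r * t) H.pos
    have h2 : t < 2 := lt_of_mul_lt_mul_left (by omega : r * t < r * 2) H.pos.le
    rcases (show t = 0 ∨ t = 1 by omega) with rfl | rfl
    · omega
    · rw [ht, mul_one]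

/-- If the coefficient of `u` at `c` is `1` modulo `m`, then the sum of the coordinates minus the
coefficient function `f` of `c` lies in the dual lattice. If `f` is one of the coordinates, then
this is the sum of the other two. -/
lemma hasLevelOnePoint_of_coord_eq_one (H : IsCanonicalLattice L r m u)
    (hw : IsIrreducibleElement L r w) (h : IsUnimodular L r a b c) {α β γ : ℤ}
    (hu : (m : ℤ) • u = α • a + β • b + γ • c) (hγ : (γ : ZMod m) = 1) {f : Fin 3 → ℤ}
    (hf : ∀ x y z : ℤ, f ⬝ᵥ (x • a + y • b + z • c) = r * z) {i j l : Fin 3} (hij : i ≠ j)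
    (hil : i ≠ l) (hjl : j ≠ l) (hi : f i = 0) (hj : f j = 0) (hl : f l = 1) :
    HasLevelOnePoint L r w := by
  refine hasLevelOnePoint_of_dvd_add H hw hij fun n hn => ?_
  have h1 : ∀ v : Fin 3 → ℤ, ((fun _ => 1) - f) ⬝ᵥ v = v 0 + v 1 + v 2 - f ⬝ᵥ v := fun v => by
    rw [sub_dotProduct]
    simp [dotProduct, Fin.sum_univ_three]
  have ha := hf 1 0 0
  have hb := hf 0 1 0
  have hc := hf 0 0 1
  simp only [one_smul, zero_smul, add_zero, zero_add, mul_zero, mul_one] at ha hb hc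
  have h2 := H.dvd_dotProduct h hu (x := (fun _ => 1) - f) (p := 1) (q := 1) (s := 0)
    (by rw [h1, ha, h.fst.2.2]; ring) (by rw [h1, hb, h.snd.2.2]; ring)
    (by rw [h1, hc, h.thd.2.2]; ring) (by
      rw [← ZMod.intCast_zmod_eq_zero_iff_dvd]
      have := congrArg (Int.cast : ℤ → ZMod m) (H.coord_sum h hu)
      push_cast at this ⊢
      linear_combination this - hγ) n hn
  rw [h1, sum_eq_of_ne hij hil hjl, dotProduct_eq_of_ne hij hil hjl, hi, hj, hl] at h2
  convert h2 using 1
  ring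

lemma two_ne_zero_of_lt (hm : 2 < m) : (2 : ZMod m) ≠ 0 := by
  intro h
  have : ((2 : ℕ) : ZMod m) = 0 := by exact_mod_cast h
  rw [ZMod.natCast_eq_zero_iff] at this
  exact absurd (Nat.le_of_dvd two_pos this) (by omega)

/-- If `a` is the midpoint of two junior elements, then the opposite coordinate of `u` in a
unimodular triangle on one of the halves of the segment is `1`. -/
lemma IsCanonicalLattice.coord_eq_one (H : IsCanonicalLattice L r m u) (hm : 2 < m)
    (h : IsUnimodular L r a b c) (hab : IsJunior L r ((2 : ℤ) • a - b)) {α β γ : ℤ}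
    (hu : (m : ℤ) • u = α • a + β • b + γ • c) : (γ : ZMod m) = 1 := by
  have h' : IsUnimodular L r a ((2 : ℤ) • a - b) c := ⟨h.fst, hab, h.thd, fun n hn hs => by
    obtain ⟨x, y, z, rfl⟩ := h.exists_eq n hn hs
    exact ⟨x + 2 * y, -y, z, by module⟩⟩
  have hu' : (m : ℤ) • u = (α + 2 * β) • a + (-β) • ((2 : ℤ) • a - b) + γ • c := by
    rw [hu]; module
  have hs := congrArg (Int.cast : ℤ → ZMod m) (H.coord_sum h hu)
  obtain ⟨h1, hα, hβ, hγ⟩ := H.eq_one (by omega) h hu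
  obtain ⟨h2, -⟩ := H.eq_one (by omega) h' hu'
  push_cast at hs h2
  have h20 := two_ne_zero_of_lt hm
  rcases h2 with h2 | h2 | h2
  · rcases h1 with h1 | h1 | h1
    · refine absurd (hβ.mul_left_eq_zero.1 (?_ : (2 : ZMod m) * β = 0)) h20
      linear_combination h2 - h1
    · linear_combination hs - h2 + h1
    · exact h1
  · rcases h1 with h1 | h1 | h1
    · linear_combination hs - h1 + h2
    · exact absurd (by linear_combination -h1 - h2 : (2 : ZMod m) = 0) h20
    · exact h1
  · exact h2

/-- If `a` is the midpoint of `b` and another junior element and `q` is at height `k` times that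
of `c`, then the elements of `L` on the line at the height of `c`, not too far from the segment from
`a` to `q`, are junior. -/
lemma IsUnimodular.isJunior_row (hr : 0 < r) (h : IsUnimodular L r a b c)
    (hab : IsJunior L r ((2 : ℤ) • a - b)) {x y k ε : ℤ} (hk : 0 < k)
    (hq : IsJunior L r (x • a + y • b + (k * ε) • c)) {t : ℤ} (h1 : -(k - 1) ≤ k * t - y)
    (h2 : k * t - y ≤ k - 1) : IsJunior L r ((1 - t - ε) • a + t • b + ε • c) := by
  have hx : x = 1 - y - k * ε := by linarith [h.coord_sum hr hq]
  subst hx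
  refine IsJunior.of_convex hq h.snd hab h.fst (comb_mem h.fst.1 h.snd.1 h.thd.1 _ _ _)
    (K := 2 * k) (x := 2) (y := k - 1 + (k * t - y)) (z := k - 1 - (k * t - y)) (t := 0)
    (by omega) (by omega) (by omega) (by omega) le_rfl (by ring) ?_
  module

/-- If `a` is the midpoint of two junior elements, then all junior elements are on the same side of
the line through them. -/
lemma IsCanonicalLattice.coord_nonneg (H : IsCanonicalLattice L r m u) (hm : 2 < m)
    (h : IsUnimodular L r a b c) (hab : IsJunior L r ((2 : ℤ) • a - b)) {x y z : ℤ}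
    (hq : IsJunior L r (x • a + y • b + z • c)) : 0 ≤ z := by
  by_contra hz
  push Not at hz
  have h1 := Int.mul_ediv_add_emod y (-z)
  have h2 := Int.emod_nonneg y (neg_ne_zero.2 hz.ne)
  have h3 := Int.emod_lt_of_pos y (neg_pos.2 hz)
  set t := y / (-z)
  have hq' := h.isJunior_row H.pos hab (x := x) (y := y) (k := -z) (ε := -1) (by omega)
    (by simpa using hq) (t := t) (by omega) (by omega)
  obtain ⟨α, β, γ, hu⟩ := H.exists_coord h
  have h' : IsUnimodular L r a b ((1 - t - -1) • a + t • b + (-1 : ℤ) • c) :=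
    ⟨h.fst, h.snd, hq', fun n hn hs => by
      obtain ⟨x, y, z, rfl⟩ := h.exists_eq n hn hs
      exact ⟨x + z * (2 - t), y + z * t, -z, by module⟩⟩
  -- The coefficients of `u` at `c` and at the junior element on the other side are opposite, but both
  -- are `1`.
  have e1 := H.coord_eq_one hm h hab hu
  have e2 := H.coord_eq_one hm h' hab (α := α + γ * (2 - t)) (β := β + γ * t) (γ := -γ)
    (by rw [hu]; module)
  push_cast at e2
  exact two_ne_zero_of_lt hm (by linear_combination -e1 - e2)

lemma exists_two_pos (ha : IsJunior L r a) (hne : ∀ i, a ≠ r • (Pi.single i 1 : Fin 3 → ℤ)) :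
    ∃ i j l : Fin 3, i ≠ j ∧ i ≠ l ∧ j ≠ l ∧ 0 < a i ∧ 0 < a j := by
  have hs := ha.2.2
  have h0 := ha.2.1 0
  have h1 := ha.2.1 1
  have h2 := ha.2.1 2
  have key : ∀ {i j l : Fin 3}, i ≠ j → i ≠ l → j ≠ l → ¬ (a i = 0 ∧ a j = 0) := by
    rintro i j l hij hil hjl ⟨hi, hj⟩
    rw [sum_eq_of_ne hij hil hjl, hi, hj] at hs
    refine hne l (funext fun t => ?_)
    rcases eq_or_eq_of_ne hij hil hjl t with rfl | rfl | rfl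
    · simp [hi, hil]
    · simp [hj, hjl]
    · simp; omega
  have k01 := key (show (0 : Fin 3) ≠ 1 by decide) (show (0 : Fin 3) ≠ 2 by decide) (by decide)
  have k02 := key (show (0 : Fin 3) ≠ 2 by decide) (show (0 : Fin 3) ≠ 1 by decide) (by decide)
  have k12 := key (show (1 : Fin 3) ≠ 2 by decide) (show (1 : Fin 3) ≠ 0 by decide) (by decide)
  by_cases h : a 0 = 0
  · exact ⟨1, 2, 0, by decide, by decide, by decide, by omega, by omega⟩
  · by_cases h' : a 1 = 0
    · exact ⟨0, 2, 1, by decide, by decide, by decide, by omega, by omega⟩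
    · exact ⟨0, 1, 2, by decide, by decide, by decide, by omega, by omega⟩

/-- The case where some junior element is the midpoint of two others. -/
lemma hasLevelOnePoint_of_midpoint (H : IsCanonicalLattice L r m u) (hm : 2 < m)
    (hw : IsIrreducibleElement L r w) (h : IsUnimodular L r a b c)
    (hab : IsJunior L r ((2 : ℤ) • a - b)) (hne : ∀ i, a ≠ r • (Pi.single i 1 : Fin 3 → ℤ)) :
    HasLevelOnePoint L r w := by
  obtain ⟨f, hf⟩ := h.exists_dual H.pos H.smul_mem
  obtain ⟨α, β, γ, hu⟩ := H.exists_coord h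
  have hγ := H.coord_eq_one hm h hab hu
  have he : ∀ i, ∃ x y : ℤ, r • (Pi.single i 1 : Fin 3 → ℤ) = x • a + y • b + f i • c := by
    intro i
    obtain ⟨x, y, z, e⟩ := h.exists_eq _ (H.smul_mem (Pi.single i 1))
      ⟨1, by rw [(isJunior_single H.pos H.smul_mem i).2.2, mul_one]⟩
    have := hf x y z
    rw [← e, dotProduct_smul_single] at this
    exact ⟨x, y, by rw [e, mul_left_cancel₀ H.pos.ne' this]⟩
  have hf0 : ∀ i, 0 ≤ f i := by
    intro i
    obtain ⟨x, y, e⟩ := he i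
    exact H.coord_nonneg hm h hab (e ▸ isJunior_single H.pos H.smul_mem i)
  obtain ⟨i, j, l, hij, hil, hjl, hi, hj⟩ := exists_two_pos h.fst hne
  have hfa := hf 1 0 0
  have hfc := hf 0 0 1
  simp only [one_smul, zero_smul, add_zero, zero_add, mul_zero, mul_one] at hfa hfc
  rw [dotProduct_eq_of_ne hij hil hjl] at hfa hfc
  have p1 := mul_nonneg (hf0 i) hi.le
  have p2 := mul_nonneg (hf0 j) hj.le
  have p3 := mul_nonneg (hf0 l) (h.fst.2.1 l)
  have hfi : f i = 0 := (mul_eq_zero.1 (by linarith : f i * a i = 0)).resolve_right hi.ne'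
  have hfj : f j = 0 := (mul_eq_zero.1 (by linarith : f j * a j = 0)).resolve_right hj.ne'
  rw [hfi, hfj, zero_mul, zero_mul, zero_add, zero_add] at hfc
  have hr := H.pos
  have hfl : f l ≠ 0 := fun h0 => by rw [h0, zero_mul] at hfc; omega
  have hfl0 := hf0 l
  -- As `a` has two positive coordinates, `f` is a multiple of the third coordinate.
  rcases (show f l = 1 ∨ 2 ≤ f l by omega) with hl | hl
  · exact hasLevelOnePoint_of_coord_eq_one H hw h hu hγ hf hij hil hjl hfi hfj hl
  exfalso
  obtain ⟨x, y, e⟩ := he l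
  have hE := isJunior_single H.pos H.smul_mem l
  rw [e] at hE
  set k := f l with hk
  have hx : x = 1 - y - k := by linarith [h.coord_sum H.pos hE]
  subst hx
  have h1 := Int.mul_ediv_add_emod y k
  have h2 := Int.emod_nonneg y hfl
  have h3 := Int.emod_lt_of_pos y (show 0 < k by omega)
  set t := y / k with ht
  have hq := fun s => h.isJunior_row H.pos hab (x := 1 - y - k) (y := y) (k := k) (ε := 1)
    (by omega) (by rw [mul_one]; exact hE) (t := s)
  have hqt := hq t (by omega) (by omega)
  by_cases hdvd : y % k = 0
  · -- The vertex is on a line through `a` and another junior element.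
    rw [hdvd, add_zero] at h1
    have hq2 : IsJunior L r ((2 : ℤ) • ((1 - t - 1) • a + t • b + (1 : ℤ) • c) - a) := by
      refine IsJunior.of_convex hE h.fst h.fst h.fst
        (L.sub_mem (L.zsmul_mem hqt.1 2) h.fst.1) (K := k) (x := 2) (y := k - 2) (z := 0) (t := 0)
        (by omega) (by omega) (by omega) le_rfl le_rfl (by ring) ?_
      rw [← h1]
      module
    have h' : IsUnimodular L r ((1 - t - 1) • a + t • b + (1 : ℤ) • c) a b :=
      ⟨hqt, h.fst, h.snd, fun n hn hs => by
        obtain ⟨x, y, z, rfl⟩ := h.exists_eq n hn hs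
        exact ⟨z, x + z * t, y - z * t, by module⟩⟩
    have := H.coord_nonneg hm h' hq2 (x := 0) (y := 2) (z := -1) (by
      convert hab using 1; module)
    omega
  · -- Two neighbouring points in the first row form a unimodular triangle with `a`.
    have hqt' := hq (t + 1) (by rw [mul_add]; omega) (by rw [mul_add]; omega)
    have h' : IsUnimodular L r a ((1 - t - 1) • a + t • b + (1 : ℤ) • c)
        ((1 - (t + 1) - 1) • a + (t + 1) • b + (1 : ℤ) • c) :=
      ⟨h.fst, hqt, hqt', fun n hn hs => by
        obtain ⟨x, y, z, rfl⟩ := h.exists_eq n hn hs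
        exact ⟨x + y, z - y + z * t, y - z * t, by module⟩⟩
    obtain ⟨-, h0, -⟩ := H.eq_one (by omega) h' (α := α + β) (β := γ - β + γ * t)
      (γ := β - γ * t) (by rw [hu]; module)
    have hs := congrArg (Int.cast : ℤ → ZMod m) (H.coord_sum h hu)
    push_cast at hs h0
    have : Fact (1 < m) := ⟨by omega⟩
    refine h0.ne_zero ?_
    linear_combination hs - hγ

end

section

/-! ### Level one points: the centroid case -/

variable {L : AddSubgroup (Fin 3 → ℤ)} {r : ℤ} {m : ℕ} {u a b c w : Fin 3 → ℤ}

lemma smul_single_injective (hr : r ≠ 0) {i j : Fin 3}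
    (h : r • (Pi.single i 1 : Fin 3 → ℤ) = r • (Pi.single j 1 : Fin 3 → ℤ)) : i = j := by
  by_contra hij
  have := congrFun h i
  simp [hij] at this
  exact hr this

/-- The case where the vertices of the octant are the only junior elements. -/
lemma hasLevelOnePoint_of_forall_single (H : IsCanonicalLattice L r m u) (hm : 1 < m)
    (hw : IsIrreducibleElement L r w)
    (hF : ∀ q, IsJunior L r q → ∃ i, q = r • (Pi.single i 1 : Fin 3 → ℤ)) :
    HasLevelOnePoint L r w := by
  obtain ⟨a, b, c, h, -⟩ := exists_unimodular H.pos H.smul_mem (y := 0) fun _ => le_rfl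
  have key : ∀ {a b c : Fin 3 → ℤ} {α β γ : ℤ}, IsUnimodular L r a b c →
      (m : ℤ) • u = α • a + β • b + γ • c → (γ : ZMod m) = 1 → HasLevelOnePoint L r w := by
    intro a b c α β γ h hu hγ
    obtain ⟨f, hf⟩ := h.exists_dual H.pos H.smul_mem
    obtain ⟨i, hi⟩ := hF a h.fst
    obtain ⟨j, hj⟩ := hF b h.snd
    obtain ⟨l, hl⟩ := hF c h.thd
    have ha := hf 1 0 0
    have hb := hf 0 1 0
    have hc := hf 0 0 1
    simp only [one_smul, zero_smul, add_zero, zero_add, mul_zero, mul_one] at ha hb hc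
    rw [hi, dotProduct_smul_single] at ha
    rw [hj, dotProduct_smul_single] at hb
    rw [hl, dotProduct_smul_single] at hc
    have hfi := (mul_eq_zero.1 ha).resolve_left H.pos.ne'
    have hfj := (mul_eq_zero.1 hb).resolve_left H.pos.ne'
    have hfl : f l = 1 := mul_left_cancel₀ H.pos.ne' (by rw [hc, mul_one])
    refine hasLevelOnePoint_of_coord_eq_one H hw h hu hγ hf (i := i) (j := j) (l := l) ?_ ?_ ?_
      hfi hfj hfl
    · rintro rfl
      have := (h.coord_unique H (x := 1) (y := 0) (z := 0) (x' := 0) (y' := 1) (z' := 0)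
        (by simp [hi, hj])).1
      omega
    · rintro rfl; omega
    · rintro rfl; omega
  obtain ⟨α, β, γ, hu⟩ := H.exists_coord h
  rcases (H.eq_one hm h hu).1 with h1 | h1 | h1
  · exact key h.rotate (by rw [hu]; abel) h1
  · exact key h.rotate.rotate (by rw [hu]; abel) h1
  · exact key h hu h1

lemma IsUnimodular.centroid (h : IsUnimodular L r a b c)
    (habc : IsJunior L r ((3 : ℤ) • a - b - c)) :
    IsUnimodular L r a c ((3 : ℤ) • a - b - c) :=
  ⟨h.fst, h.thd, habc, fun n hn hs => by
    obtain ⟨x, y, z, rfl⟩ := h.exists_eq n hn hs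
    exact ⟨x + 3 * y, z - y, -y, by module⟩⟩

lemma IsCanonicalLattice.not_isJunior_of_centroid (H : IsCanonicalLattice L r m u) (hm : 2 < m)
    (h : IsUnimodular L r a b c) (habc : IsJunior L r ((3 : ℤ) • a - b - c)) :
    ¬ IsJunior L r ((2 : ℤ) • a - b) ∧ ¬ IsJunior L r ((2 : ℤ) • b - a) := by
  refine ⟨fun h2 => ?_, fun h2 => ?_⟩
  · have := H.coord_nonneg hm h h2 (x := 3) (y := -1) (z := -1) (by convert habc using 1; module)
    omega
  · have := H.coord_nonneg hm h.swap h2 (x := -1) (y := 3) (z := -1)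
      (by convert habc using 1; module)
    omega

/-- The only junior elements in the angle at `a` spanned by `b` and `c` are the vertices, if the
reflections of `a` in `b` and in `c`, and that in their midpoint, are not junior. -/
lemma IsUnimodular.eq_of_angle (hr : 0 < r) (h : IsUnimodular L r a b c)
    (hb : ¬ IsJunior L r ((2 : ℤ) • b - a)) (hc : ¬ IsJunior L r ((2 : ℤ) • c - a))
    (hbc : ¬ IsJunior L r (b + c - a)) {x y z : ℤ} (hy : 0 ≤ y) (hz : 0 ≤ z)
    (hq : IsJunior L r (x • a + y • b + z • c)) : (y = 0 ∧ z = 0) ∨ (y = 1 ∧ z = 0) ∨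
      (y = 0 ∧ z = 1) := by
  have hx : x = 1 - y - z := by linarith [h.coord_sum hr hq]
  subst hx
  by_contra hne
  rcases hz.eq_or_lt with rfl | hz
  · refine hb (IsJunior.of_convex hq h.fst h.fst h.fst (L.sub_mem (L.zsmul_mem h.snd.1 2) h.fst.1)
      (K := y) (x := 2) (y := y - 2) (z := 0) (t := 0)
      (by omega) (by omega) (by omega) le_rfl le_rfl (by ring) (by module))
  rcases hy.eq_or_lt with rfl | hy
  · refine hc (IsJunior.of_convex hq h.fst h.fst h.fst (L.sub_mem (L.zsmul_mem h.thd.1 2) h.fst.1)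
      (K := z) (x := 2) (y := z - 2) (z := 0) (t := 0)
      (by omega) (by omega) (by omega) le_rfl le_rfl (by ring) (by module))
  have hmem := L.sub_mem (L.add_mem h.snd.1 h.thd.1) h.fst.1
  rcases le_total z y with hzy | hyz
  · exact hbc (IsJunior.of_convex hq h.thd h.fst h.fst hmem (K := y) (x := 1) (y := y - z)
      (z := z - 1) (t := 0) (by omega) (by omega) (by omega) (by omega) le_rfl (by ring)
      (by module))
  · exact hbc (IsJunior.of_convex hq h.snd h.fst h.fst hmem (K := z) (x := 1) (y := z - y)
      (z := y - 1) (t := 0) (by omega) (by omega) (by omega) (by omega) le_rfl (by ring)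
      (by module))

/-- The lattice of the group of type `1/9 (1, 4, 7)`: the monomials `xᵢ² xₗ`, `xᵢ xⱼ²` and `xⱼ xₗ²`
are invariant, and if none of them takes the value one on `w`, then `w` dominates the centroid. -/
lemma hasLevelOnePoint_of_nine (H : IsCanonicalLattice L r m u)
    (hw : IsIrreducibleElement L r w) {i j l : Fin 3} (hij : i ≠ j) (hil : i ≠ l) (hjl : j ≠ l)
    (ha : a ∈ L) (hal : ∀ t, 3 * a t = r)
    (hM : ∀ x : Fin 3 → ℤ, x i + x j + x l = 3 → (3 : ℤ) ∣ 1 + (x i - x j) →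
      ∀ n ∈ L, r ∣ x ⬝ᵥ n) : HasLevelOnePoint L r w := by
  have hr := H.pos
  have hi := hw.lt H i
  have hj := hw.lt H j
  have hl := hw.lt H l
  have hi0 := hw.nonneg i
  have hj0 := hw.nonneg j
  have hl0 := hw.nonneg l
  have hsum := hw.le_sum H
  rw [sum_eq_of_ne hij hil hjl] at hsum
  have key : ∀ x y z : ℤ, 0 ≤ x → 0 ≤ y → 0 ≤ z → x + y + z = 3 → (3 : ℤ) ∣ 1 + (x - y) →
      HasLevelOnePoint L r w ∨ x * w i + y * w j + z * w l = 0 ∨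
        x * w i + y * w j + z * w l = 2 * r := by
    intro x y z hx hy hz hs h3
    obtain ⟨X, hXi, hXj, hXl⟩ : ∃ X : Fin 3 → ℤ, X i = x ∧ X j = y ∧ X l = z :=
      ⟨fun t => if t = i then x else if t = j then y else z, by simp, by simp [hij.symm],
        by simp [hil.symm, hjl.symm]⟩
    have hX := hM X (by rw [hXi, hXj, hXl, hs]) (by rwa [hXi, hXj])
    obtain ⟨t, ht⟩ := hX w hw.mem
    have hdot := dotProduct_eq_of_ne hij hil hjl X w
    rw [hXi, hXj, hXl] at hdot
    rw [hdot] at ht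
    have h0 : 0 ≤ t := nonneg_of_mul_nonneg_right (by rw [← ht]; positivity : 0 ≤ r * t) hr
    have h3 : t < 3 := lt_of_mul_lt_mul_left (by rw [← ht]; nlinarith : r * t < r * 3) hr.le
    rcases (show t = 0 ∨ t = 1 ∨ t = 2 by omega) with rfl | rfl | rfl
    · exact Or.inr (Or.inl (by rw [ht, mul_zero]))
    · refine Or.inl ⟨X, fun t => ?_, hX, by rw [hdot, ht, mul_one]⟩
      rcases eq_or_eq_of_ne hij hil hjl t with rfl | rfl | rfl <;> omega
    · exact Or.inr (Or.inr (by rw [ht, mul_comm]))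
  rcases key 2 0 1 (by norm_num) le_rfl (by norm_num) (by norm_num) (by norm_num) with h1 | h1
  · exact h1
  rcases key 1 2 0 (by norm_num) (by norm_num) le_rfl (by norm_num) (by norm_num) with h2 | h2
  · exact h2
  rcases key 0 1 2 le_rfl (by norm_num) (by norm_num) (by norm_num) (by norm_num) with h3 | h3
  · exact h3
  exfalso
  have hai := hal i
  have haj := hal j
  have hall := hal l
  have hwa : w = a := hw.eq_of_le a ha (fun t => by have := hal t; omega) (fun t => by
    rcases eq_or_eq_of_ne hij hil hjl t with rfl | rfl | rfl <;> omega) (fun h0 => by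
      have := hal i
      rw [h0] at this
      simp at this
      omega)
  rw [hwa] at hsum h1 h2 h3
  omega

/-- If a junior element is the centroid of a unimodular fan of three triangles, then there are no
further junior elements. -/
lemma IsCanonicalLattice.eq_of_centroid (H : IsCanonicalLattice L r m u) (hm : 2 < m)
    (h : IsUnimodular L r a b c) (habc : IsJunior L r ((3 : ℤ) • a - b - c)) (q : Fin 3 → ℤ)
    (hq : IsJunior L r q) : q = a ∨ q = b ∨ q = c ∨ q = (3 : ℤ) • a - b - c := by
  have hr := H.pos
  set d := (3 : ℤ) • a - b - c with hd
  have h' : IsUnimodular L r a c d := h.centroid habc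
  have e1 : (3 : ℤ) • a - c - d = b := by rw [hd]; module
  have h'' : IsUnimodular L r a d b := by
    have := h'.centroid (by rw [e1]; exact h.snd)
    rwa [e1] at this
  have e2 : (3 : ℤ) • a - d - b = c := by rw [hd]; module
  obtain ⟨n1, n1'⟩ := H.not_isJunior_of_centroid hm h habc
  obtain ⟨n2, n2'⟩ := H.not_isJunior_of_centroid hm h' (by rw [e1]; exact h.snd)
  obtain ⟨n3, n3'⟩ := H.not_isJunior_of_centroid hm h'' (by rw [e2]; exact h.thd)
  obtain ⟨x, y, z, rfl⟩ := h.exists_eq q hq.1 ⟨1, by rw [hq.2.2, mul_one]⟩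
  have hx : x = 1 - y - z := by linarith [h.coord_sum hr hq]
  subst hx
  have k1 : ¬ IsJunior L r (b + c - a) := by
    convert n3 using 2; rw [hd]; module
  have k2 : ¬ IsJunior L r (c + d - a) := by
    convert n1 using 2; rw [hd]; module
  have k3 : ¬ IsJunior L r (d + b - a) := by
    convert n2 using 2; rw [hd]; module
  by_cases hyz : 0 ≤ y ∧ 0 ≤ z
  · rcases h.eq_of_angle hr n1' n2' k1 hyz.1 hyz.2 hq with ⟨rfl, rfl⟩ | ⟨rfl, rfl⟩ | ⟨rfl, rfl⟩
    · left; module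
    · right; left; module
    · right; right; left; module
  · by_cases hyz' : y ≤ 0 ∧ y ≤ z
    · have e : (1 - y - z) • a + y • b + z • c =
          (1 - (z - y) - (-y)) • a + (z - y) • c + (-y) • d := by rw [hd]; module
      rw [e] at hq ⊢
      rcases h'.eq_of_angle hr n2' n3' k2 (by omega) (by omega) hq with
        ⟨h1, h2⟩ | ⟨h1, h2⟩ | ⟨h1, h2⟩
      · rw [h1, h2]; left; module
      · rw [h1, h2]; right; right; left; module
      · rw [h1, h2]; right; right; right; module
    · have e : (1 - y - z) • a + y • b + z • c =
          (1 - (-z) - (y - z)) • a + (-z) • d + (y - z) • b := by rw [hd]; module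
      rw [e] at hq ⊢
      rcases h''.eq_of_angle hr n3' n1' k3 (by omega) (by omega) hq with
        ⟨h1, h2⟩ | ⟨h1, h2⟩ | ⟨h1, h2⟩
      · rw [h1, h2]; left; module
      · rw [h1, h2]; right; right; right; module
      · rw [h1, h2]; right; left; module

lemma three_eq_zero_of_eq_one {R : Type*} [CommRing R] {A B C : R} (h2 : (2 : R) ≠ 0)
    (hB : IsUnit B) (hC : IsUnit C) (hs : A + B + C = 1) (w₁ : A = 1 ∨ B = 1 ∨ C = 1)
    (w₂ : A + 3 * B = 1 ∨ C - B = 1 ∨ -B = 1) (w₃ : A + 3 * C = 1 ∨ -C = 1 ∨ B - C = 1) :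
    (3 : R) = 0 := by
  obtain ⟨B', hB'⟩ := hB.exists_right_inv
  obtain ⟨C', hC'⟩ := hC.exists_right_inv
  by_contra h3
  rcases w₁ with w₁ | w₁ | w₁ <;> rcases w₂ with w₂ | w₂ | w₂ <;> rcases w₃ with w₃ | w₃ | w₃ <;>
    grind

lemma residues_of_isUnit : ∀ {A B C : ZMod 3}, B ≠ 0 → C ≠ 0 → C - B ≠ 0 → A + B + C = 1 →
    (B = 1 ∧ C = -1 ∧ A = 1) ∨ (B = -1 ∧ C = 1 ∧ A = 1) := by
  decide

/-- The case where some junior element is the centroid of a triangle of junior elements. -/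
lemma hasLevelOnePoint_of_centroid (H : IsCanonicalLattice L r m u) (hm : 2 < m)
    (hw : IsIrreducibleElement L r w) (h : IsUnimodular L r a b c)
    (habc : IsJunior L r ((3 : ℤ) • a - b - c)) (hne : ∀ i, a ≠ r • (Pi.single i 1 : Fin 3 → ℤ)) :
    HasLevelOnePoint L r w := by
  have hr := H.pos
  set d := (3 : ℤ) • a - b - c with hd
  have h' : IsUnimodular L r a c d := h.centroid habc
  have e1 : (3 : ℤ) • a - c - d = b := by rw [hd]; module
  have h'' : IsUnimodular L r a d b := by
    have := h'.centroid (by rw [e1]; exact h.snd)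
    rwa [e1] at this
  obtain ⟨α, β, γ, hu⟩ := H.exists_coord h
  -- White's theorem for the three triangles leaves only one possibility for `u`.
  obtain ⟨w1, -, hβ, hγ⟩ := H.eq_one (by omega) h hu
  obtain ⟨w2, -, hβγ, -⟩ := H.eq_one (by omega) h' (α := α + 3 * β) (β := γ - β) (γ := -β)
    (by rw [hu, hd]; module)
  obtain ⟨w3, -⟩ := H.eq_one (by omega) h'' (α := α + 3 * γ) (β := -γ) (γ := β - γ)
    (by rw [hu, hd]; module)
  have hs := congrArg (Int.cast : ℤ → ZMod m) (H.coord_sum h hu)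
  have h20 := two_ne_zero_of_lt hm
  have h3 : (3 : ZMod m) = 0 := by
    push_cast at hs w2 w3
    exact three_eq_zero_of_eq_one h20 hβ hγ hs w1 w2 w3
  obtain rfl : m = 3 := by
    have : ((3 : ℕ) : ZMod m) = 0 := by exact_mod_cast h3
    rw [ZMod.natCast_eq_zero_iff] at this
    exact le_antisymm (Nat.le_of_dvd (by norm_num) this) hm
  have hβγ1 : ((β : ZMod 3) = 1 ∧ (γ : ZMod 3) = -1 ∧ (α : ZMod 3) = 1) ∨
      ((β : ZMod 3) = -1 ∧ (γ : ZMod 3) = 1 ∧ (α : ZMod 3) = 1) := by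
    push_cast at hs hβγ
    exact residues_of_isUnit hβ.ne_zero hγ.ne_zero hβγ.ne_zero hs
  have hF := H.eq_of_centroid hm h habc
  -- Hence `b`, `c` and `d` are the vertices of the octant.
  have hE : ∀ i : Fin 3, ∃ t : Fin 3, r • (Pi.single i 1 : Fin 3 → ℤ) = ![b, c, d] t := by
    intro i
    rcases hF _ (isJunior_single hr H.smul_mem i) with h1 | h1 | h1 | h1
    · exact absurd h1.symm (hne i)
    · exact ⟨0, h1⟩
    · exact ⟨1, h1⟩
    · exact ⟨2, h1⟩
  choose g hg using hE
  have hginj : Function.Injective g := fun i j hij =>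
    smul_single_injective hr.ne' (by rw [hg i, hg j, hij])
  have hgsurj := Finite.surjective_of_injective hginj
  obtain ⟨i, hi⟩ := hgsurj 0
  obtain ⟨j, hj⟩ := hgsurj 1
  obtain ⟨l, hl⟩ := hgsurj 2
  have hij : i ≠ j := by rintro rfl; rw [hi] at hj; exact absurd hj (by decide)
  have hil : i ≠ l := by rintro rfl; rw [hi] at hl; exact absurd hl (by decide)
  have hjl : j ≠ l := by rintro rfl; rw [hj] at hl; exact absurd hl (by decide)
  have hbi : b = r • (Pi.single i 1 : Fin 3 → ℤ) := by rw [hg i, hi]; rfl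
  have hcj : c = r • (Pi.single j 1 : Fin 3 → ℤ) := by rw [hg j, hj]; rfl
  have hdl : d = r • (Pi.single l 1 : Fin 3 → ℤ) := by rw [hg l, hl]; rfl
  have h3a : (3 : ℤ) • a = b + c + d := by rw [hd]; module
  have hal : ∀ t, 3 * a t = r := by
    intro t
    have := congrFun h3a t
    rw [hbi, hcj, hdl] at this
    simp only [Pi.smul_apply, Pi.add_apply, smul_eq_mul] at this
    rw [this]
    rcases eq_or_eq_of_ne hij hil hjl t with rfl | rfl | rfl
    · simp [hij, hil]
    · simp [hij.symm, hjl]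
    · simp [hil.symm, hjl.symm]
  have hdvd : ∀ x : Fin 3 → ℤ, x i + x j + x l = 3 → (1 * α + x i * β + x j * γ : ZMod 3) = 0 →
      ∀ n ∈ L, r ∣ x ⬝ᵥ n := by
    intro x hx h0
    refine H.dvd_dotProduct h hu (p := 1) (q := x i) (s := x j) ?_ ?_ ?_ ?_
    · have : 3 * (x ⬝ᵥ a) = 3 * (r * 1) := by
        rw [dotProduct_eq_of_ne hij hil hjl]
        linear_combination x i * hal i + x j * hal j + x l * hal l + r * hx
      omega
    · rw [hbi, dotProduct_smul_single]
    · rw [hcj, dotProduct_smul_single]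
    · rw [← ZMod.intCast_zmod_eq_zero_iff_dvd]
      exact_mod_cast h0
  rcases hβγ1 with ⟨hb1, hc1, ha1⟩ | ⟨hb1, hc1, ha1⟩
  · refine hasLevelOnePoint_of_nine H hw hij hil hjl h.fst.1 hal fun x hx h3 => hdvd x hx ?_
    rw [hb1, hc1, ha1]
    have := (ZMod.intCast_zmod_eq_zero_iff_dvd _ 3).2 h3
    push_cast at this
    linear_combination this
  · refine hasLevelOnePoint_of_nine H hw hij.symm hjl hil h.fst.1 hal
      fun x hx h3 => hdvd x (by rw [← hx]; ring) ?_
    rw [hb1, hc1, ha1]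
    have := (ZMod.intCast_zmod_eq_zero_iff_dvd _ 3).2 h3
    push_cast at this
    linear_combination this

theorem hasLevelOnePoint_of_two_lt (H : IsCanonicalLattice L r m u) (hm : 2 < m)
    (hw : IsIrreducibleElement L r w) : HasLevelOnePoint L r w := by
  by_cases hF : ∀ q, IsJunior L r q → ∃ i, q = r • (Pi.single i 1 : Fin 3 → ℤ)
  · exact hasLevelOnePoint_of_forall_single H (by omega) hw hF
  push Not at hF
  obtain ⟨a, ha, hne⟩ := hF
  rcases exists_unimodular_of_junior H.pos H.smul_mem ha hne with ⟨b, c, h, h2⟩ | ⟨b, c, h, h3⟩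
  · exact hasLevelOnePoint_of_midpoint H hm hw h h2 hne
  · exact hasLevelOnePoint_of_centroid H hm hw h h3 hne

end

section

/-! ### Level one points: two classes of ages -/

/-- `L` is the lattice of a group of type `1/14 (1, 9, 11)`, and `w` is the element
`1/14 (7, 7, 7)`. -/
def IsFourteen (L : AddSubgroup (Fin 3 → ℤ)) (r : ℤ) (w : Fin 3 → ℤ) : Prop :=
  (∀ t, 2 * w t = r) ∧ ∃ i j l : Fin 3, i ≠ j ∧ i ≠ l ∧ j ≠ l ∧
    ∃ y ∈ L, 14 * y i = r ∧ 14 * y j = 11 * r ∧ 14 * y l = 9 * r ∧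
      ∀ n ∈ L, ∃ (z : Fin 3 → ℤ) (k : ℤ), n = r • z + k • y

variable {L : AddSubgroup (Fin 3 → ℤ)} {r : ℤ} {u a b c w : Fin 3 → ℤ}

lemma emod_two_of_isUnit {x : ℤ} (hx : IsUnit (x : ZMod 2)) : x % 2 = 1 := by
  have h := hx.ne_zero
  rw [Ne, ZMod.intCast_zmod_eq_zero_iff_dvd] at h
  push_cast at h
  omega

lemma IsCanonicalLattice.coord_odd (H : IsCanonicalLattice L r 2 u) (h : IsUnimodular L r a b c)
    {α β γ : ℤ} (hu : ((2 : ℕ) : ℤ) • u = α • a + β • b + γ • c) :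
    α % 2 = 1 ∧ β % 2 = 1 ∧ γ % 2 = 1 := by
  obtain ⟨-, h1, h2, h3⟩ := H.eq_one one_lt_two h hu
  exact ⟨emod_two_of_isUnit h1, emod_two_of_isUnit h2, emod_two_of_isUnit h3⟩

/-- Junior elements cannot be halved, so that their coordinates are not all odd. -/
lemma IsCanonicalLattice.not_isJunior_of_odd (H : IsCanonicalLattice L r 2 u)
    (h : IsUnimodular L r a b c) {x y z : ℤ} (hx : x % 2 = 1) (hy : y % 2 = 1) (hz : z % 2 = 1) :
    ¬ IsJunior L r (x • a + y • b + z • c) := by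
  intro hq
  obtain ⟨α, β, γ, hu⟩ := H.exists_coord h
  obtain ⟨hα, hβ, hγ⟩ := H.coord_odd h hu
  obtain ⟨x', hx'⟩ : ∃ x', x = α + 2 * x' := ⟨(x - α) / 2, by omega⟩
  obtain ⟨y', hy'⟩ : ∃ y', y = β + 2 * y' := ⟨(y - β) / 2, by omega⟩
  obtain ⟨z', hz'⟩ : ∃ z', z = γ + 2 * z' := ⟨(z - γ) / 2, by omega⟩
  set v := u + (x' • a + y' • b + z' • c) with hv
  have hvL : v ∈ L := L.add_mem H.mem (comb_mem h.fst.1 h.snd.1 h.thd.1 _ _ _)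
  have h2 : x • a + y • b + z • c = (2 : ℤ) • v := by
    rw [hv, smul_add, ← Nat.cast_ofNat (R := ℤ) (n := 2), hu, hx', hy', hz']
    push_cast
    module
  rw [h2] at hq
  have hsum := hq.2.2
  have hnn := hq.2.1
  simp only [Pi.smul_apply, smul_eq_mul] at hsum hnn
  have hr := H.pos
  have := H.le_sum v hvL (fun i => by have := hnn i; omega) (fun h0 => by
    rw [h0] at hsum
    simp at hsum
    omega)
  omega

lemma IsCanonicalLattice.two_mul_dvd (H : IsCanonicalLattice L r 2 u) {n : Fin 3 → ℤ}
    (hn : n ∈ L) : r ∣ 2 * (n 0 + n 1 + n 2) := by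
  obtain ⟨j, t, ht⟩ := H.exists_dvd n hn
  have := H.sum_eq
  push_cast at this
  exact ⟨2 * t + j, by linear_combination 2 * ht + j * this⟩

/-- If `a` is the midpoint of two junior elements, then the vertices of the octant cannot be at
height two or more on both sides of the line through them: otherwise either, by convexity, some
element with odd coefficients at height one or minus one would be junior, or the segment from one of
these vertices to the other would pass through `a`. -/
lemma false_of_two_le (H : IsCanonicalLattice L r 2 u) (h : IsUnimodular L r a b c)
    (hab : IsJunior L r ((2 : ℤ) • a - b)) {i j : Fin 3} (hij : i ≠ j) {x y k x' y' k' : ℤ}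
    (hk : 2 ≤ k) (hk' : 2 ≤ k')
    (hi : r • (Pi.single i 1 : Fin 3 → ℤ) = x • a + y • b + k • c)
    (hj : r • (Pi.single j 1 : Fin 3 → ℤ) = x' • a + y' • b + (-k') • c) : False := by
  have hr := H.pos
  have hE := isJunior_single hr H.smul_mem i
  have hE' := isJunior_single hr H.smul_mem j
  rw [hi] at hE
  rw [hj] at hE'
  -- In the row at height `ε` the element with parameter `y / k` is junior, and so is the next one
  -- unless `k` divides `y`. Of two neighbours in this row one has odd coefficients, so that `y` is an
  -- even multiple of `k`.
  have row : ∀ {x y k ε : ℤ}, 2 ≤ k → (ε = 1 ∨ ε = -1) →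
      IsJunior L r (x • a + y • b + (k * ε) • c) → ∃ t, t % 2 = 0 ∧ y = k * t := by
    intro x y k ε hk hε hq
    have h1 := Int.mul_ediv_add_emod y k
    have h2 := Int.emod_nonneg y (show k ≠ 0 by omega)
    have h3 := Int.emod_lt_of_pos y (show 0 < k by omega)
    have hrow := fun t => h.isJunior_row hr hab (x := x) (y := y) (k := k) (ε := ε) (by omega) hq
      (t := t)
    have hodd : ∀ t, t % 2 = 1 → ¬ IsJunior L r ((1 - t - ε) • a + t • b + ε • c) := fun t ht =>
      H.not_isJunior_of_odd h (by omega) ht (by omega)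
    have ht : y / k % 2 = 0 := by
      by_contra ht
      exact hodd (y / k) (by omega) (hrow _ (by omega) (by omega))
    refine ⟨y / k, ht, ?_⟩
    by_contra hne
    exact hodd (y / k + 1) (by omega) (hrow _ (by rw [mul_add]; omega) (by rw [mul_add]; omega))
  obtain ⟨t, ht, rfl⟩ := row hk (Or.inl rfl) (by rwa [mul_one])
  obtain ⟨t', ht', rfl⟩ := row hk' (Or.inr rfl) (by rwa [mul_neg_one])
  have hx : x = 1 - k * t - k := by linarith [h.coord_sum hr hE]
  have hx' : x' = 1 - k' * t' + k' := by linarith [h.coord_sum hr hE']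
  subst hx hx'
  -- The elements at heights `2` and `-2` on the segments from `a` to the two vertices.
  have hR : IsJunior L r ((-1 - 2 * t) • a + (2 * t) • b + (2 : ℤ) • c) :=
    IsJunior.of_convex hE h.fst h.fst h.fst (comb_mem h.fst.1 h.snd.1 h.thd.1 _ _ _) (K := k)
      (x := 2) (y := k - 2) (z := 0) (t := 0) (by omega) (by omega) (by omega) le_rfl le_rfl
      (by ring) (by module)
  have hL : IsJunior L r ((3 - 2 * t') • a + (2 * t') • b + (-2 : ℤ) • c) :=
    IsJunior.of_convex hE' h.fst h.fst h.fst (comb_mem h.fst.1 h.snd.1 h.thd.1 _ _ _) (K := k')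
      (x := 2) (y := k' - 2) (z := 0) (t := 0) (by omega) (by omega) (by omega) le_rfl le_rfl
      (by ring) (by module)
  rcases lt_trichotomy (t + t') 0 with hs | hs | hs
  · refine H.not_isJunior_of_odd h (x := 1 - t) (y := t - 1) (z := 1) (by omega) (by omega) rfl
      (IsJunior.of_convex hR hL h.fst h.fst (comb_mem h.fst.1 h.snd.1 h.thd.1 _ _ _)
        (K := 2 * -(t + t')) (x := -(t + t') + 1) (y := 1) (z := -(t + t') - 2) (t := 0)
        (by omega) (by omega) (by omega) (by omega) le_rfl (by ring) (by module))
  · -- Now `a` lies on an edge of the octant, and hence the whole triangle.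
    obtain rfl : t' = -t := by omega
    obtain ⟨l, hil, hjl⟩ := exists_third hij
    have ei := congrFun hi l
    have ej := congrFun hj l
    simp only [Pi.smul_apply, Pi.add_apply, smul_eq_mul, Pi.single_eq_of_ne hil.symm,
      Pi.single_eq_of_ne hjl.symm, mul_zero] at ei ej
    have ha0 : a l = 0 := by
      have : (k + k') * a l = 0 := by linear_combination -k' * ei - k * ej
      exact (mul_eq_zero.1 this).resolve_left (by omega)
    have hb0 : b l = 0 := by
      have h1 := hab.2.1 l
      have h2 := h.snd.2.1 l
      simp only [Pi.sub_apply, Pi.smul_apply, smul_eq_mul, ha0, mul_zero] at h1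
      omega
    have hc0 : c l = 0 := by
      rw [ha0, hb0, mul_zero, mul_zero, zero_add, zero_add] at ei
      exact (mul_eq_zero.1 ei.symm).resolve_left (by omega)
    obtain ⟨x, y, z, e⟩ := h.exists_eq _ (H.smul_mem (Pi.single l 1))
      ⟨1, by rw [(isJunior_single hr H.smul_mem l).2.2, mul_one]⟩
    have := congrFun e l
    simp [ha0, hb0, hc0] at this
    omega
  · refine H.not_isJunior_of_odd h (x := -1 - t) (y := t + 1) (z := 1) (by omega) (by omega) rfl
      (IsJunior.of_convex hR hL h.fst h.fst (comb_mem h.fst.1 h.snd.1 h.thd.1 _ _ _)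
        (K := 2 * (t + t')) (x := (t + t') + 1) (y := 1) (z := (t + t') - 2) (t := 0)
        (by omega) (by omega) (by omega) (by omega) le_rfl (by ring) (by module))

lemma IsUnimodular.exists_eq_single (H : IsCanonicalLattice L r 2 u) (h : IsUnimodular L r a b c)
    {f : Fin 3 → ℤ} (hf : ∀ x y z : ℤ, f ⬝ᵥ (x • a + y • b + z • c) = r * z) (i : Fin 3) :
    ∃ x y : ℤ, r • (Pi.single i 1 : Fin 3 → ℤ) = x • a + y • b + f i • c := by
  obtain ⟨x, y, z, e⟩ := h.exists_eq _ (H.smul_mem (Pi.single i 1))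
    ⟨1, by rw [(isJunior_single H.pos H.smul_mem i).2.2, mul_one]⟩
  have := hf x y z
  rw [← e, dotProduct_smul_single] at this
  exact ⟨x, y, by rw [e, mul_left_cancel₀ H.pos.ne' this]⟩

lemma one_add_smul_dotProduct (ε : ℤ) (f v : Fin 3 → ℤ) :
    ((fun _ => 1) + ε • f) ⬝ᵥ v = v 0 + v 1 + v 2 + ε * f ⬝ᵥ v := by
  rw [add_dotProduct, smul_dotProduct]
  simp [dotProduct, Fin.sum_univ_three]

lemma hasLevelOnePoint_of_isJunior (H : IsCanonicalLattice L r 2 u)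
    (hw : IsIrreducibleElement L r w) (hs : r ∣ w 0 + w 1 + w 2) : HasLevelOnePoint L r w := by
  have hwJ := hw.isJunior H hs
  rcases exists_unimodular_of_junior H.pos H.smul_mem hwJ hw.ne_single with
    ⟨b, c, h, h2⟩ | ⟨b, c, h, h3⟩
  · obtain ⟨f, hf⟩ := h.exists_dual H.pos H.smul_mem
    obtain ⟨α, β, γ, hu⟩ := H.exists_coord h
    obtain ⟨hα, hβ, hγ⟩ := H.coord_odd h hu
    have hfa := hf 1 0 0
    have hfb := hf 0 1 0
    have hfc := hf 0 0 1
    simp only [one_smul, zero_smul, add_zero, zero_add, mul_zero, mul_one] at hfa hfb hfc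
    have key : ∀ ε : ℤ, (ε = 1 ∨ ε = -1) → (∀ i, 0 ≤ 1 + ε * f i) → HasLevelOnePoint L r w := by
      intro ε hε hnn
      have h1 := H.dvd_dotProduct h hu (x := (fun _ => 1) + ε • f) (p := 1) (q := 1) (s := 1 + ε)
        (by rw [one_add_smul_dotProduct, hfa, hwJ.2.2]; ring)
        (by rw [one_add_smul_dotProduct, hfb, h.snd.2.2]; ring)
        (by rw [one_add_smul_dotProduct, hfc, h.thd.2.2]; ring) (by
          rcases hε with rfl | rfl
          · push_cast; omega
          · push_cast; omega)
      refine ⟨_, fun i => ?_, h1, by rw [one_add_smul_dotProduct, hfa, hwJ.2.2]; ring⟩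
      simpa using hnn i
    by_cases h1 : ∀ i, 0 ≤ 1 + 1 * f i
    · exact key 1 (Or.inl rfl) h1
    by_cases h2' : ∀ i, 0 ≤ 1 + -1 * f i
    · exact key (-1) (Or.inr rfl) h2'
    exfalso
    push Not at h1 h2'
    obtain ⟨j, hj⟩ := h1
    obtain ⟨i, hi⟩ := h2'
    obtain ⟨x, y, e⟩ := h.exists_eq_single H hf i
    obtain ⟨x', y', e'⟩ := h.exists_eq_single H hf j
    exact false_of_two_le H h h2 (i := i) (j := j) (by rintro rfl; omega) (k := f i) (k' := -f j)
      (by omega) (by omega) e (by rw [neg_neg]; exact e')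
  · exfalso
    obtain ⟨α, β, γ, hu⟩ := H.exists_coord h
    obtain ⟨-, hβ, hγ⟩ := H.coord_odd h hu
    obtain ⟨-, h1, -⟩ := H.coord_odd (h.centroid h3) (α := α + 3 * β) (β := γ - β) (γ := -β)
      (by rw [hu]; module)
    omega

/-- An irreducible element that is not of integral age is half the sum of the vertices of a
unimodular triangle. -/
lemma exists_two_smul_eq (H : IsCanonicalLattice L r 2 u)
    (hw : IsIrreducibleElement L r w) (hs : ¬ r ∣ w 0 + w 1 + w 2) :
    ∃ a b c, IsUnimodular L r a b c ∧ (2 : ℤ) • w = a + b + c := by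
  obtain ⟨a, b, c, h, t, x₀, x₁, x₂, ht, h0, h1, h2, e⟩ :=
    exists_unimodular H.pos H.smul_mem hw.nonneg
  refine ⟨a, b, c, h, ?_⟩
  obtain ⟨α, β, γ, hu⟩ := H.exists_coord h
  obtain ⟨hα, hβ, hγ⟩ := H.coord_odd h hu
  obtain ⟨j, hj⟩ := H.exists_dvd w hw.mem
  obtain ⟨p, q, s, hpqs⟩ := h.exists_eq (w - j • u) (L.sub_mem hw.mem (L.zsmul_mem H.mem j)) (by
    convert hj using 1
    simp only [Pi.sub_apply, Pi.smul_apply, smul_eq_mul]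
    ring)
  have hjodd : j % 2 = 1 := by
    by_contra h
    have : r ∣ j * (u 0 + u 1 + u 2) := ⟨j / 2, by
      have h3 : j = 2 * (j / 2) := by omega
      have h4 := H.sum_eq
      push_cast at h4
      linear_combination (u 0 + u 1 + u 2) * h3 + (j / 2) * h4⟩
    exact hs (by simpa using dvd_add hj this)
  have h2w : (2 : ℤ) • w = (j * α + 2 * p) • a + (j * β + 2 * q) • b + (j * γ + 2 * s) • c := by
    have h3 : (2 : ℤ) • w = j • (((2 : ℕ) : ℤ) • u) + (2 : ℤ) • (w - j • u) := by
      push_cast; module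
    rw [h3, hu, hpqs]
    module
  have odd : ∀ {α p : ℤ}, α % 2 = 1 → (j * α + 2 * p) % 2 = 1 := by
    intro α p hα
    rw [Int.add_emod, Int.mul_emod, hα, hjodd]
    simp
  have ox := odd (p := p) hα
  have oy := odd (p := q) hβ
  have oz := odd (p := s) hγ
  set x := j * α + 2 * p
  set y := j * β + 2 * q
  set z := j * γ + 2 * s
  have e' : (t * x) • a + (t * y) • b + (t * z) • c =
      (2 * x₀) • a + (2 * x₁) • b + (2 * x₂) • c := by
    have : t • ((2 : ℤ) • w) = (2 : ℤ) • (t • w) := by module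
    rw [h2w, e] at this
    calc _ = t • (x • a + y • b + z • c) := by module
      _ = _ := by rw [this]; module
  obtain ⟨e0, e1, e2⟩ := h.coord_unique H e'
  have hx : 0 ≤ x := nonneg_of_mul_nonneg_right (by omega : 0 ≤ t * x) ht
  have hy : 0 ≤ y := nonneg_of_mul_nonneg_right (by omega : 0 ≤ t * y) ht
  have hz : 0 ≤ z := nonneg_of_mul_nonneg_right (by omega : 0 ≤ t * z) ht
  have hwi : ∀ i, 2 * w i = x * a i + y * b i + z * c i := fun i => by
    simpa using congrFun h2w i
  have key : ∀ v, IsJunior L r v → ¬ ∀ i, 2 * v i ≤ 2 * w i := by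
    intro v hv hle
    have := hw.eq_of_le v hv.1 hv.2.1 (fun i => by have := hle i; omega) (hv.ne_zero H.pos)
    exact hs ⟨1, by rw [this, hv.2.2, mul_one]⟩
  have hax := fun i => mul_nonneg hx (h.fst.2.1 i)
  have hby := fun i => mul_nonneg hy (h.snd.2.1 i)
  have hcz := fun i => mul_nonneg hz (h.thd.2.1 i)
  have hx1 : x = 1 := by
    by_contra hne
    refine key a h.fst fun i => ?_
    have := mul_le_mul_of_nonneg_right (show 2 ≤ x by omega) (h.fst.2.1 i)
    rw [hwi]
    linarith [hby i, hcz i]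
  have hy1 : y = 1 := by
    by_contra hne
    refine key b h.snd fun i => ?_
    have := mul_le_mul_of_nonneg_right (show 2 ≤ y by omega) (h.snd.2.1 i)
    rw [hwi]
    linarith [hax i, hcz i]
  have hz1 : z = 1 := by
    by_contra hne
    refine key c h.thd fun i => ?_
    have := mul_le_mul_of_nonneg_right (show 2 ≤ z by omega) (h.thd.2.1 i)
    rw [hwi]
    linarith [hax i, hby i]
  rw [h2w, hx1, hy1, hz1, one_smul, one_smul, one_smul]

/-- At most one coefficient of a junior element with respect to a unimodular triangle is positive:
otherwise `a + b - c` would be a convex combination of this element, `a` and `b`. -/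
lemma IsCanonicalLattice.not_pos_pos (H : IsCanonicalLattice L r 2 u)
    (h : IsUnimodular L r a b c) {x y z : ℤ} (hq : IsJunior L r (x • a + y • b + z • c))
    (hx : 1 ≤ x) : y ≤ 0 := by
  by_contra hy
  have hz : z = 1 - x - y := by linarith [h.coord_sum H.pos hq]
  subst hz
  exact H.not_isJunior_of_odd h (x := 1) (y := 1) (z := -1) rfl rfl rfl
    (IsJunior.of_convex hq h.fst h.snd h.fst (comb_mem h.fst.1 h.snd.1 h.thd.1 _ _ _)
      (K := x + y - 1) (x := 1) (y := y - 1) (z := x - 1) (t := 0) (by omega) (by omega)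
      (by omega) (by omega) le_rfl (by ring) (by module))

/-- Two junior elements, one on each side of the line through `a` and `b`, are not both strictly on
the outer side of the line through `a` and `c`: otherwise `a - b + c` would be a convex combination
of them, `a` and `c`. -/
lemma IsCanonicalLattice.not_neg_neg (H : IsCanonicalLattice L r 2 u)
    (h : IsUnimodular L r a b c) {x y z x' y' z' : ℤ}
    (hq : IsJunior L r (x • a + y • b + z • c)) (hq' : IsJunior L r (x' • a + y' • b + z' • c))
    (hz : z ≤ 0) (hz' : 1 ≤ z') (hy : y < 0) : 0 ≤ y' := by
  by_contra hy'
  have hx : x = 1 - y - z := by linarith [h.coord_sum H.pos hq]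
  have hx' : x' = 1 - y' - z' := by linarith [h.coord_sum H.pos hq']
  subst hx hx'
  exact H.not_isJunior_of_odd h (x := 1) (y := -1) (z := 1) rfl rfl rfl
    (IsJunior.of_convex hq h.fst hq' h.thd (comb_mem h.fst.1 h.snd.1 h.thd.1 _ _ _)
      (K := -y * (z' - y' - 1) + y' * z) (x := z' - 1) (y := (z' - 1) * (-y - 1)) (z := -y - z)
      (t := (-y - z) * (-y' - 1))
      (by nlinarith [mul_nonneg_of_nonpos_of_nonpos (show y' ≤ 0 by omega) hz])
      (by omega) (mul_nonneg (by omega) (by omega)) (by omega) (mul_nonneg (by omega) (by omega))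
      (by ring) (by module))

/-- If there are junior elements on the extensions of two consecutive sides of a unimodular triangle,
then the second one is next to the triangle: otherwise `a + b - c` would be a convex combination of
these elements and `a`. -/
lemma IsCanonicalLattice.le_one_of_cyclic (H : IsCanonicalLattice L r 2 u)
    (h : IsUnimodular L r a b c) {β β' : ℤ} (hq : IsJunior L r ((1 + β) • a + (-β) • b))
    (hq' : IsJunior L r ((1 + β') • b + (-β') • c)) (hβ : 1 ≤ β) : β' ≤ 1 := by
  by_contra hβ'
  exact H.not_isJunior_of_odd h (x := 1) (y := 1) (z := -1) rfl rfl rfl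
    (IsJunior.of_convex hq' hq h.fst h.fst (comb_mem h.fst.1 h.snd.1 h.thd.1 _ _ _)
      (K := β * β') (x := β) (y := 1) (z := β * β' - 1 - β) (t := 0) (by nlinarith) (by omega)
      (by omega) (by nlinarith) le_rfl (by ring) (by module))

/-- If the vertices of the octant lie on the extensions of the sides of the triangle, in cyclic
order, then the lattice is that of the group of type `1/14 (1, 9, 11)`. -/
lemma isFourteen_of_cyclic (H : IsCanonicalLattice L r 2 u) (hw : w ∈ L)
    (hs : ¬ r ∣ w 0 + w 1 + w 2) (h : IsUnimodular L r a b c) (h2w : (2 : ℤ) • w = a + b + c)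
    {i j l : Fin 3} (hij : i ≠ j) (hil : i ≠ l) (hjl : j ≠ l) {β₁ β₂ β₃ : ℤ} (h1 : 1 ≤ β₁)
    (h2 : 1 ≤ β₂) (h3 : 1 ≤ β₃)
    (hi : r • (Pi.single i 1 : Fin 3 → ℤ) = (1 + β₁) • a + (-β₁) • b)
    (hj : r • (Pi.single j 1 : Fin 3 → ℤ) = (1 + β₂) • b + (-β₂) • c)
    (hl : r • (Pi.single l 1 : Fin 3 → ℤ) = (1 + β₃) • c + (-β₃) • a) : IsFourteen L r w := by
  have hr := H.pos
  have hJ := fun i => isJunior_single hr H.smul_mem i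
  have Ji := hJ i
  have Jj := hJ j
  have Jl := hJ l
  rw [hi] at Ji
  rw [hj] at Jj
  rw [hl] at Jl
  obtain rfl : β₂ = 1 := le_antisymm (H.le_one_of_cyclic h Ji Jj h1) h2
  obtain rfl : β₃ = 1 := le_antisymm (H.le_one_of_cyclic h.rotate Jj Jl h2) h3
  obtain rfl : β₁ = 1 := le_antisymm (H.le_one_of_cyclic h.rotate.rotate Jl Ji h3) h1
  have ei := fun t => congrFun hi t
  have ej := fun t => congrFun hj t
  have el := fun t => congrFun hl t
  have ew := fun t => congrFun h2w t
  simp only [Pi.smul_apply, Pi.add_apply, smul_eq_mul] at ei ej el ew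
  have hb : b = (2 : ℤ) • a - r • (Pi.single i 1 : Fin 3 → ℤ) := by rw [hi]; module
  have hc : c = (2 : ℤ) • b - r • (Pi.single j 1 : Fin 3 → ℤ) := by rw [hj]; module
  have e := fun t => And.intro (ei t) (And.intro (ej t) (And.intro (el t) (ew t)))
  have i1 := e i
  have j1 := e j
  have l1 := e l
  simp only [Pi.single_eq_same, Pi.single_eq_of_ne hij, Pi.single_eq_of_ne hil,
    Pi.single_eq_of_ne hij.symm, Pi.single_eq_of_ne hil.symm, Pi.single_eq_of_ne hjl,
    Pi.single_eq_of_ne hjl.symm] at i1 j1 l1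
  have hw2 : ∀ t, 2 * w t = r := by
    intro t
    rcases eq_or_eq_of_ne hij hil hjl t with rfl | rfl | rfl <;> omega
  -- In the coordinates `i`, `j`, `l` the vertices `a`, `b` and `c` are `1/7 (4, 2, 1)`, `1/7 (1, 4, 2)`
  -- and `1/7 (2, 1, 4)`, so that `y` is `1/14 (1, 11, 9)`.
  set y := a + w - r • (Pi.single i 1 : Fin 3 → ℤ) with hy
  have hyL : y ∈ L := L.sub_mem (L.add_mem h.fst.1 hw) (H.smul_mem _)
  have ey : ∀ t, y t = a t + w t - r * (Pi.single i 1 : Fin 3 → ℤ) t := fun t => by simp [hy]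
  have yi := ey i
  have yj := ey j
  have yl := ey l
  simp only [Pi.single_eq_same, Pi.single_eq_of_ne hij.symm, Pi.single_eq_of_ne hil.symm] at yi yj yl
  refine ⟨hw2, i, j, l, hij, hil, hjl, y, hyL, by omega, by omega, by omega, ?_⟩
  -- The vertices of the triangle and `w` are generated by `y` modulo the multiples of `r`.
  have hgen : ∀ v : Fin 3 → ℤ, ∀ k x₁ x₂ x₃ : ℤ, v i = r * x₁ + k * y i → v j = r * x₂ + k * y j →
      v l = r * x₃ + k * y l → ∃ (z : Fin 3 → ℤ) (k : ℤ), v = r • z + k • y := by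
    intro v k x₁ x₂ x₃ e1 e2 e3
    refine ⟨fun t => if t = i then x₁ else if t = j then x₂ else x₃, k, funext fun t => ?_⟩
    rcases eq_or_eq_of_ne hij hil hjl t with rfl | rfl | rfl
    · simpa using e1
    · simpa [hij.symm] using e2
    · simpa [hil.symm, hjl.symm] using e3
  obtain ⟨za, ka, ha'⟩ := hgen a 8 0 (-6) (-5) (by omega) (by omega) (by omega)
  obtain ⟨zw, kw, hw'⟩ := hgen w 7 0 (-5) (-4) (by have := hw2 i; omega)
    (by have := hw2 j; omega) (by have := hw2 l; omega)
  have hint : ∀ n ∈ L, r ∣ n 0 + n 1 + n 2 → ∃ (z : Fin 3 → ℤ) (k : ℤ), n = r • z + k • y := by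
    intro n hn hn'
    obtain ⟨p, q, s, rfl⟩ := h.exists_eq n hn hn'
    refine ⟨(p + 2 * q + 4 * s) • za - (q + 2 * s) • Pi.single i 1 - s • Pi.single j 1,
      (p + 2 * q + 4 * s) * ka, ?_⟩
    rw [hc, hb, ha']
    module
  intro n hn
  by_cases hn' : r ∣ n 0 + n 1 + n 2
  · exact hint n hn hn'
  · obtain ⟨z, k, hz⟩ := hint (n - w) (L.sub_mem hn hw) (by
      obtain ⟨p, hp⟩ := H.two_mul_dvd hn
      obtain ⟨q, hq⟩ := H.two_mul_dvd hw
      have hsum := H.sum_eq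
      push_cast at hsum
      have hodd : ∀ {s p : ℤ}, ¬ r ∣ s → 2 * s = r * p → p % 2 = 1 := by
        intro s p hs hp
        by_contra h
        refine hs ⟨p / 2, ?_⟩
        have h3 : p = 2 * (p / 2) := by omega
        have : 2 * s = 2 * (r * (p / 2)) := by linear_combination hp + r * h3
        omega
      have op := hodd hn' hp
      have oq := hodd hs hq
      refine ⟨(p - q) / 2, ?_⟩
      have h3 : p - q = 2 * ((p - q) / 2) := by omega
      simp only [Pi.sub_apply]
      have : 2 * (n 0 - w 0 + (n 1 - w 1) + (n 2 - w 2)) = 2 * (r * ((p - q) / 2)) := by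
        linear_combination hp - hq + r * h3
      omega)
    exact ⟨z + zw, k + kw, by
      rw [sub_eq_iff_eq_add] at hz
      rw [hz]
      nth_rewrite 1 [hw']
      module⟩

lemma hasLevelOnePoint_or_isFourteen_of_not_dvd (H : IsCanonicalLattice L r 2 u)
    (hw : IsIrreducibleElement L r w) (hs : ¬ r ∣ w 0 + w 1 + w 2) :
    HasLevelOnePoint L r w ∨ IsFourteen L r w := by
  have hr := H.pos
  obtain ⟨a, b, c, h, h2w⟩ := exists_two_smul_eq H hw hs
  by_contra hcon
  push Not at hcon
  -- One minus a coordinate takes the value one on `w`, so that it is negative somewhere.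
  have key : ∀ {a b c : Fin 3 → ℤ}, IsUnimodular L r a b c → (2 : ℤ) • w = a + b + c →
      ∀ f : Fin 3 → ℤ, (∀ x y z : ℤ, f ⬝ᵥ (x • a + y • b + z • c) = r * z) → ∃ i, 2 ≤ f i := by
    intro a b c h h2w f hf
    by_contra hlt
    push Not at hlt
    obtain ⟨α, β, γ, hu⟩ := H.exists_coord h
    obtain ⟨hα, hβ, hγ⟩ := H.coord_odd h hu
    have hfa := hf 1 0 0
    have hfb := hf 0 1 0
    have hfc := hf 0 0 1
    simp only [one_smul, zero_smul, add_zero, zero_add, mul_zero, mul_one] at hfa hfb hfc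
    have h1 := H.dvd_dotProduct h hu (x := (fun _ => 1) + (-1 : ℤ) • f) (p := 1) (q := 1) (s := 0)
      (by rw [one_add_smul_dotProduct, hfa, h.fst.2.2]; ring)
      (by rw [one_add_smul_dotProduct, hfb, h.snd.2.2]; ring)
      (by rw [one_add_smul_dotProduct, hfc, h.thd.2.2]; ring) (by push_cast; omega)
    refine hcon.1 ⟨_, fun i => ?_, h1, ?_⟩
    · have := hlt i
      simp
      omega
    · have h3 := congrArg (((fun _ => 1) + (-1 : ℤ) • f) ⬝ᵥ ·) h2w
      simp only [dotProduct_add, dotProduct_smul, smul_eq_mul] at h3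
      rw [one_add_smul_dotProduct _ _ a, one_add_smul_dotProduct _ _ b,
        one_add_smul_dotProduct _ _ c, hfa, hfb, hfc, h.fst.2.2, h.snd.2.2, h.thd.2.2] at h3
      linarith
  obtain ⟨f₃, hf₃⟩ := h.exists_dual hr H.smul_mem
  obtain ⟨f₁, hf₁⟩ := h.rotate.exists_dual hr H.smul_mem
  obtain ⟨f₂, hf₂⟩ := h.rotate.rotate.exists_dual hr H.smul_mem
  obtain ⟨l, hl⟩ := key h h2w f₃ hf₃
  obtain ⟨i, hi⟩ := key h.rotate (by rw [h2w]; abel) f₁ hf₁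
  obtain ⟨j, hj⟩ := key h.rotate.rotate (by rw [h2w]; abel) f₂ hf₂
  have he : ∀ t, r • (Pi.single t 1 : Fin 3 → ℤ) = f₁ t • a + f₂ t • b + f₃ t • c := by
    intro t
    obtain ⟨x, y, e⟩ := h.exists_eq_single H hf₃ t
    have e1 := hf₁ y (f₃ t) x
    have e2 := hf₂ (f₃ t) x y
    rw [show y • b + f₃ t • c + x • a = x • a + y • b + f₃ t • c by abel, ← e,
      dotProduct_smul_single] at e1
    rw [show f₃ t • c + x • a + y • b = x • a + y • b + f₃ t • c by abel, ← e,
      dotProduct_smul_single] at e2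
    rw [e, mul_left_cancel₀ hr.ne' e1, mul_left_cancel₀ hr.ne' e2]
  -- Each of the three coefficients is at least two at a vertex of the octant, and no two of them are
  -- positive at the same vertex.
  have hJ : ∀ t, IsJunior L r (f₁ t • a + f₂ t • b + f₃ t • c) := fun t => by
    rw [← he]; exact isJunior_single hr H.smul_mem t
  have hJ' : ∀ t, IsJunior L r (f₁ t • a + f₃ t • c + f₂ t • b) := fun t => by
    rw [add_right_comm]; exact hJ t
  have hJ'' : ∀ t, IsJunior L r (f₂ t • b + f₁ t • a + f₃ t • c) := fun t => by
    rw [add_comm (f₂ t • b)]; exact hJ t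
  have hJr : ∀ t, IsJunior L r (f₂ t • b + f₃ t • c + f₁ t • a) := fun t => by
    rw [add_comm, ← add_assoc]; exact hJ t
  have hac : IsUnimodular L r a c b := h.rotate.rotate.swap
  have hsum : ∀ t, f₁ t + f₂ t + f₃ t = 1 := fun t => h.coord_sum hr (hJ t)
  have p12 : ∀ t, 1 ≤ f₁ t → f₂ t ≤ 0 := fun t => H.not_pos_pos h (hJ t)
  have p13 : ∀ t, 1 ≤ f₁ t → f₃ t ≤ 0 := fun t => H.not_pos_pos hac (hJ' t)
  have p23 : ∀ t, 1 ≤ f₂ t → f₃ t ≤ 0 := fun t => H.not_pos_pos h.rotate (hJr t)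
  have hij : i ≠ j := by rintro rfl; have := p12 i (by omega); omega
  have hil : i ≠ l := by rintro rfl; have := p13 i (by omega); omega
  have hjl : j ≠ l := by rintro rfl; have := p23 j (by omega); omega
  have si := hsum i
  have sj := hsum j
  have sl := hsum l
  have i2 := p12 i (by omega)
  have i3 := p13 i (by omega)
  have j3 := p23 j (by omega)
  have j1 : f₁ j ≤ 0 := by
    by_contra h1
    have := p12 j (by omega)
    omega
  have l1 : f₁ l ≤ 0 := by
    by_contra h1
    have := p13 l (by omega)
    omega
  have l2 : f₂ l ≤ 0 := by
    by_contra h1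
    have := p23 l (by omega)
    omega
  have c2 : f₂ i < 0 → 0 ≤ f₂ l := H.not_neg_neg h (hJ i) (hJ l) i3 (by omega)
  have c3 : f₃ i < 0 → 0 ≤ f₃ j := H.not_neg_neg hac (hJ' i) (hJ' j) i2 (by omega)
  have c1 : f₁ j < 0 → 0 ≤ f₁ l := H.not_neg_neg h.swap (hJ'' j) (hJ'' l) j3 (by omega)
  -- At each vertex of the octant one coefficient vanishes, in one of the two cyclic orders.
  apply hcon.2
  rcases i2.lt_or_eq with hlt | h0
  · have hl2 : f₂ l = 0 := le_antisymm l2 (c2 hlt)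
    have hj1 : f₁ j = 0 := le_antisymm j1 (by by_contra h1; have := c1 (by omega); omega)
    have hi3 : f₃ i = 0 := le_antisymm i3 (by by_contra h1; have := c3 (by omega); omega)
    refine isFourteen_of_cyclic H hw.mem hs h h2w hij hil hjl (β₁ := -f₂ i) (β₂ := -f₃ j)
      (β₃ := -f₁ l) (by omega) (by omega) (by omega) ?_ ?_ ?_
    · rw [he, hi3, show f₁ i = 1 + -f₂ i by omega]; module
    · rw [he, hj1, show f₂ j = 1 + -f₃ j by omega]; module
    · rw [he, hl2, show f₃ l = 1 + -f₁ l by omega]; module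
  · have hj3 : f₃ j = 0 := le_antisymm j3 (c3 (by omega))
    have hl1 : f₁ l = 0 := le_antisymm l1 (c1 (by omega))
    refine isFourteen_of_cyclic H hw.mem hs hac (by rw [h2w]; abel) hil hij hjl.symm
      (β₁ := -f₃ i) (β₂ := -f₂ l) (β₃ := -f₁ j) (by omega) (by omega) (by omega) ?_ ?_ ?_
    · rw [he, h0, show f₁ i = 1 + -f₃ i by omega]; module
    · rw [he, hl1, show f₃ l = 1 + -f₂ l by omega]; module
    · rw [he, hj3, show f₂ j = 1 + -f₁ j by omega]; module

lemma exists_isCanonicalLattice (hr : 0 < r) (he : ∀ z : Fin 3 → ℤ, r • z ∈ L)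
    (hC : ∀ y ∈ L, (∀ i, 0 ≤ y i) → y ≠ 0 → r ≤ y 0 + y 1 + y 2) :
    ∃ m u, 0 < m ∧ IsCanonicalLattice L r m u := by
  let s : (Fin 3 → ℤ) →+ ℤ :=
    { toFun := fun n => n 0 + n 1 + n 2
      map_zero' := by simp
      map_add' := fun x y => by simp only [Pi.add_apply]; ring }
  have hs : ∀ n, s n = n 0 + n 1 + n 2 := fun _ => rfl
  obtain ⟨g, hg⟩ := Int.subgroup_cyclic (L.map s)
  have hmem : ∀ x, x ∈ L.map s ↔ g ∣ x := by
    intro x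
    rw [hg, AddSubgroup.mem_closure_singleton]
    exact ⟨fun ⟨n, hn⟩ => ⟨n, by rw [← hn, smul_eq_mul, mul_comm]⟩,
      fun ⟨n, hn⟩ => ⟨n, by rw [hn, smul_eq_mul, mul_comm]⟩⟩
  have hgr : g ∣ r := (hmem r).1 ⟨_, he (Pi.single 0 1), by simp [hs]⟩
  obtain ⟨u, huL, hu⟩ := (hmem |g|).2 (self_dvd_abs g)
  have hgr' : |g| ∣ r := (abs_dvd _ _).2 hgr
  have hg0 : 0 < |g| := abs_pos.2 fun h0 => by
    rw [h0, zero_dvd_iff] at hgr; omega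
  obtain ⟨m, hm⟩ := hgr'
  have hm0 : 0 < m := pos_of_mul_pos_right (by rw [← hm]; exact hr : 0 < |g| * m) hg0.le
  refine ⟨m.toNat, u, by omega, hr, he, hC, huL, ?_, fun n hn => ?_⟩
  · rw [← hs, hu, Int.toNat_of_nonneg hm0.le, hm, mul_comm]
  · obtain ⟨j, hj⟩ := (abs_dvd g _).2 ((hmem (s n)).1 ⟨n, hn, rfl⟩)
    refine ⟨j, 0, ?_⟩
    rw [← hs, ← hs, hu, hj]
    ring

/-- The combinatorial core: apart from the exceptional lattice, the dual lattice has a level one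
point for every irreducible element. -/
theorem hasLevelOnePoint_or_isFourteen (hr : 0 < r) (he : ∀ z : Fin 3 → ℤ, r • z ∈ L)
    (hC : ∀ y ∈ L, (∀ i, 0 ≤ y i) → y ≠ 0 → r ≤ y 0 + y 1 + y 2)
    (hw : IsIrreducibleElement L r w) : HasLevelOnePoint L r w ∨ IsFourteen L r w := by
  obtain ⟨m, u, hm, H⟩ := exists_isCanonicalLattice hr he hC
  rcases (show m = 1 ∨ m = 2 ∨ 2 < m by omega) with rfl | rfl | hm
  · exact Or.inl (hasLevelOnePoint_of_sum_eq_one H hw)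
  · by_cases hs : r ∣ w 0 + w 1 + w 2
    · exact Or.inl (hasLevelOnePoint_of_isJunior H hw hs)
    · exact hasLevelOnePoint_or_isFourteen_of_not_dvd H hw hs
  · exact Or.inl (hasLevelOnePoint_of_two_lt H hm hw)

end

section

/-! ### Diagonal groups and their lattices -/

open MvPolynomial

variable {k : Type*} [Field k]

/-- `diagGL` as a group homomorphism. -/
def diagHom : (Fin 3 → kˣ) →* Matrix.GeneralLinearGroup (Fin 3) k where
  toFun := diagGL
  map_one' := Units.ext (by simp [diagGL])
  map_mul' s t := Units.ext (by simp [diagGL, Matrix.diagonal_mul_diagonal])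

lemma diagGL_injective : Function.Injective (diagGL : (Fin 3 → kˣ) → _) := by
  intro s t h
  have h1 : Matrix.diagonal (fun i => (s i : k)) = Matrix.diagonal fun i => (t i : k) :=
    congrArg Units.val h
  exact funext fun i => Units.ext (congrFun (Matrix.diagonal_injective h1) i)

lemma diagGL_one_mem (G : Subgroup (Matrix.GeneralLinearGroup (Fin 3) k)) : diagGL 1 ∈ G := by
  have : (diagGL 1 : Matrix.GeneralLinearGroup (Fin 3) k) = 1 := map_one diagHom
  rw [this]
  exact G.one_mem

/-- The exponents of the elements of a diagonal group with respect to a root of unity `ζ`. -/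
def exponents (G : Subgroup (Matrix.GeneralLinearGroup (Fin 3) k)) (ζ : kˣ) :
    AddSubgroup (Fin 3 → ℤ) where
  carrier := {n | diagHom (fun i => ζ ^ n i) ∈ G}
  zero_mem' := by
    change diagHom (fun i => ζ ^ (0 : ℤ)) ∈ G
    simp only [zpow_zero]
    exact diagGL_one_mem G
  add_mem' {a b} ha hb := by
    change diagHom (fun i => ζ ^ (a i + b i)) ∈ G
    have : (fun i => ζ ^ (a i + b i)) = (fun i => ζ ^ a i) * fun i => ζ ^ b i :=
      funext fun i => zpow_add _ _ _
    rw [this, map_mul]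
    exact G.mul_mem ha hb
  neg_mem' {a} ha := by
    change diagHom (fun i => ζ ^ (-a i)) ∈ G
    have : (fun i => ζ ^ (-a i)) = (fun i => ζ ^ a i)⁻¹ := funext fun i => zpow_neg _ _
    rw [this, map_inv]
    exact G.inv_mem ha

/-- The exponents of the monomials that are invariant under a group with given exponents modulo
`r`. -/
def dualExponents (L : AddSubgroup (Fin 3 → ℤ)) (r : ℤ) : AddSubgroup (Fin 3 → ℤ) where
  carrier := {x | ∀ n ∈ L, r ∣ x ⬝ᵥ n}
  zero_mem' n _ := by rw [zero_dotProduct]; exact dvd_zero r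
  add_mem' ha hb n hn := by rw [add_dotProduct]; exact dvd_add (ha n hn) (hb n hn)
  neg_mem' ha n hn := by rw [neg_dotProduct]; exact (dvd_neg).2 (ha n hn)

variable {G : Subgroup (Matrix.GeneralLinearGroup (Fin 3) k)} {ζ : kˣ}

lemma mem_exponents {n : Fin 3 → ℤ} : n ∈ exponents G ζ ↔ diagGL (fun i => ζ ^ n i) ∈ G := Iff.rfl

lemma smul_mem_exponents (hζ : IsPrimitiveRoot ζ (Nat.card G)) (z : Fin 3 → ℤ) :
    (Nat.card G : ℤ) • z ∈ exponents G ζ := by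
  rw [mem_exponents]
  have : (fun i => ζ ^ ((Nat.card G : ℤ) • z) i) = 1 := funext fun i => by
    rw [Pi.smul_apply, smul_eq_mul, zpow_mul, zpow_natCast, hζ.pow_eq_one, one_zpow, Pi.one_apply]
  rw [this]
  exact diagGL_one_mem G

lemma exists_exponents [Finite G] (hdiag : ∀ g ∈ G, g.val.IsDiag)
    (hζ : IsPrimitiveRoot ζ (Nat.card G)) {g : Matrix.GeneralLinearGroup (Fin 3) k} (hg : g ∈ G) :
    ∃ n : Fin 3 → ℤ, g = diagGL fun i => ζ ^ n i := by
  have hd : Matrix.diagonal g.val.diag = g.val := Matrix.isDiag_iff_diagonal_diag _ |>.1 (hdiag g hg)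
  have hpow : g ^ Nat.card G = 1 := by
    have := pow_card_eq_one' (x := (⟨g, hg⟩ : G))
    exact congrArg Subtype.val this
  have : NeZero (Nat.card G) := ⟨Nat.card_pos.ne'⟩
  have hroot : ∀ i, ∃ n : ℤ, ((ζ ^ n : kˣ) : k) = g.val.diag i := by
    intro i
    have h1 : (g.val.diag i) ^ Nat.card G = 1 := by
      have h2 : g.val ^ Nat.card G = 1 := by rw [← Units.val_pow_eq_pow_val, hpow, Units.val_one]
      rw [← hd, Matrix.diagonal_pow] at h2
      have := congrFun (congrFun h2 i) i
      simpa using this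
    obtain ⟨n, -, hn⟩ := (IsPrimitiveRoot.coe_units_iff.2 hζ).eq_pow_of_pow_eq_one h1
    exact ⟨n, by rw [zpow_natCast, Units.val_pow_eq_pow_val, hn]⟩
  choose n hn using hroot
  refine ⟨n, Units.ext ?_⟩
  change g.val = Matrix.diagonal fun i => ((ζ ^ n i : kˣ) : k)
  simp only [hn]
  exact hd.symm

lemma coeff_linearSubst_diagGL (t : Fin 3 → kˣ) (f : MvPolynomial (Fin 3) k) (s : Fin 3 →₀ ℕ) :
    coeff s (linearSubst (diagGL t) f) = (∏ i, (t i : k) ^ s i) * coeff s f := by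
  have hX : ∀ i, (∑ j, C ((diagGL t).val i j) * X j : MvPolynomial (Fin 3) k) =
      C (t i : k) * X i := by
    intro i
    rw [Finset.sum_eq_single i]
    · simp [diagGL]
    · intro j _ hj
      simp [diagGL, Matrix.diagonal_apply_ne _ hj.symm]
    · simp
  induction f using MvPolynomial.induction_on' with
  | monomial v x =>
    have h1 : linearSubst (diagGL t) (monomial v x) = C (∏ i, (t i : k) ^ v i) * monomial v x := by
      rw [linearSubst, aeval_monomial]
      simp only [hX, mul_pow]
      rw [Finsupp.prod_fintype _ _ (by simp), Finset.prod_mul_distrib, monomial_eq,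
        Finsupp.prod_fintype _ _ (by simp), map_prod]
      simp only [map_pow, algebraMap_eq]
      ring
    rw [h1, coeff_C_mul]
    by_cases hvs : v = s
    · rw [hvs]
    · rw [coeff_monomial, if_neg hvs, mul_zero, mul_zero]
  | add p q hp hq => rw [map_add, coeff_add, hp, hq, coeff_add, mul_add]

lemma isToric_invariantRing [Finite G] (hdiag : ∀ g ∈ G, g.val.IsDiag)
    (hζ : IsPrimitiveRoot ζ (Nat.card G)) :
    IsToric (invariantRing G) (dualExponents (exponents G ζ) (Nat.card G)) (Nat.card G) where
  pos := Nat.card_pos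
  mem z n hn := by
    have : (fun i => (Nat.card G : ℤ) * z i) = (Nat.card G : ℤ) • z := rfl
    rw [this, smul_dotProduct, smul_eq_mul]
    exact dvd_mul_right _ _
  mem_iff f := by
    have hprod : ∀ (n : Fin 3 → ℤ) (s : Fin 3 →₀ ℕ),
        ∏ i, ((ζ ^ n i : kˣ) : k) ^ s i = ((ζ ^ (intExp s ⬝ᵥ n) : kˣ) : k) := by
      intro n s
      rw [dotProduct, Fin.sum_univ_three, Fin.prod_univ_three]
      have h1 : ∀ i, ((ζ ^ n i : kˣ) : k) ^ s i = ((ζ ^ (intExp s i * n i) : kˣ) : k) := fun i => by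
        rw [mul_comm, zpow_mul, intExp, zpow_natCast, Units.val_pow_eq_pow_val]
      rw [h1, h1, h1, zpow_add, zpow_add, Units.val_mul, Units.val_mul]
    have hone : ∀ (n : Fin 3 → ℤ) (s : Fin 3 →₀ ℕ),
        ∏ i, ((ζ ^ n i : kˣ) : k) ^ s i = 1 ↔ (Nat.card G : ℤ) ∣ intExp s ⬝ᵥ n := by
      intro n s
      rw [hprod, Units.val_eq_one, hζ.zpow_eq_one_iff_dvd]
    constructor
    · intro hf s hs n hn
      have h1 := congrArg (coeff s) (hf _ hn)
      rw [show (diagHom fun i => ζ ^ n i) = diagGL fun i => ζ ^ n i from rfl,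
        coeff_linearSubst_diagGL] at h1
      rw [← hone]
      exact mul_right_cancel₀ (mem_support_iff.1 hs) (by rw [h1, one_mul])
    · intro hf g hg
      obtain ⟨n, rfl⟩ := exists_exponents hdiag hζ hg
      ext s
      rw [coeff_linearSubst_diagGL]
      by_cases hs : s ∈ f.support
      · rw [(hone n s).2 (hf s hs n hg), one_mul]
      · rw [notMem_support_iff.1 hs, mul_zero]

/-- A diagonal matrix with one entry at most different from `1` is not in a small group, unless
it is the identity. -/
lemma IsSmall.dvd (hsmall : IsSmall G) (hζ : IsPrimitiveRoot ζ (Nat.card G)) {n : Fin 3 → ℤ}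
    (hn : n ∈ exponents G ζ) {i : Fin 3} (hi : ∀ j, j ≠ i → (Nat.card G : ℤ) ∣ n j) :
    (Nat.card G : ℤ) ∣ n i := by
  classical
  rw [← hζ.zpow_eq_one_iff_dvd]
  by_contra h1
  refine hsmall _ hn ?_
  have h2 : (diagHom fun i => ζ ^ n i).val - 1 =
      Matrix.diagonal fun i => ((ζ ^ n i : kˣ) : k) - 1 := by
    rw [← Matrix.diagonal_one, ← Matrix.diagonal_sub]
    rfl
  rw [h2, Matrix.rank_diagonal, Fintype.card_eq_one_iff]
  refine ⟨⟨i, ?_⟩, fun ⟨j, hj⟩ => ?_⟩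
  · rw [sub_ne_zero, Ne, Units.val_eq_one]
    exact h1
  · by_contra hne
    rw [Subtype.mk.injEq] at hne
    have := (hζ.zpow_eq_one_iff_dvd _).2 (hi j hne)
    rw [this] at hj
    simp at hj

/-- In a small cyclic group every coordinate is unramified. -/
lemma exists_dualExponents_eq_one [Finite G] [IsCyclic G] (hdiag : ∀ g ∈ G, g.val.IsDiag)
    (hsmall : IsSmall G) (hζ : IsPrimitiveRoot ζ (Nat.card G)) (i : Fin 3) :
    ∃ x ∈ dualExponents (exponents G ζ) (Nat.card G), x i = 1 := by
  obtain ⟨j, l, hij, hil, hjl⟩ : ∃ j l : Fin 3, i ≠ j ∧ i ≠ l ∧ j ≠ l := by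
    revert i; decide
  obtain ⟨⟨g, hg⟩, hgen⟩ := IsCyclic.exists_generator (α := G)
  obtain ⟨n, rfl⟩ := exists_exponents hdiag hζ hg
  have hr : (0 : ℤ) < Nat.card G := by exact_mod_cast Nat.card_pos
  -- The exponent of the generator is divisible by the common divisor of the other ones and `r`.
  set d := Int.gcd (Int.gcd (n j) (n l)) (Nat.card G) with hd
  have hdr : (d : ℤ) ∣ Nat.card G := Int.gcd_dvd_right _ _
  have hd1 : (d : ℤ) ∣ Int.gcd (n j) (n l) := Int.gcd_dvd_left _ _
  have hdj : (d : ℤ) ∣ n j := hd1.trans (Int.gcd_dvd_left _ _)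
  have hdl : (d : ℤ) ∣ n l := hd1.trans (Int.gcd_dvd_right _ _)
  obtain ⟨s, hs⟩ := hdr
  have hs0 : s ≠ 0 := by rintro rfl; omega
  have hdi : (d : ℤ) ∣ n i := by
    have h1 := hsmall.dvd hζ ((exponents G ζ).zsmul_mem (show n ∈ exponents G ζ from hg) s) (i := i) (by
      intro t ht
      rcases eq_or_eq_of_ne hij hil hjl t with rfl | rfl | rfl
      · exact absurd rfl ht
      · obtain ⟨c, hc⟩ := hdj
        exact ⟨c, by rw [Pi.smul_apply, smul_eq_mul, hc, hs]; ring⟩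
      · obtain ⟨c, hc⟩ := hdl
        exact ⟨c, by rw [Pi.smul_apply, smul_eq_mul, hc, hs]; ring⟩)
    rw [Pi.smul_apply, smul_eq_mul, hs, mul_comm] at h1
    exact (mul_dvd_mul_iff_left hs0).1 h1
  obtain ⟨c, hc⟩ := hdi
  have hb1 := Int.gcd_eq_gcd_ab (Int.gcd (n j) (n l)) (Nat.card G)
  have hb2 := Int.gcd_eq_gcd_ab (n j) (n l)
  rw [← hd] at hb1
  set p := Int.gcdA (Int.gcd (n j) (n l)) (Nat.card G)
  set q := Int.gcdB (Int.gcd (n j) (n l)) (Nat.card G)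
  set p' := Int.gcdA (n j) (n l)
  set q' := Int.gcdB (n j) (n l)
  have hxn : ∃ x : Fin 3 → ℤ, x i = 1 ∧ (Nat.card G : ℤ) ∣ x ⬝ᵥ n := by
    refine ⟨fun t => if t = i then 1 else if t = j then -(p * p' * c) else -(p * q' * c),
      by simp, q * c, ?_⟩
    rw [dotProduct_eq_of_ne hij hil hjl]
    simp only [if_true, if_neg hij.symm, if_neg hil.symm, if_neg hjl.symm]
    rw [hc]
    linear_combination c * hb1 + c * p * hb2
  obtain ⟨x, hxi, hx⟩ := hxn
  refine ⟨x, fun v hv => ?_, hxi⟩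
  obtain ⟨e, he⟩ := Subgroup.mem_zpowers_iff.1 (hgen ⟨_, hv⟩)
  have he' : (diagHom fun i => ζ ^ n i) ^ e = diagHom fun i => ζ ^ v i :=
    congrArg Subtype.val he
  rw [← map_zpow] at he'
  have hv' : ∀ t, (Nat.card G : ℤ) ∣ v t - e * n t := by
    intro t
    have := congrFun (diagGL_injective he') t
    rw [Pi.pow_apply, ← zpow_mul] at this
    rw [← hζ.zpow_eq_one_iff_dvd, zpow_sub, ← this, mul_comm e, mul_inv_cancel]
  have : x ⬝ᵥ v = e * (x ⬝ᵥ n) + (x 0 * (v 0 - e * n 0) + x 1 * (v 1 - e * n 1) +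
      x 2 * (v 2 - e * n 2)) := by
    simp only [dotProduct, Fin.sum_univ_three]
    ring
  rw [this]
  exact dvd_add (hx.mul_left _) (dvd_add (dvd_add ((hv' 0).mul_left _) ((hv' 1).mul_left _))
    ((hv' 2).mul_left _))

/-- The age of the nonidentity elements of the group is at least one, in the canonical case. -/
lemma card_le_sum_of_isCanonical [Finite G] [IsCyclic G] (hdiag : ∀ g ∈ G, g.val.IsDiag)
    (hsmall : IsSmall G) (hcan : IsCanonical k (invariantRing G) 3)
    (hζ : IsPrimitiveRoot ζ (Nat.card G)) {y : Fin 3 → ℤ} (hy : y ∈ exponents G ζ)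
    (hy0 : ∀ i, 0 ≤ y i) (hne : y ≠ 0) : (Nat.card G : ℤ) ≤ y 0 + y 1 + y 2 := by
  have T := isToric_invariantRing hdiag hζ
  have hr : (0 : ℝ) < Nat.card G := by exact_mod_cast Nat.card_pos
  by_cases h2 : ∃ i j, i ≠ j ∧ 0 < y i ∧ 0 < y j
  · obtain ⟨i, j, hij, hi, hj⟩ := h2
    have h1 := T.one_le_sum hcan (fun i => by
      obtain ⟨x, hx, hxi⟩ := exists_dualExponents_eq_one hdiag hsmall hζ i
      exact ⟨⟨x, hx⟩, hxi⟩) (y := fun i => (y i : ℝ) / Nat.card G)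
      (fun i => div_nonneg (by exact_mod_cast hy0 i) hr.le) (fun a => by
        obtain ⟨n, hn⟩ := a.2 y hy
        refine ⟨n, ?_⟩
        have h3 : (((a : Fin 3 → ℤ) ⬝ᵥ y : ℤ) : ℝ) = (Nat.card G : ℝ) * n := by
          rw [hn]; push_cast; rfl
        rw [dotProduct] at h3
        push_cast at h3
        have h4 : ∑ i, (y i : ℝ) / Nat.card G * ((a : Fin 3 → ℤ) i : ℝ) =
            (∑ i, ((a : Fin 3 → ℤ) i : ℝ) * y i) / Nat.card G := by
          rw [Finset.sum_div]
          exact Finset.sum_congr rfl fun i _ => by ring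
        rw [h4, h3, mul_div_cancel_left₀ _ hr.ne'])
      hij (div_pos (by exact_mod_cast hi) hr) (div_pos (by exact_mod_cast hj) hr)
    rw [← Finset.sum_div, le_div_iff₀ hr, one_mul, Fin.sum_univ_three] at h1
    exact_mod_cast h1
  · push Not at h2
    obtain ⟨i, hi⟩ : ∃ i, y i ≠ 0 := by
      by_contra h
      push Not at h
      exact hne (funext h)
    have hi0 : 0 < y i := lt_of_le_of_ne (hy0 i) hi.symm
    have hz : ∀ j, j ≠ i → y j = 0 := fun j hj =>
      le_antisymm (h2 i j hj.symm hi0) (hy0 j)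
    have h3 := hsmall.dvd hζ hy (i := i) fun j hj => by rw [hz j hj]; exact dvd_zero _
    have h4 := Int.le_of_dvd hi0 h3
    have := hy0 0
    have := hy0 1
    have := hy0 2
    fin_cases i <;> simp at h4 <;> omega

lemma mem_latticeN [Finite G] (hζ : IsPrimitiveRoot ζ (Nat.card G)) {y : Fin 3 → ℝ} :
    y ∈ latticeN G ζ ↔ ∃ n ∈ exponents G ζ, y = fun i => (n i : ℝ) / (Nat.card G : ℝ) := by
  have hr : (Nat.card G : ℝ) ≠ 0 := by exact_mod_cast Nat.card_pos.ne'
  constructor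
  · intro hy
    induction hy using AddSubgroup.closure_induction with
    | mem y hy =>
      rcases hy with ⟨z, rfl⟩ | ⟨a, ha, rfl⟩
      · refine ⟨_, smul_mem_exponents hζ z, funext fun i => ?_⟩
        simp only [Pi.smul_apply, smul_eq_mul]
        push_cast
        rw [mul_div_cancel_left₀ _ hr]
      · exact ⟨a, ha, rfl⟩
    | zero => exact ⟨0, AddSubgroup.zero_mem _, by ext i; simp⟩
    | add x y _ _ hx hy =>
      obtain ⟨m, hm, rfl⟩ := hx
      obtain ⟨n, hn, rfl⟩ := hy
      exact ⟨m + n, AddSubgroup.add_mem _ hm hn, by ext i; simp [add_div]⟩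
    | neg x _ hx =>
      obtain ⟨m, hm, rfl⟩ := hx
      exact ⟨-m, AddSubgroup.neg_mem _ hm, by ext i; simp [neg_div]⟩
  · rintro ⟨n, hn, rfl⟩
    exact AddSubgroup.subset_closure (Or.inr ⟨n, hn, rfl⟩)

lemma mem_of_mem_hilbertBasis {B : AddSubmonoid (Fin 3 → ℝ)} {w : Fin 3 → ℝ}
    (hw : w ∈ hilbertBasis B) : w ∈ B :=
  hw B (AddSubmonoid.closure_eq B)

/-- The elements of the Hilbert basis are irreducible: otherwise they could be left out. -/
lemma eq_of_mem_hilbertBasis {B : AddSubmonoid (Fin 3 → ℝ)} {w p q : Fin 3 → ℝ}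
    (hw : w ∈ hilbertBasis B) (hp : p ∈ B) (hq : q ∈ B) (h : w = p + q) (hp0 : p ≠ 0) : w = p := by
  by_contra hwp
  have hq0 : w ≠ q := by
    rintro rfl
    exact hp0 (by simpa using h)
  have := hw ((B : Set (Fin 3 → ℝ)) \ {w}) (le_antisymm
    ((AddSubmonoid.closure_mono Set.sdiff_subset).trans (AddSubmonoid.closure_eq B).le) (by
      intro x hx
      by_cases hxw : x = w
      · have hpq := add_mem
          (AddSubmonoid.subset_closure (s := (B : Set (Fin 3 → ℝ)) \ {w}) ⟨hp, fun e => hwp e.symm⟩)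
          (AddSubmonoid.subset_closure (s := (B : Set (Fin 3 → ℝ)) \ {w}) ⟨hq, fun e => hq0 e.symm⟩)
        rw [← h] at hpq
        rwa [hxw]
      · exact AddSubmonoid.subset_closure ⟨hx, hxw⟩))
  exact this.2 rfl

lemma ne_zero_of_mem_hilbertBasis {B : AddSubmonoid (Fin 3 → ℝ)} {w : Fin 3 → ℝ}
    (hw : w ∈ hilbertBasis B) : w ≠ 0 := by
  rintro rfl
  have := hw ((B : Set (Fin 3 → ℝ)) \ {0}) (le_antisymm
    ((AddSubmonoid.closure_mono Set.sdiff_subset).trans (AddSubmonoid.closure_eq B).le) (by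
      intro x hx
      by_cases hx0 : x = 0
      · rw [hx0]; exact zero_mem _
      · exact AddSubmonoid.subset_closure ⟨hx, hx0⟩))
  exact this.2 rfl

/-- A level one point gives a lattice point in the level one polyhedron. -/
lemma HasLevelOnePoint.nonempty [Finite G] (hζ : IsPrimitiveRoot ζ (Nat.card G)) {n : Fin 3 → ℤ}
    (h : HasLevelOnePoint (exponents G ζ) (Nat.card G) n) :
    (levelPolyhedron (fun i => (n i : ℝ) / (Nat.card G : ℝ)) 1 ∩
      dualLattice (latticeN G ζ)).Nonempty := by
  have hr : (Nat.card G : ℝ) ≠ 0 := by exact_mod_cast Nat.card_pos.ne'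
  obtain ⟨x, hx0, hx, hxn⟩ := h
  have key : ∀ v : Fin 3 → ℤ, (fun i => (x i : ℝ)) ⬝ᵥ (fun i => (v i : ℝ) / (Nat.card G : ℝ)) =
      ((x ⬝ᵥ v : ℤ) : ℝ) / Nat.card G := by
    intro v
    simp only [dotProduct]
    push_cast
    rw [Finset.sum_div]
    exact Finset.sum_congr rfl fun i _ => by ring
  refine ⟨fun i => x i, ⟨fun y hy => ?_, ?_⟩, fun y hy => ?_⟩
  · exact Finset.sum_nonneg fun i _ => 
      mul_nonneg (show (0 : ℝ) ≤ (x i : ℝ) by exact_mod_cast hx0 i) (hy i)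
  · change _ ⬝ᵥ _ = _
    rw [key, hxn]
    push_cast
    exact div_self hr
  · obtain ⟨v, hv, rfl⟩ := (mem_latticeN hζ).1 hy
    obtain ⟨t, ht⟩ := hx v hv
    exact ⟨t, by rw [key, ht]; push_cast; rw [mul_div_cancel_left₀ _ hr]⟩

/-- A coordinate that takes the value one on a unit vector can be made nonnegative. -/
lemma hasLevelOnePoint_single [Finite G] [IsCyclic G] (hdiag : ∀ g ∈ G, g.val.IsDiag)
    (hsmall : IsSmall G) (hζ : IsPrimitiveRoot ζ (Nat.card G)) (i : Fin 3) :
    HasLevelOnePoint (exponents G ζ) (Nat.card G)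
      ((Nat.card G : ℤ) • (Pi.single i 1 : Fin 3 → ℤ)) := by
  have hr : (1 : ℤ) ≤ Nat.card G := by exact_mod_cast Nat.card_pos
  obtain ⟨x, hx, hxi⟩ := exists_dualExponents_eq_one hdiag hsmall hζ i
  refine ⟨x + (Nat.card G : ℤ) • (fun j => if j = i then 0 else |x j|), fun j => ?_,
    fun n hn => ?_, ?_⟩
  · simp only [Pi.add_apply, Pi.smul_apply, smul_eq_mul]
    split_ifs with hj
    · rw [hj, hxi]; norm_num
    · nlinarith [neg_abs_le (x j), abs_nonneg (x j)]
  · rw [add_dotProduct, smul_dotProduct, smul_eq_mul]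
    exact dvd_add (hx n hn) (dvd_mul_right _ _)
  · rw [dotProduct_smul_single]
    simp [hxi]

lemma exists_perm_of_ne {i j l : Fin 3} (hij : i ≠ j) (hil : i ≠ l) (hjl : j ≠ l) :
    ∃ π : Equiv.Perm (Fin 3), π i = 0 ∧ π j = 2 ∧ π l = 1 := by
  revert i j l
  decide

lemma isOfType_of_isFourteen [Finite G] (hdiag : ∀ g ∈ G, g.val.IsDiag)
    (hζ : IsPrimitiveRoot ζ (Nat.card G)) {n : Fin 3 → ℤ}
    (h : IsFourteen (exponents G ζ) (Nat.card G) n) : IsOfType G 14 ![1, 9, 11] := by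
  obtain ⟨-, i, j, l, hij, hil, hjl, y, hy, hi, hj, hl, hgen⟩ := h
  obtain ⟨q, hq⟩ : ∃ q : ℕ, (q : ℤ) = y i := ⟨(y i).toNat, Int.toNat_of_nonneg (by omega)⟩
  have hr : Nat.card G = q * 14 := by omega
  obtain ⟨π, hπi, hπj, hπl⟩ := exists_perm_of_ne hij hil hjl
  refine ⟨ζ ^ q, hζ.pow Nat.card_pos hr, π, ?_⟩
  have hyq : ∀ t, y t = q * (![1, 9, 11] (π t) : ℕ) := by
    intro t
    rcases eq_or_eq_of_ne hij hil hjl t with rfl | rfl | rfl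
    · rw [hπi]; simp; omega
    · rw [hπj]; simp; omega
    · rw [hπl]; simp; omega
  have hg0 : (diagGL fun t => (ζ ^ q) ^ (![1, 9, 11] (π t) : ℕ)) = diagHom fun t => ζ ^ y t := by
    change diagGL _ = diagGL _
    congr 1
    funext t
    rw [hyq, ← pow_mul, ← zpow_natCast]
    push_cast
    rfl
  rw [hg0]
  refine le_antisymm (fun g hg => ?_) ?_
  · obtain ⟨v, rfl⟩ := exists_exponents hdiag hζ hg
    obtain ⟨z, e, rfl⟩ := hgen v hg
    refine Subgroup.mem_zpowers_iff.2 ⟨e, ?_⟩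
    rw [← map_zpow]
    change diagGL _ = diagGL _
    congr 1
    funext t
    simp only [Pi.pow_apply, Pi.add_apply, Pi.smul_apply, smul_eq_mul]
    rw [zpow_add, zpow_mul, zpow_natCast, hζ.pow_eq_one, one_zpow, one_mul, ← zpow_mul, mul_comm]
  · rw [Subgroup.zpowers_le]
    exact hy

/-- For the group of type `1/14 (1, 9, 11)` no invariant monomial has degree two. -/
lemma levelPolyhedron_inter_eq_empty [Finite G] (hζ : IsPrimitiveRoot ζ (Nat.card G))
    (hG : IsOfType G 14 ![1, 9, 11]) :
    levelPolyhedron ![7 / 14, 7 / 14, 7 / 14] 1 ∩ dualLattice (latticeN G ζ) = ∅ := by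
  obtain ⟨ξ, hξ, π, hπ⟩ := hG
  have hcard : Nat.card G = 14 := by
    rw [hπ, Nat.card_zpowers]
    refine (orderOf_eq_iff (by norm_num)).2 ⟨?_, fun m hm hm0 h => ?_⟩
    · change (diagHom _) ^ 14 = 1
      rw [← map_pow, ← map_one diagHom]
      congr 1
      funext t
      rw [Pi.pow_apply, ← pow_mul, mul_comm, pow_mul, hξ.pow_eq_one, one_pow, Pi.one_apply]
    · change (diagHom _) ^ m = 1 at h
      rw [← map_pow, ← map_one diagHom] at h
      have := congrFun (diagGL_injective h) (π.symm 0)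
      rw [Pi.pow_apply, Equiv.apply_symm_apply, Pi.one_apply] at this
      simp only [Matrix.cons_val_zero, pow_one] at this
      exact absurd (Nat.le_of_dvd hm0 ((hξ.pow_eq_one_iff_dvd m).1 this)) (by omega)
  rw [hcard] at hζ
  rw [Set.eq_empty_iff_forall_notMem]
  rintro x ⟨⟨hx0, hx1⟩, hxN⟩
  have hζ' : IsPrimitiveRoot ζ (Nat.card G) := by rwa [hcard]
  have hint : ∀ i, ∃ z : ℤ, x i = z := by
    intro i
    have hmem : (Pi.single i 1 : Fin 3 → ℝ) ∈ latticeN G ζ :=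
      AddSubgroup.subset_closure (Or.inl ⟨Pi.single i 1, by
        ext j
        by_cases hj : j = i
        · subst hj; simp
        · simp [hj]⟩)
    obtain ⟨z, hz⟩ := hxN _ hmem
    exact ⟨z, by rw [← hz, dotProduct_single, mul_one]⟩
  choose z hz using hint
  have hz0 : ∀ i, 0 ≤ z i := by
    intro i
    have := hx0 (Pi.single i 1) (fun j => by
      by_cases hj : j = i
      · subst hj; simp
      · simp [hj])
    rw [dotProduct_single, mul_one, hz] at this
    exact_mod_cast this
  have hsum : z 0 + z 1 + z 2 = 2 := by
    change x ⬝ᵥ _ = 1 at hx1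
    simp only [dotProduct, Fin.sum_univ_three, Matrix.cons_val_zero, Matrix.cons_val_one,
      Matrix.cons_val, hz] at hx1
    have : (z 0 : ℝ) + z 1 + z 2 = 2 := by linarith
    exact_mod_cast this
  -- The generator has exponents `t (1, 9, 11)` with respect to `ζ`, where `t` is a unit.
  obtain ⟨t, -, ht⟩ := (IsPrimitiveRoot.coe_units_iff.2 hζ).eq_pow_of_pow_eq_one
    (ξ := (ξ : k)) (by rw [← Units.val_pow_eq_pow_val, hξ.pow_eq_one, Units.val_one])
  have htξ : ζ ^ t = ξ := Units.ext (by rw [Units.val_pow_eq_pow_val, ht])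
  have htc : t.Coprime 14 := by
    rw [← hζ.pow_iff_coprime (by norm_num), htξ]
    exact hξ
  have hmem : (fun i => ((t * (![1, 9, 11] (π i) : ℕ) : ℕ) : ℤ)) ∈ exponents G ζ := by
    rw [mem_exponents, hπ]
    simp only [zpow_natCast, pow_mul, htξ]
    exact Subgroup.mem_zpowers _
  obtain ⟨e, he⟩ := hxN _ ((mem_latticeN hζ').2 ⟨_, hmem, rfl⟩)
  rw [hcard] at he
  simp only [dotProduct, Fin.sum_univ_three, hz] at he
  have hdvd : (14 : ℤ) ∣ t * (z 0 * (![1, 9, 11] (π 0) : ℕ) + z 1 * (![1, 9, 11] (π 1) : ℕ) +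
      z 2 * (![1, 9, 11] (π 2) : ℕ)) := by
    refine ⟨e, ?_⟩
    have : (t : ℝ) * (z 0 * (![1, 9, 11] (π 0) : ℕ) + z 1 * (![1, 9, 11] (π 1) : ℕ) +
      z 2 * (![1, 9, 11] (π 2) : ℕ)) = 14 * e := by
      rw [← he]
      push_cast
      ring
    exact_mod_cast this
  have hcop : IsCoprime (14 : ℤ) t := by
    have := Nat.isCoprime_iff_coprime.2 htc.symm
    exact_mod_cast this
  have hdvd' := hcop.dvd_of_dvd_mul_left hdvd
  have h0 := hz0 0
  have h1 := hz0 1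
  have h2 := hz0 2
  have hb : z 0 ≤ 2 ∧ z 1 ≤ 2 ∧ z 2 ≤ 2 := by omega
  revert hdvd'
  obtain ⟨b0, b1, b2⟩ := hb
  obtain ⟨p, hp⟩ : ∃ p, p = π 0 := ⟨_, rfl⟩
  obtain ⟨q, hq⟩ : ∃ q, q = π 1 := ⟨_, rfl⟩
  obtain ⟨s, hs⟩ : ∃ s, s = π 2 := ⟨_, rfl⟩
  have hpq : p ≠ q := by rw [hp, hq]; exact π.injective.ne (by decide)
  have hps : p ≠ s := by rw [hp, hs]; exact π.injective.ne (by decide)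
  have hqs : q ≠ s := by rw [hq, hs]; exact π.injective.ne (by decide)
  rw [← hp, ← hq, ← hs]
  clear hz hz0 hx0 hx1 hxN he hdvd
  generalize z 0 = x at *
  generalize z 1 = y at *
  generalize z 2 = v at *
  have hx : x = 0 ∨ x = 1 ∨ x = 2 := by omega
  have hy : y = 0 ∨ y = 1 ∨ y = 2 := by omega
  fin_cases p <;> fin_cases q <;> fin_cases s <;> simp at hpq hps hqs ⊢ <;>
    rcases hx with rfl | rfl | rfl <;> rcases hy with rfl | rfl | rfl <;> omega

end

end QuotSing

end

theorem theorem4p12 {k : Type*} [Field k] [IsAlgClosed k]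
    (G : Subgroup (Matrix.GeneralLinearGroup (Fin 3) k)) [Finite G] [IsCyclic G]
    (hchar : (Nat.card G : k) ≠ 0)
    (hdiag : ∀ g ∈ G, g.val.IsDiag)
    (hsmall : QuotSing.IsSmall G)
    (hcan : QuotSing.IsCanonical k (QuotSing.invariantRing G) 3)
    (ζ : kˣ) (hζ : IsPrimitiveRoot ζ (Nat.card G))
    (w : Fin 3 → ℝ)
    (hw : w ∈ QuotSing.hilbertBasis
      (QuotSing.coneσ 3 ⊓ (QuotSing.latticeN G ζ).toAddSubmonoid)) :
    QuotSing.levelPolyhedron w 1 ∩ QuotSing.dualLattice (QuotSing.latticeN G ζ) = ∅ ↔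
      QuotSing.IsOfType G 14 ![1, 9, 11] ∧ w = ![7 / 14, 7 / 14, 7 / 14] := by
  have hr : (0 : ℝ) < Nat.card G := by exact_mod_cast Nat.card_pos
  have hrz : (0 : ℤ) < Nat.card G := by exact_mod_cast Nat.card_pos
  refine ⟨fun hempty => ?_, fun ⟨hG, hw'⟩ => ?_⟩
  · obtain ⟨hwσ, hwN⟩ := QuotSing.mem_of_mem_hilbertBasis hw
    obtain ⟨n, hn, rfl⟩ := (QuotSing.mem_latticeN hζ).1 hwN
    have hnot : ¬ QuotSing.HasLevelOnePoint (QuotSing.exponents G ζ) (Nat.card G) n := fun h =>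
      (h.nonempty hζ).ne_empty hempty
    have hirr : QuotSing.IsIrreducibleElement (QuotSing.exponents G ζ) (Nat.card G) n :=
      { mem := hn
        nonneg := fun i => by
          have h1 : (0 : ℝ) ≤ (n i : ℝ) / Nat.card G := hwσ i
          have h2 := mul_nonneg h1 hr.le
          rw [div_mul_cancel₀ _ hr.ne'] at h2
          exact_mod_cast h2
        ne_zero := by
          rintro rfl
          exact QuotSing.ne_zero_of_mem_hilbertBasis hw (by ext i; simp)
        eq_of_le := fun y hy hy0 hle hne => by
          have hp : (fun i => (y i : ℝ) / (Nat.card G : ℝ)) ≠ 0 := by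
            intro h0
            refine hne (funext fun i => ?_)
            have := congrFun h0 i
            simp only [Pi.zero_apply, div_eq_zero_iff, hr.ne', or_false] at this
            exact_mod_cast this
          have := QuotSing.eq_of_mem_hilbertBasis hw (p := fun i => (y i : ℝ) / (Nat.card G : ℝ))
            (q := fun i => ((n - y) i : ℝ) / (Nat.card G : ℝ))
            ⟨fun i => div_nonneg (by exact_mod_cast hy0 i) hr.le,
              (QuotSing.mem_latticeN hζ).2 ⟨y, hy, rfl⟩⟩
            ⟨fun i => div_nonneg (by
                have := hle i
                simp only [Pi.sub_apply]
                push_cast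
                exact sub_nonneg.2 (by exact_mod_cast this)) hr.le,
              (QuotSing.mem_latticeN hζ).2 ⟨n - y, AddSubgroup.sub_mem _ hn hy, rfl⟩⟩
            (by ext i; simp [← add_div]) hp
          funext i
          have h1 := congrFun this i
          simp only [div_left_inj' hr.ne'] at h1
          exact_mod_cast h1
        ne_single := by
          rintro i rfl
          exact hnot (QuotSing.hasLevelOnePoint_single hdiag hsmall hζ i) }
    have h14 := (QuotSing.hasLevelOnePoint_or_isFourteen hrz (QuotSing.smul_mem_exponents hζ)
      (fun y hy hy0 hne => QuotSing.card_le_sum_of_isCanonical hdiag hsmall hcan hζ hy hy0 hne)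
      hirr).resolve_left hnot
    refine ⟨QuotSing.isOfType_of_isFourteen hdiag hζ h14, funext fun i => ?_⟩
    have h2 : (2 : ℝ) * n i = Nat.card G := by exact_mod_cast h14.1 i
    have h3 : (n i : ℝ) / Nat.card G = 7 / 14 := by
      rw [div_eq_iff hr.ne', ← h2]
      ring
    fin_cases i <;> simpa using h3
  · rw [hw']
    exact QuotSing.levelPolyhedron_inter_eq_empty hζ hG
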